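/- Let $r,t,n\ge 1$ be integers. A combinatorial $n$-fold IP is given by a matrix $D\in\mathbb Z^{r\times t}$, vectors $b\in\mathbb Z^{r+n}$, $l,u\in\mathbb Z^{nt}$ and a separable convex function $f:\mathbb Z^{nt}\to\mathbb Z$, i.e. $f(x)=\sum_{i=1}^n\sum_{j=1}^t f^i_j(x^i_j)$ with every $f^i_j:\mathbb Z\to\mathbb Z$ convex, where $f$ is represented by an evaluation oracle. It is the problem $$\min\{f(x)\mid E^{(n)}x=b,\ l\le x\le u,\ x\in\mathbb Z^{nt}\},\qquad E^{(n)}=\begin{pmatrix}D&D&\cdots&D\\ \mathbf 1^{\intercal}&0&\cdots&0\\ 0&\mathbf 1^{\intercal}&\cdots&0\\ \vdots&\vdots&\ddots&\vdots\\ 0&0&\cdots&\mathbf 1^{\intercal}\end{pmatrix},$$ where $\mathbf 1^{\intercal}=(1\ \cdots\ 1)\in\mathbb Z^{1\times t}$. Let $\Delta=1+\|D\|_\infty$, where $\|D\|_\infty$ is the largest absolute value of an entry of $D$, and let $L=\langle b,l,u,f\rangle$ be the total length of the binary encodings of the entries of $b$, $l$, $u$ and of the number $\max_{l\le x\le u}|f(x)|$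 (read as $0$ if no $x$ satisfies $l\le x\le u$). An optimization oracle for the continuous relaxation returns, for a separable convex function $F:\mathbb R^{nt}\to\mathbb R$ that extends $f$, an optimal solution of $\min\{F(x)\mid E^{(n)}x=b,\ l\le x\le u,\ x\in\mathbb R^{nt}\}$, or reports that this problem is infeasible. Time is the number of elementary steps of a random access machine: memory accesses, additions, subtractions and comparisons of integers, roundings (up or down) of an entry of the vector returned by the optimization oracle, and calls to the evaluation oracle each count as one step. There is one algorithm that solves every combinatorial $n$-fold IP, i.e. finds a minimizer or reports correctly that the IP is infeasible, in time $$t^{O(r)}\,(\Delta r)^{O(r^2)}\,O(n^3L)+\mathsf{oo},$$ where $\mathsf{oo}$ is the time required for one call to the optimization oracle for the continuous relaxation of the given IP, and the constants hidden in the $O$-notation are absolute. -/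

import Mathlib

noncomputable section

namespace CombNFold

/-! ### Combinatorial `n`-fold integer programs -/

/-- The `n`-fold product of the bimatrix with upper part `D` and lower part `A`: a row of `n` copies
of `D` above the block diagonal matrix with `n` diagonal blocks `A`. The variables are indexed by
pairs (brick, position in the brick). -/
def nFoldProduct {r s t : ℕ} (n : ℕ) (D : Matrix (Fin r) (Fin t) ℤ) (A : Matrix (Fin s) (Fin t) ℤ) :
    Matrix (Fin r ⊕ Fin n × Fin s) (Fin n × Fin t) ℤ :=
  Matrix.of fun row col =>
    match row with
    | Sum.inl p => D p col.2
    | Sum.inr (i, q) => if i = col.1 then A q col.2 else 0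

/-- The row vector `(1 ⋯ 1)` of length `t`, as a matrix. -/
def onesRow (t : ℕ) : Matrix (Fin 1) (Fin t) ℤ := Matrix.of fun _ _ => 1

/-- `f : ℤ^{nt} → ℤ` is a sum of univariate convex functions `ℤ → ℤ`. -/
def IsSeparableConvex {n t : ℕ} (f : (Fin n × Fin t → ℤ) → ℤ) : Prop :=
  ∃ φ : Fin n × Fin t → ℤ → ℤ,
    (∀ k z, φ k z - φ k (z - 1) ≤ φ k (z + 1) - φ k z) ∧ ∀ x, f x = ∑ k, φ k (x k)

/-- `F : ℝ^{nt} → ℝ` is a separable convex function that agrees with `f` on the integer points. -/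
def IsSeparableConvexExtension {n t : ℕ} (f : (Fin n × Fin t → ℤ) → ℤ)
    (F : (Fin n × Fin t → ℝ) → ℝ) : Prop :=
  (∃ φ : Fin n × Fin t → ℝ → ℝ,
    (∀ k, ConvexOn ℝ Set.univ (φ k)) ∧ ∀ x, F x = ∑ k, φ k (x k)) ∧
  ∀ x : Fin n × Fin t → ℤ, F (fun k => (x k : ℝ)) = (f x : ℝ)

/-- A combinatorial `n`-fold IP
`min {f(x) | E⁽ⁿ⁾ x = b, l ≤ x ≤ u, x ∈ ℤ^{nt}}` with `E = (D over (1 ⋯ 1))`. -/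
structure Instance (r t n : ℕ) where
  D : Matrix (Fin r) (Fin t) ℤ
  b : Fin r ⊕ Fin n × Fin 1 → ℤ
  l : Fin n × Fin t → ℤ
  u : Fin n × Fin t → ℤ
  f : (Fin n × Fin t → ℤ) → ℤ
  separableConvex : IsSeparableConvex f

namespace Instance

variable {r t n : ℕ}

/-- The constraint matrix `E⁽ⁿ⁾`. -/
def E (I : Instance r t n) : Matrix (Fin r ⊕ Fin n × Fin 1) (Fin n × Fin t) ℤ :=
  nFoldProduct n I.D (onesRow t)

def Feasible (I : Instance r t n) (x : Fin n × Fin t → ℤ) : Prop :=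
  I.E.mulVec x = I.b ∧ I.l ≤ x ∧ x ≤ I.u

def IsMinimizer (I : Instance r t n) (x : Fin n × Fin t → ℤ) : Prop :=
  I.Feasible x ∧ ∀ y, I.Feasible y → I.f x ≤ I.f y

/-- Feasibility for the continuous relaxation. -/
def RelaxFeasible (I : Instance r t n) (x : Fin n × Fin t → ℝ) : Prop :=
  (I.E.map (fun z : ℤ => (z : ℝ))).mulVec x = (fun q => (I.b q : ℝ)) ∧
    ∀ k, (I.l k : ℝ) ≤ x k ∧ x k ≤ (I.u k : ℝ)

/-- `ans` is a correct answer of an optimization oracle for the continuous relaxation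
`min {F(x) | E⁽ⁿ⁾ x = b, l ≤ x ≤ u, x ∈ ℝ^{nt}}`: `none` if there is no feasible point,
and some optimal solution otherwise. -/
def IsRelaxationAnswer (I : Instance r t n) (F : (Fin n × Fin t → ℝ) → ℝ) :
    Option (Fin n × Fin t → ℝ) → Prop
  | none => ¬ ∃ x, I.RelaxFeasible x
  | some x => I.RelaxFeasible x ∧ ∀ y, I.RelaxFeasible y → F x ≤ F y

/-- `Δ = 1 + ‖D‖_∞`, where `‖D‖_∞` is the largest absolute value of an entry. -/
def Delta (I : Instance r t n) : ℕ :=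
  1 + Finset.univ.sup fun p : Fin r × Fin t => (I.D p.1 p.2).natAbs

/-- The number of bits of the binary encoding of an integer (one bit for the sign). -/
def encLength (z : ℤ) : ℕ := 1 + z.natAbs.size

/-- The maximum of `|f x|` over the integer points of the box `l ≤ x ≤ u` (`0` for an empty box). -/
def fMax (I : Instance r t n) : ℕ := (Finset.Icc I.l I.u).sup fun x => (I.f x).natAbs

/-- `L = ⟨b, l, u, f⟩`. -/
def size (I : Instance r t n) : ℕ :=
  (∑ q, encLength (I.b q)) + (∑ k, encLength (I.l k)) + (∑ k, encLength (I.u k)) +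
    encLength (I.fMax : ℤ)

end Instance

/-! ### The machine model

A random access machine whose memory consists of integer registers `var 0, var 1, …` and of integer
arrays `arr 0, arr 1, …` with two integer indices (a program mentions finitely many of them),
programmed in a structured language. Apart from constants and memory access, it can only add,
subtract and test for positivity, and every such elementary operation has cost one; there is no
multiplication. The objective function is accessed through an evaluation oracle, one call of which
has cost one. A call to the optimization oracle for the continuous relaxation costs `oo` and stores
the optimal solution, a real vector, in a bank of real registers, which can only be accessed by
rounding an entry down or up. -/

structure State where
  var : ℕ → ℤ
  arr : ℕ → ℤ → ℤ → ℤ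
  real : ℤ → ℤ → ℝ

inductive Expr where
  | const (z : ℤ)
  | var (v : ℕ)
  | get (a : ℕ) (i j : Expr)
  | add (e₁ e₂ : Expr)
  | sub (e₁ e₂ : Expr)
  | floor (i j : Expr)
  | ceil (i j : Expr)

namespace Expr

def eval (s : State) : Expr → ℤ
  | const z => z
  | var v => s.var v
  | get a i j => s.arr a (i.eval s) (j.eval s)
  | add e₁ e₂ => e₁.eval s + e₂.eval s
  | sub e₁ e₂ => e₁.eval s - e₂.eval s
  | floor i j => ⌊s.real (i.eval s) (j.eval s)⌋
  | ceil i j => ⌈s.real (i.eval s) (j.eval s)⌉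

/-- The number of operations in an expression. -/
def cost : Expr → ℕ
  | const _ => 1
  | var _ => 1
  | get _ i j => i.cost + j.cost + 1
  | add e₁ e₂ => e₁.cost + e₂.cost + 1
  | sub e₁ e₂ => e₁.cost + e₂.cost + 1
  | floor i j => i.cost + j.cost + 1
  | ceil i j => i.cost + j.cost + 1

end Expr

/-- Programs. -/
inductive Cmd where
  | skip
  /-- `var v := e` -/
  | assign (v : ℕ) (e : Expr)
  /-- `arr a [i, j] := e` -/
  | store (a : ℕ) (i j e : Expr)
  | seq (c₁ c₂ : Cmd)
  /-- `if e > 0 then c₁ else c₂` -/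
  | ite (e : Expr) (c₁ c₂ : Cmd)
  /-- `while e > 0 do c` -/
  | loop (e : Expr) (c : Cmd)
  /-- `var v := f(x)`, where `x` is the vector stored in the array `a` -/
  | evalObj (v a : ℕ)
  /-- call of the optimization oracle for the continuous relaxation; `var v` becomes `1` if it
  returns a solution and `0` if it reports infeasibility -/
  | relax (v : ℕ)

/-- A vector or matrix stored in a two-dimensional array, with zeros outside. -/
def embed {α : Type} [Zero α] {m k : ℕ} (M : Fin m × Fin k → α) : ℤ → ℤ → α := fun i j =>
  if h : (0 ≤ i ∧ i < m) ∧ (0 ≤ j ∧ j < k) then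
    M (⟨i.toNat, by omega⟩, ⟨j.toNat, by omega⟩)
  else 0

/-- The vector in `ℤ^{nt}` read off from a two-dimensional array. -/
def readVec (n t : ℕ) (A : ℤ → ℤ → ℤ) : Fin n × Fin t → ℤ := fun k => A (k.1 : ℕ) (k.2 : ℕ)

namespace State

def setVar (s : State) (v : ℕ) (z : ℤ) : State where
  var := fun v' => if v' = v then z else s.var v'
  arr := s.arr
  real := s.real

def setArr (s : State) (a : ℕ) (i j z : ℤ) : State where
  var := s.var
  arr := fun a' i' j' => if a' = a ∧ i' = i ∧ j' = j then z else s.arr a' i' j'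
  real := s.real

/-- The effect of a call to the optimization oracle with answer `ans`. -/
def setRelax {n t : ℕ} (s : State) (v : ℕ) : Option (Fin n × Fin t → ℝ) → State
  | none => s.setVar v 0
  | some x => { s.setVar v 1 with real := embed x }

end State

/-- `Exec f ans oo c s T s'`: started in state `s`, the program `c` halts in state `s'` after time
exactly `T`, where the evaluation oracle evaluates `f` and the optimization oracle answers `ans` at
a cost of `oo` per call. -/
inductive Exec {n t : ℕ} (f : (Fin n × Fin t → ℤ) → ℤ) (ans : Option (Fin n × Fin t → ℝ))
    (oo : ℕ) : Cmd → State → ℕ → State → Prop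
  | skip (s : State) : Exec f ans oo Cmd.skip s 1 s
  | assign (v : ℕ) (e : Expr) (s : State) :
      Exec f ans oo (Cmd.assign v e) s (e.cost + 1) (s.setVar v (e.eval s))
  | store (a : ℕ) (i j e : Expr) (s : State) :
      Exec f ans oo (Cmd.store a i j e) s (i.cost + j.cost + e.cost + 1)
        (s.setArr a (i.eval s) (j.eval s) (e.eval s))
  | seq {c₁ c₂ : Cmd} {s s₁ s₂ : State} {T₁ T₂ : ℕ} :
      Exec f ans oo c₁ s T₁ s₁ → Exec f ans oo c₂ s₁ T₂ s₂ →
      Exec f ans oo (Cmd.seq c₁ c₂) s (T₁ + T₂) s₂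
  | iteTrue {e : Expr} {c₁ c₂ : Cmd} {s s₁ : State} {T : ℕ} :
      0 < e.eval s → Exec f ans oo c₁ s T s₁ →
      Exec f ans oo (Cmd.ite e c₁ c₂) s (e.cost + 1 + T) s₁
  | iteFalse {e : Expr} {c₁ c₂ : Cmd} {s s₁ : State} {T : ℕ} :
      ¬ 0 < e.eval s → Exec f ans oo c₂ s T s₁ →
      Exec f ans oo (Cmd.ite e c₁ c₂) s (e.cost + 1 + T) s₁
  | loopTrue {e : Expr} {c : Cmd} {s s₁ s₂ : State} {T₁ T₂ : ℕ} :
      0 < e.eval s → Exec f ans oo c s T₁ s₁ → Exec f ans oo (Cmd.loop e c) s₁ T₂ s₂ →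
      Exec f ans oo (Cmd.loop e c) s (e.cost + 1 + T₁ + T₂) s₂
  | loopFalse {e : Expr} {c : Cmd} {s : State} :
      ¬ 0 < e.eval s → Exec f ans oo (Cmd.loop e c) s (e.cost + 1) s
  | evalObj (v a : ℕ) (s : State) :
      Exec f ans oo (Cmd.evalObj v a) s 1 (s.setVar v (f (readVec n t (s.arr a))))
  | relax (v : ℕ) (s : State) :
      Exec f ans oo (Cmd.relax v) s oo (s.setRelax v ans)

/-- The machine is deterministic: final state and running time are unique. -/
theorem Exec.unique {n t : ℕ} {f : (Fin n × Fin t → ℤ) → ℤ} {ans : Option (Fin n × Fin t → ℝ)}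
    {oo : ℕ} {c : Cmd} {s s₁ s₂ : State} {T₁ T₂ : ℕ} (h₁ : Exec f ans oo c s T₁ s₁)
    (h₂ : Exec f ans oo c s T₂ s₂) : T₁ = T₂ ∧ s₁ = s₂ := by
  induction h₁ generalizing T₂ s₂ with
  | skip => cases h₂; simp
  | assign => cases h₂; simp
  | store => cases h₂; simp
  | evalObj => cases h₂; simp
  | relax => cases h₂; simp
  | seq _ _ ih₁ ih₂ =>
    cases h₂ with
    | seq a b =>
      obtain ⟨rfl, rfl⟩ := ih₁ a
      obtain ⟨rfl, rfl⟩ := ih₂ b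
      simp
  | iteTrue h _ ih =>
    cases h₂ with
    | iteTrue _ a => obtain ⟨rfl, rfl⟩ := ih a; simp
    | iteFalse h' _ => exact absurd h h'
  | iteFalse h _ ih =>
    cases h₂ with
    | iteTrue h' _ => exact absurd h' h
    | iteFalse _ a => obtain ⟨rfl, rfl⟩ := ih a; simp
  | loopTrue h _ _ ih₁ ih₂ =>
    cases h₂ with
    | loopTrue _ a b =>
      obtain ⟨rfl, rfl⟩ := ih₁ a
      obtain ⟨rfl, rfl⟩ := ih₂ b
      simp
    | loopFalse h' => exact absurd h h'
  | loopFalse h =>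
    cases h₂ with
    | loopTrue h' _ _ => exact absurd h' h
    | loopFalse _ => simp

namespace Instance

variable {r t n : ℕ}

/-- The initial memory: `r`, `t`, `n` in the registers `0`, `1`, `2`; `D` in the array `0`;
the right hand side of the upper rows in column `0` of the array `1` and that of the lower rows in
column `0` of the array `2`; `l` and `u` in the arrays `3` and `4`; zeros elsewhere. -/
def initState (I : Instance r t n) : State where
  var v := if v = 0 then (r : ℤ) else if v = 1 then (t : ℤ) else if v = 2 then (n : ℤ) else 0
  arr a :=
    if a = 0 then embed (fun p : Fin r × Fin t => I.D p.1 p.2)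
    else if a = 1 then embed (fun p : Fin r × Fin 1 => I.b (Sum.inl p.1))
    else if a = 2 then embed (fun p : Fin n × Fin 1 => I.b (Sum.inr p))
    else if a = 3 then embed I.l
    else if a = 4 then embed I.u
    else 0
  real := 0

/-- The final state `s` holds a solution of the IP: register `0` is `1` and the array `0` holds a
minimizer, or register `0` is `0` and the IP is infeasible. (As `l` and `u` are finite, the IP is
never unbounded.) -/
def SolvedBy (I : Instance r t n) (s : State) : Prop :=
  (s.var 0 = 1 ∧ I.IsMinimizer (readVec n t (s.arr 0))) ∨
    (s.var 0 = 0 ∧ ¬ ∃ x, I.Feasible x)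

end Instance

end CombNFold

end

/-! Small kernel steps. After adding one slack variable per upper constraint, the difference of two
solutions is a kernel vector of the constraint matrix extended by unit columns. Such a vector is a
sum of unit moves of matching sign: shifts of one unit inside a brick, and changes of one slack
variable by one. Each move has an image in `ℤ^r` of norm at most `2Δ`, and the images add up to
zero. By the Steinitz lemma the images can be ordered so that all partial sums stay in a box of side
`O(rΔ)`. As soon as there are more than `(4Δr+1)^r` moves, two partial sums coincide, and the moves
between them form a shorter kernel vector. Hence below every nonzero kernel vector lies one of norm
at most `G = 2(4Δr+1)^r`, a bound free of `n` and `t` (`exists_small_kernel_element`).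

Augmentation. A separable convex function is superadditive along sign-compatible decompositions. So
if `z` is optimal, the gap between the current `x` and `z` is at most `‖z - x‖₁` times the gain of
the best step of norm at most `G` (`improvement_bound`). If `N` bounds the total width of the box,
each best step removes the fraction `1/N` of the gap, and `N * e` steps close an integral gap below
`2^e` (`Fuel`).

Finding a best step. A dynamic program fixes the variables one by one. Its state consists of the
image of the partial vector under `D`, the running sum of the bricks and a norm budget. All entries
are bounded by `V = ΔG`, so they pack into one integer in base `2V+1`. The running sum has to return
to zero at the end of each brick, so a single extra digit handles all `n` brick constraints
(`inKer_iff_layerBound`). A layer has at most `(G+1)(2V+1)^(r+1)` states, and the machine needs only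
additions once the weights are tabulated.

Proximity. The same argument, applied to the real difference of a continuous optimum and a
minimizer, with the part that contains no unit move treated as filler, gives a minimizer at distance
at most `(nt+1)G + 2nt` from the continuous optimum (`Instance.exists_minimizer_near`). The search
may therefore be confined to a box of radius `W = (nt+1)(G+2)` around a rounding of that optimum.
Then `N` is quadratic in `n`, one step takes time linear in `n`, and `e` is at most `L + rΔ`;
together this gives `n³L`.

The algorithm rounds the continuous optimum so that the brick sums persist, records the violations
of the upper constraints as slacks, drives the slacks to zero by augmentation, and, if this
succeeds, optimizes `f` by augmentation with slacks fixed at zero. The rest of the file expresses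
this in the machine language. `Run` is a total correctness statement with a time bound, `Agree` is
the frame rule, and `Run.straight` and `Run.forUp` reduce programs to invariants. -/

namespace CombNFold

open Finset

/-! ### The Steinitz lemma -/

section Steinitz

variable {ι : Type*} {d : ℕ}

/-- Weights in `[0, 1]` supported on `A` with total weight `c` and weighted sum zero. -/
def weightPolytope (A : Finset ι) (v : ι → Fin d → ℝ) (c : ℝ) : Set (ι → ℝ) :=
  {μ | (∀ i, μ i ∈ Set.Icc (0 : ℝ) 1) ∧ (∀ i ∉ A, μ i = 0) ∧ ∑ i ∈ A, μ i = c ∧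
    ∀ p, ∑ i ∈ A, μ i * v i p = 0}

/-- Compactness is what makes an extreme point available in `exists_removable`. -/
theorem isCompact_weightPolytope (A : Finset ι) (v : ι → Fin d → ℝ) (c : ℝ) :
    IsCompact (weightPolytope A v c) := by
  have hK : IsCompact (Set.pi Set.univ fun _ : ι => Set.Icc (0 : ℝ) 1) :=
    isCompact_univ_pi fun _ => isCompact_Icc
  have hc : IsClosed (weightPolytope A v c) := by
    have : weightPolytope A v c = (⋂ i, {μ : ι → ℝ | μ i ∈ Set.Icc (0 : ℝ) 1}) ∩
        ((⋂ i, ⋂ (_ : i ∉ A), {μ : ι → ℝ | μ i = 0}) ∩ ({μ : ι → ℝ | ∑ i ∈ A, μ i = c} ∩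
        ⋂ p, {μ : ι → ℝ | ∑ i ∈ A, μ i * v i p = 0})) := by
      ext μ; simp [weightPolytope]
    rw [this]
    refine IsClosed.inter (isClosed_iInter fun i => ?_) (IsClosed.inter
      (isClosed_iInter fun i => isClosed_iInter fun _ => ?_) (IsClosed.inter ?_
      (isClosed_iInter fun p => ?_)))
    · exact isClosed_Icc.preimage (continuous_apply i)
    · exact isClosed_eq (continuous_apply i) continuous_const
    · exact isClosed_eq (by fun_prop) continuous_const
    · exact isClosed_eq (by fun_prop) continuous_const
  refine hK.of_isClosed_subset hc ?_
  intro μ hμ i _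
  exact hμ.1 i

variable [DecidableEq ι]

/-- A linear relation with coefficient sum zero among more than `d + 1` vectors of `ℝ^d`. -/
theorem exists_relation (S : Finset ι) (v : ι → Fin d → ℝ) (hS : d + 1 < #S) :
    ∃ c : ι → ℝ, (∀ i ∉ S, c i = 0) ∧ (∃ i, c i ≠ 0) ∧ ∑ i ∈ S, c i = 0 ∧
      ∀ p, ∑ i ∈ S, c i * v i p = 0 := by
  -- The appended coordinate `1` turns the condition on the coefficient sum into part of a linear
  -- dependence in dimension `d + 1`.
  let w : S → (Fin d → ℝ) × ℝ := fun i => (v i, 1)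
  have hw : ¬ LinearIndependent ℝ w := by
    intro h
    have := h.fintype_card_le_finrank
    simp at this
    omega
  obtain ⟨g, hg, i₀, hi₀⟩ := Fintype.not_linearIndependent_iff.1 hw
  have hsum : ∀ u : ι → ℝ, ∑ i ∈ S, (if h : i ∈ S then g ⟨i, h⟩ else 0) * u i =
      ∑ i : S, g i * u i := by
    intro u
    rw [← Finset.sum_coe_sort S]
    exact Finset.sum_congr rfl fun i _ => by simp
  refine ⟨fun i => if h : i ∈ S then g ⟨i, h⟩ else 0, fun i hi => by simp [hi],
    ⟨i₀, by simpa using hi₀⟩, ?_, fun p => ?_⟩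
  · have := congrArg Prod.snd hg
    have h2 := hsum fun _ => 1
    simp only [mul_one] at h2
    rw [h2]
    simpa [w, Prod.snd_sum] using this
  · rw [hsum fun i => v i p]
    have := congrFun (congrArg Prod.fst hg) p
    simpa [w, Prod.fst_sum, Finset.sum_apply] using this

/-- An extreme point of the weight polytope has at most `d + 1` fractional entries. -/
theorem card_fractional_le {A : Finset ι} {v : ι → Fin d → ℝ} {c : ℝ} {μ : ι → ℝ}
    (hμ : μ ∈ (weightPolytope A v c).extremePoints ℝ) :
    #{i ∈ A | 0 < μ i ∧ μ i < 1} ≤ d + 1 := by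
  by_contra! hlt
  set S := {i ∈ A | 0 < μ i ∧ μ i < 1} with hS
  obtain ⟨g, hg0, ⟨i₀, hi₀⟩, hg1, hg2⟩ := exists_relation S v hlt
  have hSA : S ⊆ A := Finset.filter_subset _ _
  have hA1 : ∑ i ∈ A, g i = 0 := by
    rw [← hg1]; exact (Finset.sum_subset hSA fun i _ h => hg0 i h).symm
  have hA2 : ∀ p, ∑ i ∈ A, g i * v i p = 0 := fun p => by
    rw [← hg2 p]; exact (Finset.sum_subset hSA fun i _ h => by simp [hg0 i h]).symm
  -- Room to move by `±ε g` without leaving `[0, 1]`: only fractional entries change, since `g`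
  -- vanishes off `S`. The `1 +` in the denominator avoids division by zero.
  obtain ⟨ε, hε, hεμ⟩ : ∃ ε > 0, ∀ i ∈ S, ε * |g i| ≤ μ i ∧ ε * |g i| ≤ 1 - μ i := by
    have hne : S.Nonempty := Finset.card_pos.1 (by omega)
    let F : ι → ℝ := fun i => min (μ i) (1 - μ i) / (1 + |g i|)
    refine ⟨S.inf' hne F, ?_, fun i hi => ?_⟩
    · rw [gt_iff_lt, Finset.lt_inf'_iff]
      intro i hi
      have := (Finset.mem_filter.1 hi).2
      have h1 : 0 < min (μ i) (1 - μ i) := lt_min this.1 (by linarith)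
      positivity
    · have h1 : S.inf' hne F ≤ F i := Finset.inf'_le _ hi
      have h2 := abs_nonneg (g i)
      have hi' := (Finset.mem_filter.1 hi).2
      have h0 : 0 < min (μ i) (1 - μ i) := lt_min hi'.1 (by linarith)
      have h3 : S.inf' hne F * |g i| ≤ min (μ i) (1 - μ i) := by
        calc S.inf' hne F * |g i| ≤ F i * |g i| := by gcongr
          _ ≤ F i * (1 + |g i|) := by
            have : 0 ≤ F i := by positivity
            nlinarith
          _ = min (μ i) (1 - μ i) := by simp only [F]; field_simp
      exact ⟨h3.trans (min_le_left _ _), h3.trans (min_le_right _ _)⟩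
  have key : ∀ e : ℝ, |e| = ε → (fun i => μ i + e * g i) ∈ weightPolytope A v c := by
    intro e he
    refine ⟨fun i => ?_, fun i hi => ?_, ?_, fun p => ?_⟩
    · by_cases hi : i ∈ S
      · have h1 := hεμ i hi
        have h2 : |e * g i| = ε * |g i| := by rw [abs_mul, he]
        have h3 := abs_le.1 h2.le
        constructor <;> simp only <;> linarith
      · simpa [hg0 i hi] using hμ.1.1 i
    · simp only
      rw [hμ.1.2.1 i hi, hg0 i fun h => hi (hSA h)]; simp
    · rw [Finset.sum_add_distrib, ← Finset.mul_sum, hA1, hμ.1.2.2.1]; simp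
    · simp only [add_mul, Finset.sum_add_distrib, mul_assoc]
      rw [← Finset.mul_sum, hA2 p, hμ.1.2.2.2 p]; simp
  have h1 := key ε (abs_of_pos hε)
  have h2 := key (-ε) (by rw [abs_neg, abs_of_pos hε])
  have hext := hμ.2 h1 h2 ⟨1 / 2, 1 / 2, by norm_num, by norm_num, by norm_num, by
    ext i; simp; ring⟩
  have := congrFun hext i₀
  simp at this
  rcases this with h | h
  · linarith
  · exact hi₀ h

variable [Fintype ι]

/-- One step of the Steinitz construction: an element can be removed. -/
theorem exists_removable (A : Finset ι) (v : ι → Fin d → ℝ) (hA : d < #A) (μ : ι → ℝ)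
    (hμ : μ ∈ weightPolytope A v (#A - d)) :
    ∃ a ∈ A, ∃ μ', μ' ∈ weightPolytope (A.erase a) v (#(A.erase a) - d) := by
  have hA' : (d : ℝ) + 1 ≤ #A := by exact_mod_cast hA
  have hne : (weightPolytope A v (#A - 1 - d)).Nonempty := by
    -- Scaling keeps the weighted sum zero and lowers the total weight by one, to the value required
    -- after a removal.
    set θ : ℝ := (#A - 1 - d) / (#A - d) with hθ
    have hpos : (0 : ℝ) < #A - d := by linarith
    have h0 : 0 ≤ θ := div_nonneg (by linarith) hpos.le
    have h1 : θ ≤ 1 := (div_le_one hpos).2 (by linarith)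
    refine ⟨fun i => θ * μ i, fun i => ?_, fun i hi => ?_, ?_, fun p => ?_⟩
    · exact ⟨mul_nonneg h0 (hμ.1 i).1, mul_le_one₀ h1 (hμ.1 i).1 (hμ.1 i).2⟩
    · simp [hμ.2.1 i hi]
    · rw [← Finset.mul_sum, hμ.2.2.1, hθ]; field_simp
    · simp only [mul_assoc]; rw [← Finset.mul_sum, hμ.2.2.2 p]; simp
  obtain ⟨ν, hν⟩ := (isCompact_weightPolytope A v _).extremePoints_nonempty hne
  have hcard := card_fractional_le hν
  -- If no weight vanished, all but at most `d + 1` weights would equal `1` and the others would be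
  -- positive, so the total would exceed `#A - 1 - d`.
  obtain ⟨a, haA, ha⟩ : ∃ a ∈ A, ν a = 0 := by
    by_contra! hnz
    have hlow : ∀ i ∈ A, (1 : ℝ) - (if 0 < ν i ∧ ν i < 1 then 1 else 0) ≤ ν i := by
      intro i hi
      have h01 := hν.1.1 i
      have : 0 < ν i := lt_of_le_of_ne h01.1 (hnz i hi).symm
      by_cases h1 : ν i < 1
      · simp [this, h1]; exact this.le
      · simp [h1]; linarith
    have hsum := hν.1.2.2.1
    have e1 : ∑ i ∈ A, ((1 : ℝ) - (if 0 < ν i ∧ ν i < 1 then 1 else 0)) =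
        #A - #{i ∈ A | 0 < ν i ∧ ν i < 1} := by
      rw [Finset.sum_sub_distrib]; simp
    have hc : (#{i ∈ A | 0 < ν i ∧ ν i < 1} : ℝ) ≤ d + 1 := by exact_mod_cast hcard
    rcases Finset.eq_empty_or_nonempty {i ∈ A | 0 < ν i ∧ ν i < 1} with he | ⟨j, hj⟩
    · have := Finset.sum_le_sum hlow
      rw [e1, hsum, he] at this
      simp at this
      have : (0 : ℝ) ≤ d := by positivity
      linarith
    · have hj' := Finset.mem_filter.1 hj
      have := Finset.sum_lt_sum hlow ⟨j, hj'.1, by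
        rw [if_pos hj'.2]; linarith [hj'.2.1]⟩
      rw [e1, hsum] at this
      linarith
  have herase : ∀ w : ι → ℝ, ∑ i ∈ A.erase a, ν i * w i = ∑ i ∈ A, ν i * w i := by
    intro w
    rw [← Finset.add_sum_erase A _ haA, ha]; simp
  refine ⟨a, haA, ν, hν.1.1, fun i hi => ?_, ?_, fun p => ?_⟩
  · by_cases h : i = a
    · rw [h, ha]
    · exact hν.1.2.1 i fun h' => hi (Finset.mem_erase.2 ⟨h, h'⟩)
  · have := herase fun _ => 1
    simp only [mul_one] at this
    rw [this, hν.1.2.2.1, Finset.card_erase_of_mem haA, Nat.cast_sub (by omega)]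
    simp
  · rw [herase fun i => v i p, hν.1.2.2.2 p]

/-- The order is built from the end: remove an element that leaves an admissible weighting, put it
last and recurse. Every prefix is then a set that carries weights of total `#A - d`, or has at most
`d` elements, and either property bounds its sum. -/
theorem exists_order_of_weights (v : ι → Fin d → ℝ) (M : ℝ) (hM : 0 ≤ M)
    (hv : ∀ i p, |v i p| ≤ M) (A : Finset ι)
    (hA : #A ≤ d ∨ ∃ μ, μ ∈ weightPolytope A v (#A - d)) :
    ∃ pos : ι → ℕ, (∀ i ∈ A, pos i < #A) ∧ Set.InjOn pos A ∧
      ∀ k p, |∑ i ∈ A with pos i < k, v i p| ≤ d * M := by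
  induction hn : #A generalizing A with
  | zero =>
    rw [Finset.card_eq_zero] at hn
    subst hn
    exact ⟨fun _ => 0, by simp, by simp, fun k p => by simp; positivity⟩
  | succ N ih =>
    have htot : ∀ p, |∑ i ∈ A, v i p| ≤ d * M := by
      intro p
      rcases hA with h | ⟨μ, hμ⟩
      · calc |∑ i ∈ A, v i p| ≤ ∑ i ∈ A, |v i p| := Finset.abs_sum_le_sum_abs _ _
          _ ≤ ∑ i ∈ A, M := Finset.sum_le_sum fun i _ => hv i p
          _ = #A * M := by simp
          _ ≤ d * M := by gcongr
      -- The complementary weights `1 - μ i` are nonnegative and total `#A - (#A - d) = d`.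
      · have h1 : ∑ i ∈ A, v i p = ∑ i ∈ A, (1 - μ i) * v i p := by
          simp only [sub_mul, one_mul, Finset.sum_sub_distrib, hμ.2.2.2 p, sub_zero]
        rw [h1]
        calc |∑ i ∈ A, (1 - μ i) * v i p| ≤ ∑ i ∈ A, |(1 - μ i) * v i p| :=
              Finset.abs_sum_le_sum_abs _ _
          _ ≤ ∑ i ∈ A, (1 - μ i) * M := Finset.sum_le_sum fun i _ => by
              have := (hμ.1 i).2
              rw [abs_mul, abs_of_nonneg (by linarith : 0 ≤ 1 - μ i)]
              exact mul_le_mul_of_nonneg_left (hv i p) (by linarith)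
          _ = d * M := by
              rw [← Finset.sum_mul, Finset.sum_sub_distrib, hμ.2.2.1]; simp
    obtain ⟨a, haA, ha⟩ : ∃ a ∈ A, #(A.erase a) ≤ d ∨
        ∃ μ, μ ∈ weightPolytope (A.erase a) v (#(A.erase a) - d) := by
      rcases Nat.lt_or_ge d #A with h | h
      · rcases hA with h' | ⟨μ, hμ⟩
        · omega
        · obtain ⟨a, haA, h⟩ := exists_removable A v h μ hμ
          exact ⟨a, haA, Or.inr h⟩
      · obtain ⟨a, haA⟩ : A.Nonempty := Finset.card_pos.1 (by omega)
        exact ⟨a, haA, Or.inl (by rw [Finset.card_erase_of_mem haA]; omega)⟩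
    have hce : #(A.erase a) = N := by rw [Finset.card_erase_of_mem haA]; omega
    obtain ⟨pos, hpos, hinj, hbd⟩ := ih (A.erase a) ha hce
    have hpa : ∀ i ∈ A, i ≠ a → Function.update pos a N i = pos i ∧ pos i < N := by
      intro i hi hia
      exact ⟨by simp [hia], by
        have := hpos i (Finset.mem_erase.2 ⟨hia, hi⟩); omega⟩
    refine ⟨Function.update pos a N, fun i hi => ?_, ?_, fun k p => ?_⟩
    · by_cases h : i = a
      · subst h; simp
      · have := hpa i hi h; omega
    · intro i hi j hj hij
      by_cases h : i = a <;> by_cases h' : j = a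
      · rw [h, h']
      · have := hpa j hj h'
        rw [this.1, h] at hij; simp at hij; omega
      · have := hpa i hi h
        rw [this.1, h'] at hij; simp at hij; omega
      · rw [(hpa i hi h).1, (hpa j hj h').1] at hij
        exact hinj (Finset.mem_coe.2 (Finset.mem_erase.2 ⟨h, hi⟩))
          (Finset.mem_coe.2 (Finset.mem_erase.2 ⟨h', hj⟩)) hij
    · rcases Nat.lt_or_ge N k with hk | hk
      · have : {i ∈ A | Function.update pos a N i < k} = A := by
          apply Finset.filter_true_of_mem
          intro i hi
          by_cases h : i = a
          · subst h; simpa using hk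
          · have := hpa i hi h; omega
        rw [this]; exact htot p
      · have : {i ∈ A | Function.update pos a N i < k} = {i ∈ A.erase a | pos i < k} := by
          ext i
          simp only [Finset.mem_filter, Finset.mem_erase]
          by_cases h : i = a
          · subst h; simp; omega
          · simp [h]
        rw [this]; exact hbd k p

/-- **Steinitz lemma** for the maximum norm: vectors of norm at most `M` in `ℝ^d` with sum zero can
be ordered so that all partial sums have norm at most `d * M`. -/
theorem steinitz (v : ι → Fin d → ℝ) (M : ℝ) (hM : 0 ≤ M) (hv : ∀ i p, |v i p| ≤ M)
    (hsum : ∀ p, ∑ i, v i p = 0) :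
    ∃ pos : ι → ℕ, Function.Injective pos ∧ ∀ k p, |∑ i with pos i < k, v i p| ≤ d * M := by
  -- For the whole family, equal weights `(N - d) / N` are admissible because the vectors sum to
  -- zero.
  have : #(Finset.univ : Finset ι) ≤ d ∨
      ∃ μ, μ ∈ weightPolytope (Finset.univ : Finset ι) v (#(Finset.univ : Finset ι) - d) := by
    rcases Nat.lt_or_ge d #(Finset.univ : Finset ι) with h | h
    · right
      set N := #(Finset.univ : Finset ι)
      have hN : (d : ℝ) + 1 ≤ N := by exact_mod_cast h
      have hd : (0 : ℝ) ≤ d := by positivity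
      have hN0 : (0 : ℝ) < N := by linarith
      refine ⟨fun _ => (N - d) / N, fun i => ⟨div_nonneg (by linarith) hN0.le,
        (div_le_one hN0).2 (by linarith)⟩, fun i hi => absurd (Finset.mem_univ i) hi, ?_,
        fun p => ?_⟩
      · rw [Finset.sum_const, nsmul_eq_mul]
        change (N : ℝ) * _ = _
        field_simp
      · rw [← Finset.mul_sum, hsum p, mul_zero]
    · exact Or.inl h
  obtain ⟨pos, -, hinj, hbd⟩ := exists_order_of_weights v M hM hv Finset.univ this
  exact ⟨pos, fun i j hij => hinj (by simp) (by simp) hij, hbd⟩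

end Steinitz

/-! ### Zero-sum subfamilies -/

section ZeroSum

variable {ι : Type*} [DecidableEq ι] {d : ℕ}

/-- Integer vectors of norm at most `M` whose sum has norm at most `q * M`: if there are many of
them, then a nonempty proper subfamily has sum zero. -/
theorem exists_zero_sum_subset [Fintype ι] (v : ι → Fin d → ℤ) (M q : ℕ) (hv : ∀ i p, |v i p| ≤ M)
    (w : Fin d → ℝ) (hw : ∀ p, |w p| ≤ q * M) (hsum : ∀ p, (∑ i, (v i p : ℝ)) + w p = 0)
    (hcard : (q + 1) * (2 * M * d + 1) ^ d < Fintype.card ι) :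
    ∃ A : Finset ι, A.Nonempty ∧ A ≠ Finset.univ ∧ ∀ p, ∑ i ∈ A, v i p = 0 := by
  -- The remainder `w` is cut into `q` equal filler vectors of norm at most `M`, so that the
  -- enlarged family sums to zero and the Steinitz lemma applies.
  let V : ι ⊕ Fin q → Fin d → ℝ := Sum.elim (fun i p => (v i p : ℝ)) (fun _ p => w p / q)
  have hV : ∀ i p, |V i p| ≤ (M : ℝ) := by
    rintro (i | i) p
    · simp only [V, Sum.elim_inl]; exact_mod_cast hv i p
    · have hq : (0 : ℝ) < q := by exact_mod_cast (Fin.pos i)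
      simp only [V, Sum.elim_inr]
      rw [abs_div, abs_of_pos hq, div_le_iff₀ hq, mul_comm]; exact hw p
  have hVs : ∀ p, ∑ i, V i p = 0 := by
    intro p
    rw [Fintype.sum_sum_type]
    simp only [V, Sum.elim_inl, Sum.elim_inr, Finset.sum_const, Finset.card_univ, Fintype.card_fin,
      nsmul_eq_mul]
    rcases Nat.eq_zero_or_pos q with h | h
    · have h0 : w p = 0 := by have := hw p; rw [h] at this; simpa using this
      have := hsum p
      rw [h0] at this
      simpa [h] using this
    · have hq : (0 : ℝ) < q := by exact_mod_cast h
      rw [mul_div_cancel₀ _ hq.ne']; exact hsum p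
  obtain ⟨pos, hinj, hbd⟩ := steinitz V M (by positivity) hV hVs
  let cnt : ι → ℕ := fun i => #{j : Fin q | pos (Sum.inr j) < pos (Sum.inl i) + 1}
  let S : ι → Fin d → ℤ := fun i p => ∑ j with pos (Sum.inl j) < pos (Sum.inl i) + 1, v j p
  have hS : ∀ i p, |(S i p : ℝ) + cnt i * (w p / q)| ≤ d * M := by
    intro i p
    have h := hbd (pos (Sum.inl i) + 1) p
    have e : ∑ j with pos j < pos (Sum.inl i) + 1, V j p = (S i p : ℝ) + cnt i * (w p / q) := by
      rw [Finset.sum_filter, Fintype.sum_sum_type, ← Finset.sum_filter, ← Finset.sum_filter]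
      simp only [V, Sum.elim_inl, Sum.elim_inr, Finset.sum_const, nsmul_eq_mul, S, cnt]
      push_cast; rfl
    rwa [e] at h
  have hcntq : ∀ i, cnt i < q + 1 := fun i => by
    have := Finset.card_le_univ ({j : Fin q | pos (Sum.inr j) < pos (Sum.inl i) + 1})
    simp only [Fintype.card_fin] at this
    simp only [cnt]; omega
  -- Given the number of fillers in a prefix, its integer part lies in an interval of length `2 * d
  -- * M` in each coordinate. This leaves `2 * M * d + 1` integers, counted from `lo`.
  let lo : ℕ → Fin d → ℤ := fun c p => ⌈-(c * (w p / q)) - d * M⌉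
  have hlo : ∀ i p, 0 ≤ S i p - lo (cnt i) p ∧ S i p - lo (cnt i) p < 2 * M * d + 1 := by
    intro i p
    have h := abs_le.1 (hS i p)
    constructor
    · rw [sub_nonneg, Int.ceil_le]; linarith
    · have h2 : -(cnt i * (w p / q)) - d * M ≤ lo (cnt i) p := Int.le_ceil _
      have h3 : (S i p : ℝ) - lo (cnt i) p ≤ 2 * M * d := by linarith
      have : S i p - lo (cnt i) p ≤ 2 * M * d := by exact_mod_cast h3
      omega
  let key : ι → Fin (q + 1) × (Fin d → Fin (2 * M * d + 1)) := fun i =>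
    (⟨cnt i, hcntq i⟩, fun p => ⟨(S i p - lo (cnt i) p).toNat,
      (Int.toNat_lt (hlo i p).1).2 (by push_cast; exact (hlo i p).2)⟩)
  obtain ⟨i, j, hij, hkey⟩ := Fintype.exists_ne_map_eq_of_card_lt key (by simpa using hcard)
  wlog hlt : pos (Sum.inl i) < pos (Sum.inl j) generalizing i j
  · refine this j i hij.symm hkey.symm ?_
    rcases lt_trichotomy (pos (Sum.inl i)) (pos (Sum.inl j)) with h | h | h
    · exact absurd h hlt
    · exact absurd (Sum.inl_injective (hinj h)) hij
    · exact h
  have hc : cnt i = cnt j := by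
    have := congrArg Prod.fst hkey; simpa [key] using this
  have hSS : ∀ p, S i p = S j p := by
    intro p
    have h := congrFun (congrArg Prod.snd hkey) p
    simp only [key, Fin.mk.injEq] at h
    have h1 := hlo i p
    have h2 := hlo j p
    rw [← hc] at h h2
    omega
  -- Two prefixes with equally many fillers and equal integer sums differ by a zero-sum family. It
  -- contains `j` and omits `i`, hence is nonempty and proper.
  refine ⟨Finset.univ.filter fun k =>
    pos (Sum.inl i) < pos (Sum.inl k) ∧ pos (Sum.inl k) < pos (Sum.inl j) + 1,
    ⟨j, by simpa using hlt⟩, fun h => ?_, fun p => ?_⟩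
  · have := (Finset.ext_iff.1 h i).2 (Finset.mem_univ _)
    simp at this
  · have h1 := hSS p
    simp only [S] at h1
    have h2 : (Finset.univ.filter fun k => pos (Sum.inl k) < pos (Sum.inl j) + 1) =
        (Finset.univ.filter fun k => pos (Sum.inl k) < pos (Sum.inl i) + 1) ∪
        Finset.univ.filter fun k =>
          pos (Sum.inl i) < pos (Sum.inl k) ∧ pos (Sum.inl k) < pos (Sum.inl j) + 1 := by
      ext k
      simp only [Finset.mem_filter, Finset.mem_univ, true_and, Finset.mem_union]
      omega
    rw [h2, Finset.sum_union] at h1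
    · linarith
    · rw [Finset.disjoint_filter]; intro k _ _; omega

/-- A family of integer vectors with sum zero has a nonempty zero-sum subfamily of bounded size. -/
theorem exists_small_zero_sum (v : ι → Fin d → ℤ) (M : ℕ) (hv : ∀ i p, |v i p| ≤ M)
    (A : Finset ι) (hA : A.Nonempty) (hsum : ∀ p, ∑ i ∈ A, v i p = 0) :
    ∃ A' ⊆ A, A'.Nonempty ∧ (∀ p, ∑ i ∈ A', v i p = 0) ∧ #A' ≤ (2 * M * d + 1) ^ d := by
  induction hn : #A using Nat.strong_induction_on generalizing A with
  | _ N ih =>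
    rcases Nat.lt_or_ge ((2 * M * d + 1) ^ d) #A with h | h
    -- No filler is needed here: with `q = 0` a family that is too large has a proper zero-sum
    -- subfamily, and strong induction on the size continues with it.
    · obtain ⟨C, hCne, hCu, hC⟩ := exists_zero_sum_subset (ι := A) (fun i => v i) M 0
        (fun i p => hv i p) 0 (by simp) (fun p => by
          have := hsum p
          rw [← Finset.sum_coe_sort] at this
          simp only [Pi.zero_apply, add_zero]
          exact_mod_cast this) (by simpa using h)
      have hlt : #(C.map (Function.Embedding.subtype _)) < #A := by
        rw [Finset.card_map]
        have := Finset.card_lt_univ_of_notMem (s := C)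
          (x := (by
            have : ∃ x, x ∉ C := by
              by_contra! h'; exact hCu (Finset.eq_univ_iff_forall.2 h')
            exact this.choose)) (by
            have : ∃ x, x ∉ C := by
              by_contra! h'; exact hCu (Finset.eq_univ_iff_forall.2 h')
            exact this.choose_spec)
        simpa using this
      obtain ⟨A', hA', h1, h2, h3⟩ := ih _ (hn ▸ hlt) (C.map (Function.Embedding.subtype _))
        (by simpa using hCne) (fun p => by rw [Finset.sum_map]; exact hC p) rfl
      refine ⟨A', fun x hx => ?_, h1, h2, h3⟩
      have := hA' hx
      simp only [Finset.mem_map, Function.Embedding.subtype_apply] at this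
      obtain ⟨y, -, rfl⟩ := this
      exact y.2
    · exact ⟨A, Finset.Subset.refl _, hA, hsum, h⟩

end ZeroSum

/-! ### Small elements below a kernel element -/

section Conformal

variable {d : ℕ}

/-- The integer vector `g` has the sign pattern of `y` and is bounded by it in absolute value. -/
def Conformal (g : ℕ → ℤ) (y : ℕ → ℝ) : Prop :=
  ∀ k, (0 ≤ g k ∧ (g k : ℝ) ≤ y k) ∨ (g k ≤ 0 ∧ y k ≤ g k)

/-- The kernel of the constraint matrix with columns `col k`, `k < m`, and one row for each brick
`i < n`, the brick of `k` being `br k`. -/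
def InKer (m n : ℕ) (br : ℕ → ℕ) (col : ℕ → Fin d → ℤ) (g : ℕ → ℤ) : Prop :=
  (∀ p, ∑ k ∈ range m, g k * col k p = 0) ∧ ∀ i < n, ∑ k ∈ range m with br k = i, g k = 0

/-- A shift of one unit within a brick, or of one unit in a coordinate that is in no brick. -/
structure IsUnitMove (m n : ℕ) (br : ℕ → ℕ) (col : ℕ → Fin d → ℤ) (M : ℕ) (g : ℕ → ℤ) : Prop where
  brick : ∀ i < n, ∑ k ∈ range m with br k = i, g k = 0
  supp : ∀ k, m ≤ k → g k = 0
  one_le : 1 ≤ ∑ k ∈ range m, |g k|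
  le_two : ∑ k ∈ range m, |g k| ≤ 2
  image : ∀ p, |∑ k ∈ range m, g k * col k p| ≤ M

variable {m n : ℕ} {br : ℕ → ℕ} {col : ℕ → Fin d → ℤ} {Δ : ℕ}

theorem isUnitMove_single (hcol : ∀ k p, |col k p| ≤ Δ) {a : ℕ} (ha : a < m)
    (hb : n ≤ br a) {e : ℤ} (he : |e| = 1) :
    IsUnitMove m n br col (2 * Δ) (Pi.single a e) := by
  have ham : a ∈ range m := mem_range.2 ha
  have habs : ∑ k ∈ range m, |(Pi.single a e : ℕ → ℤ) k| = 1 := by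
    rw [Finset.sum_eq_single_of_mem a ham fun k _ h => by simp [h]]; simpa using he
  refine ⟨fun i hi => ?_, fun k hk => ?_, habs.ge, by rw [habs]; norm_num, fun p => ?_⟩
  · refine Finset.sum_eq_zero fun k hk => ?_
    have : k ≠ a := by
      rintro rfl
      have := (mem_filter.1 hk).2
      omega
    simp [this]
  · have : k ≠ a := by omega
    simp [this]
  · rw [Finset.sum_eq_single_of_mem a ham fun k _ h => by simp [h]]
    have := hcol a p
    rw [Pi.single_eq_same, abs_mul, he]
    push_cast
    linarith [abs_nonneg (col a p)]

theorem isUnitMove_pair (hcol : ∀ k p, |col k p| ≤ Δ) {a b : ℕ} (ha : a < m) (hb : b < m)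
    (hab : a ≠ b) (hbr : br a = br b) :
    IsUnitMove m n br col (2 * Δ) (Pi.single a 1 + Pi.single b (-1)) := by
  have ham : a ∈ range m := mem_range.2 ha
  have hbm : b ∈ range m := mem_range.2 hb
  have habs : ∑ k ∈ range m, |(Pi.single a 1 + Pi.single b (-1) : ℕ → ℤ) k| = 2 := by
    rw [← Finset.add_sum_erase _ _ ham, Finset.sum_eq_single_of_mem b
      (mem_erase.2 ⟨hab.symm, hbm⟩) fun k hk h => by simp [h, (mem_erase.1 hk).1]]
    simp [hab, hab.symm]
  refine ⟨fun i _ => ?_, fun k hk => ?_, by rw [habs]; norm_num, habs.le, fun p => ?_⟩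
  · simp only [Pi.add_apply, Finset.sum_add_distrib, Finset.sum_pi_single', mem_filter, ham, hbm,
      true_and, hbr]
    split_ifs <;> simp
  · have h1 : k ≠ a := by omega
    have h2 : k ≠ b := by omega
    simp [h1, h2]
  · simp only [Pi.add_apply, add_mul, Finset.sum_add_distrib]
    rw [Finset.sum_eq_single_of_mem a ham fun k _ h => by simp [h],
      Finset.sum_eq_single_of_mem b hbm fun k _ h => by simp [h]]
    have h1 := abs_le.1 (hcol a p)
    have h2 := abs_le.1 (hcol b p)
    simp only [Pi.single_eq_same]
    push_cast
    rw [abs_le]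
    constructor <;> linarith

/-- `z` contains no further unit move. -/
def Reduced (m n : ℕ) (br : ℕ → ℕ) (z : ℕ → ℝ) : Prop :=
  (∀ a < m, n ≤ br a → |z a| < 1) ∧
    ∀ a < m, ∀ b < m, br a = br b → 1 ≤ z a → z b ≤ -1 → False

/-- Splitting off unit moves until none is left. -/
theorem exists_unitMove_decomposition (hcol : ∀ k p, |col k p| ≤ Δ) (y : ℕ → ℝ) :
    ∃ (N : ℕ) (g : Fin N → ℕ → ℤ) (z : ℕ → ℝ),
      (∀ i, IsUnitMove m n br col (2 * Δ) (g i)) ∧ (∀ k, y k = ∑ i, (g i k : ℝ) + z k) ∧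
      (∀ k, 0 ≤ y k → 0 ≤ z k ∧ ∀ i, 0 ≤ g i k) ∧ (∀ k, y k ≤ 0 → z k ≤ 0 ∧ ∀ i, g i k ≤ 0) ∧
      Reduced m n br z := by
  -- Induction on the 1-norm. A conformal move lowers it by the norm of the move, which is at least
  -- one.
  obtain ⟨K, hK⟩ := exists_nat_gt (∑ k ∈ range m, |y k|)
  induction K generalizing y with
  | zero =>
    have : 0 ≤ ∑ k ∈ range m, |y k| := Finset.sum_nonneg fun _ _ => abs_nonneg _
    simp at hK; linarith
  | succ K ih =>
    by_cases hred : Reduced m n br y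
    · exact ⟨0, fun i => i.elim0, y, fun i => i.elim0, by simp, fun k h => ⟨h, fun i => i.elim0⟩,
        fun k h => ⟨h, fun i => i.elim0⟩, hred⟩
    obtain ⟨g₀, hg₀, hconf⟩ : ∃ g₀, IsUnitMove m n br col (2 * Δ) g₀ ∧ Conformal g₀ y := by
      by_cases h1 : ∀ a < m, n ≤ br a → |y a| < 1
      · have h2 : ¬ ∀ a < m, ∀ b < m, br a = br b → 1 ≤ y a → y b ≤ -1 → False :=
          fun h => hred ⟨h1, h⟩
        push Not at h2
        obtain ⟨a, ha, b, hb, hab, hya, hyb, -⟩ := h2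
        have hne : a ≠ b := by rintro rfl; linarith
        refine ⟨_, isUnitMove_pair hcol ha hb hne hab, fun k => ?_⟩
        by_cases hka : k = a
        · subst hka; left; simp [hne, hya]
        · by_cases hkb : k = b
          · subst hkb; right; simp [hka, hyb]
          · simp [hka, hkb, le_total]
      · push Not at h1
        obtain ⟨a, ha, hb, hya⟩ := h1
        rcases le_total 0 (y a) with h | h
        · rw [abs_of_nonneg h] at hya
          refine ⟨_, isUnitMove_single hcol ha hb (e := 1) (by simp), fun k => ?_⟩
          by_cases hka : k = a
          · subst hka; left; simp [hya]
          · simp [hka, le_total]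
        · rw [abs_of_nonpos h] at hya
          refine ⟨_, isUnitMove_single hcol ha hb (e := -1) (by simp), fun k => ?_⟩
          by_cases hka : k = a
          · subst hka; right; simp; linarith
          · simp [hka, le_total]
    have habs : ∀ k, |y k - g₀ k| = |y k| - |(g₀ k : ℝ)| := by
      intro k
      rcases hconf k with ⟨h1, h2⟩ | ⟨h1, h2⟩
      · have : (0 : ℝ) ≤ g₀ k := by exact_mod_cast h1
        rw [abs_of_nonneg (by linarith), abs_of_nonneg (by linarith), abs_of_nonneg this]
      · have : (g₀ k : ℝ) ≤ 0 := by exact_mod_cast h1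
        rw [abs_of_nonpos (by linarith), abs_of_nonpos (by linarith), abs_of_nonpos this]
        ring
    have hlt : ∑ k ∈ range m, |y k - g₀ k| < K := by
      simp only [habs, Finset.sum_sub_distrib]
      have : (1 : ℝ) ≤ ∑ k ∈ range m, |(g₀ k : ℝ)| := by exact_mod_cast hg₀.one_le
      push_cast at hK
      linarith
    obtain ⟨N, g, z, hg, hyz, hp, hn, hz⟩ := ih (fun k => y k - g₀ k) hlt
    refine ⟨N + 1, Fin.cons g₀ g, z, fun i => ?_, fun k => ?_, fun k hk => ?_, fun k hk => ?_, hz⟩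
    · refine Fin.cases ?_ (fun i => ?_) i
      · simpa using hg₀
      · simpa using hg i
    · rw [Fin.sum_univ_succ]
      have := hyz k
      simp only [Fin.cons_zero, Fin.cons_succ]
      linarith
    · have h0 : 0 ≤ y k - g₀ k ∧ 0 ≤ g₀ k := by
        rcases hconf k with ⟨h1, h2⟩ | ⟨h1, h2⟩
        · exact ⟨by linarith, h1⟩
        · have h3 : (g₀ k : ℝ) ≤ 0 := by exact_mod_cast h1
          have h4 : (g₀ k : ℝ) = 0 := by linarith
          have h5 : g₀ k = 0 := by exact_mod_cast h4
          exact ⟨by rw [h4]; linarith, h5.ge⟩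
      refine ⟨(hp k h0.1).1, fun i => ?_⟩
      refine Fin.cases ?_ (fun i => ?_) i
      · simpa using h0.2
      · simpa using (hp k h0.1).2 i
    · have h0 : y k - g₀ k ≤ 0 ∧ g₀ k ≤ 0 := by
        rcases hconf k with ⟨h1, h2⟩ | ⟨h1, h2⟩
        · have h3 : (0 : ℝ) ≤ g₀ k := by exact_mod_cast h1
          have h4 : (g₀ k : ℝ) = 0 := by linarith
          have h5 : g₀ k = 0 := by exact_mod_cast h4
          exact ⟨by rw [h4]; linarith, h5.le⟩
        · exact ⟨by linarith, h1⟩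
      refine ⟨(hn k h0.1).1, fun i => ?_⟩
      refine Fin.cases ?_ (fun i => ?_) i
      · simpa using h0.2
      · simpa using (hn k h0.1).2 i

/-- A zero-sum subfamily of conformal unit moves sums to a kernel element. -/
theorem inKer_sum_unitMoves {N : ℕ} {g : Fin N → ℕ → ℤ} {y z : ℕ → ℝ} {M : ℕ}
    (hg : ∀ i, IsUnitMove m n br col M (g i)) (hyz : ∀ k, y k = ∑ i, (g i k : ℝ) + z k)
    (hp : ∀ k, 0 ≤ y k → 0 ≤ z k ∧ ∀ i, 0 ≤ g i k)
    (hn : ∀ k, y k ≤ 0 → z k ≤ 0 ∧ ∀ i, g i k ≤ 0) (A : Finset (Fin N))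
    (hA : ∀ p, ∑ i ∈ A, ∑ k ∈ range m, g i k * col k p = 0) :
    InKer m n br col (fun k => ∑ i ∈ A, g i k) ∧ Conformal (fun k => ∑ i ∈ A, g i k) y ∧
      (∀ k, m ≤ k → ∑ i ∈ A, g i k = 0) ∧ #A ≤ ∑ k ∈ range m, |∑ i ∈ A, g i k| ∧
      ∑ k ∈ range m, |∑ i ∈ A, g i k| ≤ 2 * #A := by
  have habs : ∑ k ∈ range m, |∑ i ∈ A, g i k| = ∑ i ∈ A, ∑ k ∈ range m, |g i k| := by
    rw [Finset.sum_comm]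
    refine Finset.sum_congr rfl fun k _ => ?_
    rcases le_total 0 (y k) with h | h
    · rw [abs_of_nonneg (Finset.sum_nonneg fun i _ => (hp k h).2 i)]
      exact Finset.sum_congr rfl fun i _ => (abs_of_nonneg ((hp k h).2 i)).symm
    · rw [abs_of_nonpos (Finset.sum_nonpos fun i _ => (hn k h).2 i), ← Finset.sum_neg_distrib]
      exact Finset.sum_congr rfl fun i _ => (abs_of_nonpos ((hn k h).2 i)).symm
  refine ⟨⟨fun p => ?_, fun i hi => ?_⟩, fun k => ?_, fun k hk => ?_, ?_, ?_⟩
  · rw [← hA p, Finset.sum_comm]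
    exact Finset.sum_congr rfl fun k _ => Finset.sum_mul _ _ _
  · rw [Finset.sum_comm]
    exact Finset.sum_eq_zero fun j _ => (hg j).brick i hi
  · rcases le_total 0 (y k) with h | h
    · left
      refine ⟨Finset.sum_nonneg fun i _ => (hp k h).2 i, ?_⟩
      have h1 : ∑ i ∈ A, (g i k : ℝ) ≤ ∑ i, (g i k : ℝ) :=
        Finset.sum_le_sum_of_subset_of_nonneg (Finset.subset_univ _) fun i _ _ => by
          exact_mod_cast (hp k h).2 i
      push_cast
      linarith [hyz k, (hp k h).1]
    · right
      refine ⟨Finset.sum_nonpos fun i _ => (hn k h).2 i, ?_⟩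
      have h1 : ∑ i, (g i k : ℝ) ≤ ∑ i ∈ A, (g i k : ℝ) := by
        have h2 : ∑ i ∈ A, -(g i k : ℝ) ≤ ∑ i, -(g i k : ℝ) :=
          Finset.sum_le_sum_of_subset_of_nonneg (Finset.subset_univ _) fun i _ _ => by
            rw [neg_nonneg]; exact_mod_cast (hn k h).2 i
        rw [Finset.sum_neg_distrib, Finset.sum_neg_distrib] at h2
        linarith
      push_cast
      linarith [hyz k, (hn k h).1]
  · exact Finset.sum_eq_zero fun i _ => (hg i).supp k hk
  · rw [habs]
    calc (#A : ℤ) = ∑ i ∈ A, 1 := by simp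
      _ ≤ _ := Finset.sum_le_sum fun i _ => (hg i).one_le
  · rw [habs]
    calc ∑ i ∈ A, ∑ k ∈ range m, |g i k| ≤ ∑ i ∈ A, 2 := Finset.sum_le_sum fun i _ => (hg i).le_two
      _ = 2 * #A := by simp [mul_comm]

/-- Below every nonzero kernel element there is a nonzero one of bounded norm. -/
theorem exists_small_kernel_element (hcol : ∀ k p, |col k p| ≤ Δ) (y : ℕ → ℤ)
    (hy : InKer m n br col y) (hne : ∃ k < m, y k ≠ 0) :
    ∃ g : ℕ → ℤ, InKer m n br col g ∧ Conformal g (fun k => y k) ∧ (∀ k, m ≤ k → g k = 0) ∧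
      1 ≤ ∑ k ∈ range m, |g k| ∧ ∑ k ∈ range m, |g k| ≤ 2 * (4 * Δ * d + 1) ^ d := by
  obtain ⟨N, g, z, hg, hyz, hp, hn, hz⟩ :=
    exists_unitMove_decomposition (m := m) (n := n) (br := br) hcol (fun k => (y k : ℝ))
  have hzint : ∀ k, z k = ((y k - ∑ i, g i k : ℤ) : ℝ) := fun k => by
    push_cast; linarith [hyz k]
  have hzbrick : ∀ i < n, ∑ k ∈ range m with br k = i, (y k - ∑ j, g j k) = 0 := by
    intro i hi
    rw [Finset.sum_sub_distrib, hy.2 i hi, Finset.sum_comm,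
      Finset.sum_eq_zero fun j _ => (hg j).brick i hi, sub_zero]
  -- For integral `y` nothing remains. A nonzero entry of the remainder in a brick would have a
  -- partner of opposite sign, as the brick sum is zero, and both would be at least one in absolute
  -- value, contradicting `Reduced`. Outside the bricks an integer of absolute value below one is
  -- zero.
  have hz0 : ∀ k < m, y k = ∑ i, g i k := by
    intro k hk
    by_contra hzk
    have hzk' : y k - ∑ i, g i k ≠ 0 := sub_ne_zero.2 hzk
    rcases Nat.lt_or_ge (br k) n with h | h
    · have hmem : k ∈ {j ∈ range m | br j = br k} := by simp [hk]
      have hb := hzbrick (br k) h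
      rcases lt_or_gt_of_ne hzk' with h' | h'
      · obtain ⟨a, ha, hapos⟩ : ∃ a ∈ {j ∈ range m | br j = br k}, 0 < y a - ∑ i, g i a := by
          by_contra! hcon
          have := Finset.sum_lt_sum (s := {j ∈ range m | br j = br k})
            (f := fun a => y a - ∑ i, g i a) (g := fun _ => 0) hcon ⟨k, hmem, h'⟩
          simp only [hb, Finset.sum_const_zero, lt_irrefl] at this
        rw [mem_filter, mem_range] at ha
        refine hz.2 a ha.1 k hk ha.2 ?_ ?_
        · rw [hzint]; exact_mod_cast hapos
        · rw [hzint]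
          have : y k - ∑ i, g i k ≤ -1 := by omega
          exact_mod_cast this
      · obtain ⟨a, ha, haneg⟩ : ∃ a ∈ {j ∈ range m | br j = br k}, y a - ∑ i, g i a < 0 := by
          by_contra! hcon
          have := Finset.sum_lt_sum (s := {j ∈ range m | br j = br k})
            (g := fun a => y a - ∑ i, g i a) (f := fun _ => 0) hcon ⟨k, hmem, h'⟩
          simp only [hb, Finset.sum_const_zero, lt_irrefl] at this
        rw [mem_filter, mem_range] at ha
        refine hz.2 k hk a ha.1 ha.2.symm ?_ ?_
        · rw [hzint]; exact_mod_cast h'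
        · rw [hzint]
          have : y a - ∑ i, g i a ≤ -1 := by omega
          exact_mod_cast this
    · have := hz.1 k hk h
      rw [hzint] at this
      have h1 : |y k - ∑ i, g i k| < 1 := by exact_mod_cast this
      exact hzk' (Int.abs_lt_one_iff.1 h1)
  have hN : (Finset.univ : Finset (Fin N)).Nonempty := by
    obtain ⟨k, hk, hk0⟩ := hne
    by_contra hemp
    rw [Finset.not_nonempty_iff_eq_empty] at hemp
    exact hk0 (by rw [hz0 k hk, hemp]; simp)
  have hsum : ∀ p, ∑ i, ∑ k ∈ range m, g i k * col k p = 0 := by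
    intro p
    rw [Finset.sum_comm, ← hy.1 p]
    refine Finset.sum_congr rfl fun k hk => ?_
    rw [← Finset.sum_mul, hz0 k (mem_range.1 hk)]
  obtain ⟨A, -, hAne, hA, hcard⟩ := exists_small_zero_sum
    (fun i p => ∑ k ∈ range m, g i k * col k p) (2 * Δ) (fun i p => (hg i).image p) _ hN hsum
  obtain ⟨h1, h2, h3, h4, h5⟩ := inKer_sum_unitMoves hg hyz hp hn A hA
  refine ⟨_, h1, h2, h3, ?_, h5.trans ?_⟩
  · have : (1 : ℤ) ≤ #A := by exact_mod_cast hAne.card_pos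
    linarith
  · have : (#A : ℤ) ≤ (4 * Δ * d + 1) ^ d := by
      have h := hcard
      rw [show 2 * (2 * Δ) * d = 4 * Δ * d by ring] at h
      exact_mod_cast h
    linarith

/-- A reduced vector with brick sums zero is small. -/
theorem Reduced.sum_abs_le {z : ℕ → ℝ} (hz : Reduced m n br z) {t : ℕ}
    (hbrick : ∀ i < n, ∑ k ∈ range m with br k = i, z k = 0)
    (hsize : ∀ i < n, #{k ∈ range m | br k = i} ≤ t) (hfree : ∀ k < m, n ≤ br k → z k = 0) :
    ∑ k ∈ range m, |z k| ≤ 2 * (n * t) := by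
  have h1 : ∀ i ∈ range n, ∑ k ∈ range m with br k = i, |z k| ≤ 2 * t := by
    intro i hi
    rw [mem_range] at hi
    have hs := hbrick i hi
    have hsz : (#{k ∈ range m | br k = i} : ℝ) ≤ t := by exact_mod_cast hsize i hi
    by_cases hpos : ∃ a < m, br a = i ∧ 1 ≤ z a
    · obtain ⟨a, ha, hai, hza⟩ := hpos
      -- An entry that is at least `1` rules out entries that are at most `-1` in the same brick, so
      -- every entry exceeds `-1`. Summing `z k + 2` over the brick leaves only the constant,
      -- because the brick sum is zero.
      have : ∀ k ∈ {k ∈ range m | br k = i}, |z k| ≤ z k + 2 := by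
        intro k hk
        rw [mem_filter, mem_range] at hk
        have : -1 < z k := by
          by_contra! h
          exact hz.2 a ha k hk.1 (hai.trans hk.2.symm) hza h
        rw [abs_le]; constructor <;> linarith
      refine (Finset.sum_le_sum this).trans ?_
      rw [Finset.sum_add_distrib, hs]
      simp; linarith
    · push Not at hpos
      have : ∀ k ∈ {k ∈ range m | br k = i}, |z k| ≤ -z k + 2 := by
        intro k hk
        rw [mem_filter, mem_range] at hk
        have := hpos k hk.1 hk.2
        rw [abs_le]; constructor <;> linarith
      refine (Finset.sum_le_sum this).trans ?_
      rw [Finset.sum_add_distrib, Finset.sum_neg_distrib, hs]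
      simp; linarith
  have h2 : ∑ k ∈ range m, |z k| = ∑ k ∈ range m with br k < n, |z k| := by
    rw [Finset.sum_filter]
    refine Finset.sum_congr rfl fun k hk => ?_
    split_ifs with h
    · rfl
    · rw [hfree k (mem_range.1 hk) (by omega), abs_zero]
  have h3 : ∑ k ∈ range m with br k < n, |z k| =
      ∑ i ∈ range n, ∑ k ∈ range m with br k = i, |z k| := by
    rw [← Finset.sum_fiberwise_of_maps_to (t := range n) (g := br)
      (fun k hk => mem_range.2 (mem_filter.1 hk).2)]
    refine Finset.sum_congr rfl fun i hi => ?_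
    rw [Finset.filter_filter]
    refine Finset.sum_congr (Finset.filter_congr fun k _ => ?_) fun _ _ => rfl
    have := mem_range.1 hi
    constructor
    · exact fun h => h.2
    · exact fun h => ⟨by omega, h⟩
  rw [h2, h3]
  refine (Finset.sum_le_sum h1).trans ?_
  simp
  linarith

/-- Below every large real kernel element there is a nonzero integer kernel element. -/
theorem exists_integer_kernel_element (hcol : ∀ k p, |col k p| ≤ Δ) (y : ℕ → ℝ) {t : ℕ}
    (hker : ∀ p, ∑ k ∈ range m, y k * col k p = 0)
    (hbrick : ∀ i < n, ∑ k ∈ range m with br k = i, y k = 0)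
    (hsize : ∀ i < n, #{k ∈ range m | br k = i} ≤ t) (hfree : ∀ k < m, n ≤ br k → y k = 0)
    (hlarge : 2 * ((n * t + 1) * (4 * Δ * d + 1) ^ d + n * t) < ∑ k ∈ range m, |y k|) :
    ∃ g : ℕ → ℤ, InKer m n br col g ∧ Conformal g y ∧ 1 ≤ ∑ k ∈ range m, |g k| := by
  obtain ⟨N, g, z, hg, hyz, hp, hn, hz⟩ :=
    exists_unitMove_decomposition (m := m) (n := n) (br := br) hcol y
  have hzsum : ∑ k ∈ range m, |z k| ≤ 2 * (n * t) := by
    refine hz.sum_abs_le (fun i hi => ?_) hsize fun k hk hb => ?_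
    · have h0 : ∑ k ∈ range m with br k = i, (y k - ∑ j, (g j k : ℝ)) = 0 := by
        rw [Finset.sum_sub_distrib, hbrick i hi, Finset.sum_comm,
          Finset.sum_eq_zero fun j _ => by exact_mod_cast (hg j).brick i hi, sub_zero]
      rw [← h0]
      exact Finset.sum_congr rfl fun k _ => by linarith [hyz k]
    · have h0 := hfree k hk hb
      exact le_antisymm (hn k h0.le).1 (hp k h0.ge).1
  -- Each unit move has norm at most two and the remainder at most `2 * (n * t)`, so a vector of
  -- large norm contains many moves.
  have hN : (n * t + 1) * (4 * Δ * d + 1) ^ d < N := by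
    have h1 : ∀ k ∈ range m, |y k| ≤ ∑ i, (|g i k| : ℝ) + |z k| := by
      intro k _
      rw [hyz k]
      exact (abs_add_le _ _).trans (add_le_add_left (Finset.abs_sum_le_sum_abs _ _) _)
    have h2 := Finset.sum_le_sum h1
    rw [Finset.sum_add_distrib, Finset.sum_comm] at h2
    have h3 : ∑ i : Fin N, ∑ k ∈ range m, (|g i k| : ℝ) ≤ ∑ i : Fin N, 2 :=
      Finset.sum_le_sum fun i _ => by exact_mod_cast (hg i).le_two
    simp only [Finset.sum_const, Finset.card_univ, Fintype.card_fin, nsmul_eq_mul] at h3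
    have h4 : ((n * t + 1) * (4 * Δ * d + 1) ^ d : ℝ) < N := by linarith
    exact_mod_cast h4
  -- The filler is the image of the reduced part `z`. Its norm is at most `2 * (n * t) * Δ`, which
  -- is `n * t` times the bound `2 * Δ` for the image of a move; hence `q = n * t`.
  obtain ⟨A, hAne, -, hA⟩ := exists_zero_sum_subset
    (fun i p => ∑ k ∈ range m, g i k * col k p) (2 * Δ) (n * t) (fun i p => (hg i).image p)
    (fun p => ∑ k ∈ range m, z k * col k p) (fun p => by
      calc |∑ k ∈ range m, z k * col k p| ≤ ∑ k ∈ range m, |z k * col k p| :=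
            Finset.abs_sum_le_sum_abs _ _
        _ ≤ ∑ k ∈ range m, |z k| * Δ := Finset.sum_le_sum fun k _ => by
            rw [abs_mul]
            refine mul_le_mul_of_nonneg_left ?_ (abs_nonneg _)
            exact_mod_cast hcol k p
        _ ≤ 2 * (n * t) * Δ := by
            rw [← Finset.sum_mul]
            exact mul_le_mul_of_nonneg_right hzsum (by positivity)
        _ = _ := by push_cast; ring) (fun p => by
      rw [← hker p]
      push_cast
      rw [Finset.sum_comm, ← Finset.sum_add_distrib]
      refine Finset.sum_congr rfl fun k _ => ?_
      rw [hyz k, add_mul, Finset.sum_mul]) (by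
      rw [Fintype.card_fin, show 2 * (2 * Δ) * d = 4 * Δ * d by ring]; exact hN)
  obtain ⟨h1, h2, -, h4, -⟩ := inKer_sum_unitMoves hg hyz hp hn A hA
  refine ⟨_, h1, h2, ?_⟩
  have : (1 : ℤ) ≤ #A := by exact_mod_cast hAne.card_pos
  linarith

end Conformal

/-! ### Convexity -/

/-- Convexity of a function on the integers. -/
def IntConvex (φ : ℤ → ℤ) : Prop := ∀ z, φ z - φ (z - 1) ≤ φ (z + 1) - φ z

theorem IntConvex.shift_le {φ : ℤ → ℤ} (h : IntConvex φ) (x : ℤ) (k : ℕ) :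
    φ (x + 1) - φ x ≤ φ (x + k + 1) - φ (x + k) := by
  induction k with
  | zero => simp
  | succ k ih =>
    have := h (x + k + 1)
    rw [show x + k + 1 - 1 = x + k by ring] at this
    push_cast
    rw [show x + (k + 1) + 1 = x + k + 1 + 1 by ring, show x + ((k : ℤ) + 1) = x + k + 1 by ring]
    linarith

theorem IntConvex.superadditive_nonneg {φ : ℤ → ℤ} (h : IntConvex φ) (x : ℤ) (a b : ℕ) :
    φ (x + a) + φ (x + b) ≤ φ x + φ (x + a + b) := by
  induction a with
  | zero => simp
  | succ a ih =>
    have := h.shift_le (x + a) b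
    push_cast
    rw [show x + (a + 1) = x + a + 1 by ring, show x + a + 1 + b = x + a + b + 1 by ring]
    linarith

theorem IntConvex.neg {φ : ℤ → ℤ} (h : IntConvex φ) : IntConvex fun z => φ (-z) := by
  intro z
  have := h (-z)
  simp only
  rw [show -(z - 1) = -z + 1 by ring, show -(z + 1) = -z - 1 by ring]
  linarith

/-- Increments of a convex function grow away from the base point. Splitting a step into two parts
of equal sign, both taken from `x`, therefore costs no more than the whole step. This allows a large
kernel step to be judged by its small conformal pieces. -/
theorem IntConvex.superadditive {φ : ℤ → ℤ} (h : IntConvex φ) (x a b : ℤ)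
    (hab : (0 ≤ a ∧ 0 ≤ b) ∨ (a ≤ 0 ∧ b ≤ 0)) :
    φ (x + a) + φ (x + b) ≤ φ x + φ (x + a + b) := by
  rcases hab with ⟨ha, hb⟩ | ⟨ha, hb⟩
  · lift a to ℕ using ha
    lift b to ℕ using hb
    exact h.superadditive_nonneg x a b
  · have := h.neg.superadditive_nonneg (-x) (-a).toNat (-b).toNat
    rw [Int.toNat_of_nonneg (by omega), Int.toNat_of_nonneg (by omega)] at this
    simpa [neg_add_rev, add_comm, add_left_comm, add_assoc] using this

theorem intConvex_abs : IntConvex fun z => |z| := by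
  intro z
  simp only [abs_eq_max_neg]
  omega

theorem intConvex_zero : IntConvex fun _ => 0 := by
  intro z; simp

/-- If `g` lies between `0` and `y`, then moving by `g` from one end of a segment and by `-g` from
the other end does not increase a convex function. -/
theorem convexOn_exchange {φ : ℝ → ℝ} (h : ConvexOn ℝ Set.univ φ) (z y g : ℝ)
    (hg : (0 ≤ g ∧ g ≤ y) ∨ (g ≤ 0 ∧ y ≤ g)) :
    φ (z + g) + φ (z + y - g) ≤ φ z + φ (z + y) := by
  by_cases hy : y = 0
  · have : g = 0 := by rcases hg with h | h <;> linarith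
    simp [hy, this]
  have h0 : 0 ≤ g / y := by
    rcases hg with h | h
    · exact div_nonneg h.1 (h.1.trans h.2)
    · exact div_nonneg_of_nonpos h.1 (h.2.trans h.1)
  have h1 : g / y ≤ 1 := by
    rcases hg with h | h
    · exact div_le_one_of_le₀ h.2 (h.1.trans h.2)
    · exact div_le_one_of_ge h.2 (h.2.trans h.1)
  -- The points `z + g` and `z + y - g` are convex combinations of the endpoints with complementary
  -- weights, so the two convexity inequalities add up to the claim.
  have e1 := h.2 (Set.mem_univ z) (Set.mem_univ (z + y)) (sub_nonneg.2 h1) h0 (by ring)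
  have e2 := h.2 (Set.mem_univ z) (Set.mem_univ (z + y)) h0 (sub_nonneg.2 h1) (by ring)
  simp only [smul_eq_mul] at e1 e2
  rw [show (1 - g / y) * z + g / y * (z + y) = z + g by field_simp; ring] at e1
  rw [show g / y * z + (1 - g / y) * (z + y) = z + y - g by field_simp; ring] at e2
  linarith

/-! ### The best small step makes progress -/

section Augment

variable {d : ℕ} {m n : ℕ} {br : ℕ → ℕ} {col : ℕ → Fin d → ℤ} {Δ : ℕ}

theorem InKer.sub {y g : ℕ → ℤ} (hy : InKer m n br col y) (hg : InKer m n br col g) :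
    InKer m n br col fun k => y k - g k := by
  refine ⟨fun p => ?_, fun i hi => ?_⟩
  · simp only [sub_mul, Finset.sum_sub_distrib, hy.1 p, hg.1 p, sub_zero]
  · simp only [Finset.sum_sub_distrib, hy.2 i hi, hg.2 i hi, sub_zero]

theorem InKer.add {y g : ℕ → ℤ} (hy : InKer m n br col y) (hg : InKer m n br col g) :
    InKer m n br col fun k => y k + g k := by
  refine ⟨fun p => ?_, fun i hi => ?_⟩
  · simp only [add_mul, Finset.sum_add_distrib, hy.1 p, hg.1 p, add_zero]
  · simp only [Finset.sum_add_distrib, hy.2 i hi, hg.2 i hi, add_zero]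

theorem InKer.congr {y g : ℕ → ℤ} (hy : InKer m n br col y) (h : ∀ k < m, g k = y k) :
    InKer m n br col g := by
  refine ⟨fun p => ?_, fun i hi => ?_⟩
  · rw [← hy.1 p]
    exact Finset.sum_congr rfl fun k hk => by rw [h k (mem_range.1 hk)]
  · rw [← hy.2 i hi]
    exact Finset.sum_congr rfl fun k hk => h k (mem_range.1 (mem_filter.1 hk).1)

theorem conformal_int_iff {g y : ℕ → ℤ} : Conformal g (fun k => y k) ↔
    ∀ k, (0 ≤ g k ∧ g k ≤ y k) ∨ (g k ≤ 0 ∧ y k ≤ g k) := by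
  simp [Conformal]

/-- If no kernel step of norm at most `2 * (4 * Δ * d + 1) ^ d` within the box improves a separable
convex function by more than `-v`, then a kernel step `y` improves it by at most `‖y‖₁ * -v`. -/
theorem improvement_bound (hcol : ∀ k p, |col k p| ≤ Δ) {φ : ℕ → ℤ → ℤ}
    (hφ : ∀ k, IntConvex (φ k)) {lo up x : ℕ → ℤ} (hx : ∀ k < m, lo k ≤ x k ∧ x k ≤ up k)
    {v : ℤ} (hv0 : v ≤ 0)
    (hv : ∀ g : ℕ → ℤ, InKer m n br col g → ∑ k ∈ range m, |g k| ≤ 2 * (4 * Δ * d + 1) ^ d →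
      (∀ k < m, lo k ≤ x k + g k ∧ x k + g k ≤ up k) →
      v ≤ ∑ k ∈ range m, (φ k (x k + g k) - φ k (x k)))
    (y : ℕ → ℤ) (hy : InKer m n br col y) (hbox : ∀ k < m, lo k ≤ x k + y k ∧ x k + y k ≤ up k) :
    (∑ k ∈ range m, |y k|) * v ≤ ∑ k ∈ range m, (φ k (x k + y k) - φ k (x k)) := by
  obtain ⟨N, hN⟩ : ∃ N : ℕ, ∑ k ∈ range m, |y k| < N :=
    ⟨(∑ k ∈ range m, |y k|).toNat + 1, by
      have := Int.self_le_toNat (∑ k ∈ range m, |y k|)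
      push_cast; omega⟩
  induction N generalizing y with
  | zero =>
    have : 0 ≤ ∑ k ∈ range m, |y k| := Finset.sum_nonneg fun _ _ => abs_nonneg _
    simp at hN; omega
  | succ N ih =>
    by_cases hne : ∃ k < m, y k ≠ 0
    · obtain ⟨g, hg, hconf, -, hg1, hg2⟩ := exists_small_kernel_element hcol y hy hne
      rw [conformal_int_iff] at hconf
      have hsum : ∑ k ∈ range m, |y k - g k| = ∑ k ∈ range m, |y k| - ∑ k ∈ range m, |g k| := by
        rw [← Finset.sum_sub_distrib]
        refine Finset.sum_congr rfl fun k _ => ?_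
        have := hconf k
        simp only [abs_eq_max_neg]
        omega
      have h1 := hv g hg hg2 fun k hk => by
        have := hconf k; have := hbox k hk; have := hx k hk; omega
      have h2 := ih (fun k => y k - g k) (hy.sub hg) (fun k hk => by
        have := hconf k; have := hbox k hk; have := hx k hk
        constructor <;> omega) (by rw [hsum]; push_cast at hN; omega)
      have h3 : ∑ k ∈ range m, (φ k (x k + g k) - φ k (x k)) +
          ∑ k ∈ range m, (φ k (x k + (y k - g k)) - φ k (x k)) ≤
          ∑ k ∈ range m, (φ k (x k + y k) - φ k (x k)) := by
        rw [← Finset.sum_add_distrib]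
        refine Finset.sum_le_sum fun k _ => ?_
        have := (hφ k).superadditive (x k) (g k) (y k - g k) (by have := hconf k; omega)
        rw [show x k + g k + (y k - g k) = x k + y k by ring] at this
        linarith
      rw [hsum] at h2
      -- As `v ≤ 0` and `‖g‖₁ ≥ 1`, the bound `v` for the piece `g` is at least `‖g‖₁ * v`.
      nlinarith
    · push Not at hne
      have h1 : ∑ k ∈ range m, |y k| = 0 :=
        Finset.sum_eq_zero fun k hk => by rw [hne k (mem_range.1 hk), abs_zero]
      have h2 : ∑ k ∈ range m, (φ k (x k + y k) - φ k (x k)) = 0 :=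
        Finset.sum_eq_zero fun k hk => by rw [hne k (mem_range.1 hk), add_zero, sub_self]
      rw [h1, h2, zero_mul]

end Augment

/-! ### Number of steps -/

/-- `k` steps suffice to bring the gap `g` to zero if each step decreases it by at least
the fraction `1 / N`. -/
def Fuel (N k g : ℕ) : Prop := ∃ e j, k = N * e + j ∧ N * g < 2 ^ e * (N + j)

theorem Fuel.of_lt {N e g : ℕ} (hN : 0 < N) (h : g < 2 ^ e) : Fuel N (N * e) g :=
  ⟨e, 0, rfl, by rw [add_zero, mul_comm]; exact Nat.mul_lt_mul_of_pos_right h hN⟩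

/-- The potential interpolates linearly between powers of two: with `N * e + j` steps left, `g` is
below `2^e * (1 + j/N)`. While `g ≥ 2^e`, a step removes at least `2^e / N` and uses up one unit of
`j`. Halving the gap thus takes `N` steps, and no logarithm or exponential estimate is involved. -/
theorem Fuel.step {N k g g' : ℕ} (hN : 0 < N) (h : Fuel N k g) (hg : 0 < g)
    (hstep : N * g' + g ≤ N * g) : ∃ k' < k, Fuel N k' g' := by
  obtain ⟨e, j, rfl, hlt⟩ := h
  have hgg : g' ≤ g := by nlinarith
  induction e generalizing j with
  | zero =>
    rcases Nat.eq_zero_or_pos j with rfl | hj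
    · simp at hlt
      nlinarith
    · refine ⟨N * 0 + (j - 1), by omega, 0, j - 1, rfl, ?_⟩
      simp only [pow_zero, one_mul] at hlt ⊢
      omega
  | succ e ih =>
    by_cases hge : 2 ^ (e + 1) ≤ g
    · have hj : 0 < j := by
        by_contra h0
        have h0' : j = 0 := by omega
        subst h0'
        rw [add_zero, mul_comm] at hlt
        have := Nat.lt_of_mul_lt_mul_right hlt
        omega
      refine ⟨N * (e + 1) + (j - 1), by omega, e + 1, j - 1, rfl, ?_⟩
      obtain ⟨i, rfl⟩ : ∃ i, j = i + 1 := ⟨j - 1, by omega⟩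
      simp only [Nat.add_sub_cancel]
      nlinarith
    -- Below `2^(e+1)` the exponent can be lowered without spending steps: `N * (e+1) = N * e + N`,
    -- so `j = N` for the exponent `e`.
    · have h1 : N * g < 2 ^ e * (N + N) := by
        have : g < 2 ^ (e + 1) := by omega
        calc N * g < N * 2 ^ (e + 1) := Nat.mul_lt_mul_of_pos_left this hN
          _ = 2 ^ e * (N + N) := by ring
      obtain ⟨k', hk', hf⟩ := ih N h1
      exact ⟨k', by rw [mul_add, mul_one]; omega, hf⟩

/-! ### Packing digits -/

/-- The largest number with `e` digits of absolute value at most `V` in base `2 * V + 1`. -/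
def packMax (V e : ℕ) : ℤ := V * ∑ p ∈ range e, (2 * V + 1 : ℤ) ^ p

/-- With balanced digits the interval from `-packMax` to `packMax` contains exactly `(2V+1)^e`
integers, one for each digit vector. The same identity later supplies the sizes of the layers. -/
theorem two_mul_packMax (V e : ℕ) : 2 * packMax V e + 1 = (2 * V + 1) ^ e := by
  induction e with
  | zero => simp [packMax]
  | succ e ih =>
    rw [pow_succ, ← ih]
    rw [packMax, Finset.sum_range_succ, mul_add, ← packMax]
    rw [← ih]; ring

theorem packMax_nonneg (V e : ℕ) : 0 ≤ packMax V e := by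
  unfold packMax; positivity

theorem abs_pack_le {V e : ℕ} {dig : ℕ → ℤ} (h : ∀ p < e, |dig p| ≤ V) :
    |∑ p ∈ range e, dig p * (2 * V + 1) ^ p| ≤ packMax V e := by
  refine (Finset.abs_sum_le_sum_abs _ _).trans ?_
  rw [packMax, Finset.mul_sum]
  refine Finset.sum_le_sum fun p hp => ?_
  have hpos : (0 : ℤ) ≤ (2 * V + 1) ^ p := by positivity
  rw [abs_mul, abs_of_nonneg hpos]
  exact mul_le_mul_of_nonneg_right (h p (mem_range.1 hp)) hpos

/-- A nonzero top digit contributes at least `2 * packMax V e + 1` in absolute value, and the lower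
digits can cancel only `packMax V e` of it. A bound on the packed number thus enforces that one
digit vanishes, without extracting digits. -/
theorem top_digit_eq_zero {V e : ℕ} {dig : ℕ → ℤ} (h : ∀ p < e, |dig p| ≤ V)
    (hs : |∑ p ∈ range (e + 1), dig p * (2 * V + 1) ^ p| ≤ packMax V e) : dig e = 0 := by
  have h1 := abs_pack_le h
  rw [Finset.sum_range_succ, ← two_mul_packMax] at hs
  have h0 := packMax_nonneg V e
  rw [abs_le] at h1 hs
  by_contra hne
  rcases lt_or_gt_of_ne hne with h' | h'
  · have : dig e ≤ -1 := by omega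
    nlinarith
  · have : 1 ≤ dig e := by omega
    nlinarith

theorem digits_eq_zero {V e : ℕ} {dig : ℕ → ℤ} (h : ∀ p < e, |dig p| ≤ V)
    (hs : ∑ p ∈ range e, dig p * (2 * V + 1) ^ p = 0) : ∀ p < e, dig p = 0 := by
  induction e with
  | zero => intro p hp; omega
  | succ e ih =>
    have htop : dig e = 0 := top_digit_eq_zero (fun p hp => h p (by omega)) (by
      rw [hs, abs_zero]; exact packMax_nonneg V e)
    intro p hp
    rcases Nat.lt_succ_iff_lt_or_eq.1 hp with h' | rfl
    · refine ih (fun p hp => h p (by omega)) ?_ p h'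
      rw [Finset.sum_range_succ, htop] at hs
      simpa using hs
    · exact htop

/-! ### Kernel membership in terms of packed partial sums -/

section Weights

variable {r : ℕ} (n t V : ℕ) (col : ℕ → Fin r → ℤ)

/-- The entries of column `k` together with the entry `1` for `k < n * t` and `0` for the others. -/
def extCol (k p : ℕ) : ℤ := if h : p < r then col k ⟨p, h⟩ else if k < n * t then 1 else 0

/-- The packed column `k`. -/
def weight (k : ℕ) : ℤ := ∑ p ∈ range (r + 1), extCol n t col k p * (2 * V + 1) ^ p

/-- Bound for the packed partial sum before the variable `k`: at the end of a brick, and among the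
variables in no brick, the top digit has to vanish. -/
def layerBound (r k : ℕ) : ℤ :=
  if k % t = 0 ∨ n * t < k then packMax V r else packMax V (r + 1)

variable {n t V col}

theorem sum_weight (y : ℕ → ℤ) (k : ℕ) : ∑ j ∈ range k, weight n t V col j * y j =
    ∑ p ∈ range (r + 1), (∑ j ∈ range k, y j * extCol n t col j p) * (2 * V + 1) ^ p := by
  simp only [weight, Finset.sum_mul]
  rw [Finset.sum_comm]
  exact Finset.sum_congr rfl fun p _ => Finset.sum_congr rfl fun j _ => by ring

theorem abs_digit_le {Δ G : ℕ} (hΔ : 0 < Δ) (hcol : ∀ k p, |col k p| ≤ Δ) {m : ℕ} {y : ℕ → ℤ}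
    (hy : ∑ k ∈ range m, |y k| ≤ G) {k : ℕ} (hk : k ≤ m) (p : ℕ) :
    |∑ j ∈ range k, y j * extCol n t col j p| ≤ (Δ * G : ℕ) := by
  have hext : ∀ j, |extCol n t col j p| ≤ Δ := by
    intro j
    unfold extCol
    split_ifs
    · exact hcol _ _
    · simp; omega
    · simp
  calc |∑ j ∈ range k, y j * extCol n t col j p| ≤ ∑ j ∈ range k, |y j * extCol n t col j p| :=
        Finset.abs_sum_le_sum_abs _ _
    _ ≤ ∑ j ∈ range k, |y j| * Δ := Finset.sum_le_sum fun j _ => by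
        rw [abs_mul]; exact mul_le_mul_of_nonneg_left (hext j) (abs_nonneg _)
    _ ≤ ∑ j ∈ range m, |y j| * Δ :=
        Finset.sum_le_sum_of_subset_of_nonneg (Finset.range_mono hk) fun j _ _ => by positivity
    _ ≤ (Δ * G : ℕ) := by
        rw [← Finset.sum_mul, mul_comm]; push_cast
        exact mul_le_mul_of_nonneg_left hy (by positivity)

theorem sum_brick {m i : ℕ} (ht : 0 < t) (hm : n * t ≤ m) (hi : i < n) {R : Type*} [AddCommMonoid R]
    (y : ℕ → R) :
    ∑ k ∈ range m with k / t = i, y k = ∑ k ∈ Finset.Ico (i * t) ((i + 1) * t), y k := by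
  refine Finset.sum_congr ?_ fun _ _ => rfl
  ext k
  simp only [mem_filter, mem_range, Finset.mem_Ico]
  have h1 : (i + 1) * t ≤ n * t := Nat.mul_le_mul_right t hi
  rw [Nat.div_eq_iff ht]
  constructor
  · rintro ⟨_, h2, h3⟩
    exact ⟨by omega, by rw [add_mul, one_mul]; omega⟩
  · rintro ⟨h2, h3⟩
    rw [add_mul, one_mul] at h3
    exact ⟨by rw [add_mul, one_mul] at h1; omega, by omega, by omega⟩

theorem sum_brick_eq_sub {m i : ℕ} (ht : 0 < t) (hm : n * t ≤ m) (hi : i < n) (y : ℕ → ℤ) :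
    ∑ k ∈ range m with k / t = i, y k =
      ∑ k ∈ range ((i + 1) * t), y k - ∑ k ∈ range (i * t), y k := by
  rw [sum_brick ht hm hi, Finset.sum_Ico_eq_sub _ (Nat.mul_le_mul_right t (Nat.le_succ i))]

/-- The top digit of a partial sum. -/
theorem sum_extCol_top (y : ℕ → ℤ) (k : ℕ) :
    ∑ j ∈ range k, y j * extCol n t col j r = ∑ j ∈ range (min k (n * t)), y j := by
  have h : ∀ j, y j * extCol n t col j r = if j < n * t then y j else 0 := fun j => by
    simp [extCol]
  simp only [h]
  rw [← Finset.sum_filter]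
  refine Finset.sum_congr ?_ fun _ _ => rfl
  ext j
  simp

/-- A small vector is in the kernel iff its packed partial sums obey the layer bounds and its
packed sum vanishes. -/
theorem inKer_iff_layerBound {Δ G m : ℕ} (hΔ : 0 < Δ) (hcol : ∀ k p, |col k p| ≤ Δ) (ht : 0 < t)
    (hm : n * t ≤ m) (hV : V = Δ * G) {y : ℕ → ℤ} (hy : ∑ k ∈ range m, |y k| ≤ G) :
    InKer m n (fun k => k / t) col y ↔
      (∀ k ≤ m, |∑ j ∈ range k, weight n t V col j * y j| ≤ layerBound n t V r k) ∧
        ∑ j ∈ range m, weight n t V col j * y j = 0 := by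
  have hdig : ∀ k ≤ m, ∀ p, |∑ j ∈ range k, y j * extCol n t col j p| ≤ (V : ℤ) :=
    fun k hk p => hV ▸ abs_digit_le hΔ hcol hy hk p
  constructor
  · rintro ⟨h1, h2⟩
    -- All brick sums vanish iff the running sum vanishes at every brick boundary. Hence one digit
    -- that is never reset suffices for all bricks.
    have hpre : ∀ i ≤ n, ∑ k ∈ range (i * t), y k = 0 := by
      intro i hi
      induction i with
      | zero => simp
      | succ i ih =>
        have h3 := h2 i (by omega)
        rw [sum_brick_eq_sub ht hm (by omega), ih (by omega)] at h3
        linarith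
    refine ⟨fun k hk => ?_, ?_⟩
    · rw [sum_weight]
      unfold layerBound
      split_ifs with hc
      · have htop : ∑ j ∈ range k, y j * extCol n t col j r = 0 := by
          rw [sum_extCol_top]
          rcases Nat.lt_or_ge (n * t) k with h | h
          · rw [min_eq_right h.le]; exact hpre n le_rfl
          · rw [min_eq_left h]
            have hk0 : k % t = 0 := by omega
            obtain ⟨i, rfl⟩ := Nat.dvd_of_mod_eq_zero hk0
            rw [mul_comm]
            exact hpre i (Nat.le_of_mul_le_mul_left (by rwa [mul_comm n] at h) ht)
        rw [Finset.sum_range_succ, htop, zero_mul, add_zero]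
        exact abs_pack_le fun p _ => hdig k hk p
      · exact abs_pack_le fun p _ => hdig k hk p
    · rw [sum_weight]
      refine Finset.sum_eq_zero fun p hp => ?_
      have : ∑ j ∈ range m, y j * extCol n t col j p = 0 := by
        rw [mem_range] at hp
        rcases Nat.lt_succ_iff_lt_or_eq.1 hp with h | rfl
        · rw [← h1 ⟨p, h⟩]
          exact Finset.sum_congr rfl fun j _ => by simp [extCol, h]
        · rw [sum_extCol_top, min_eq_right hm]; exact hpre n le_rfl
      rw [this, zero_mul]
  · rintro ⟨h1, h2⟩
    rw [sum_weight] at h2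
    -- Since `V = Δ * G` bounds every digit of a vector of norm at most `G`, the packed total
    -- determines its digits, and zero means that all of them are zero.
    have hz := digits_eq_zero (fun p _ => hdig m le_rfl p) h2
    refine ⟨fun p => ?_, fun i hi => ?_⟩
    · rw [← hz p (by omega)]
      exact Finset.sum_congr rfl fun j _ => by simp [extCol]
    · have hpre : ∀ i ≤ n, ∑ k ∈ range (i * t), y k = 0 := by
        intro i hi
        have hit : i * t ≤ n * t := Nat.mul_le_mul_right t hi
        have h3 := h1 (i * t) (hit.trans hm)
        -- At a brick boundary the tighter of the two layer bounds applies and forces the brick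
        -- digit to vanish.
        rw [layerBound, if_pos (Or.inl (by simp)), sum_weight] at h3
        have h4 := top_digit_eq_zero (fun p _ => hdig (i * t) (hit.trans hm) p) h3
        rwa [sum_extCol_top, min_eq_left hit] at h4
      rw [sum_brick_eq_sub ht hm hi, hpre (i + 1) hi, hpre i hi.le, sub_zero]

end Weights

/-! ### The dynamic program -/

/-- Change of the state index caused by the value `h` of the variable `k`. -/
def stateShift (G : ℕ) (w : ℕ → ℤ) (k : ℕ) (h : ℤ) : ℤ := (G + 1) * (w k * h) + |h|

/-- The recurrence satisfied by the tables of the dynamic program: `A` marks the reachable states,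
`V` holds their optimal values and `P` the last decision. The state with packed sum `σ` and norm
budget `l` has index `(G + 1) * σ + l`. -/
structure IsTable (m G : ℕ) (S w : ℕ → ℤ) (al c A V P : ℕ → ℤ → ℤ) : Prop where
  base : ∀ σ l : ℤ, 0 ≤ l → l ≤ G → (A 0 ((G + 1) * σ + l) = 1 ↔ σ = 0)
  base_val : ∀ τ, V 0 τ = 0
  bound : ∀ k ≤ m, ∀ σ l : ℤ, 0 ≤ l → l ≤ G → A k ((G + 1) * σ + l) = 1 → |σ| ≤ S k
  sound : ∀ k < m, ∀ σ l : ℤ, 0 ≤ l → l ≤ G → A (k + 1) ((G + 1) * σ + l) = 1 →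
    ∃ h, P (k + 1) ((G + 1) * σ + l) = h ∧ |h| ≤ l ∧ al k h = 1 ∧
      A k ((G + 1) * σ + l - stateShift G w k h) = 1 ∧
      V (k + 1) ((G + 1) * σ + l) = V k ((G + 1) * σ + l - stateShift G w k h) + c k h
  complete : ∀ k < m, ∀ σ l : ℤ, 0 ≤ l → l ≤ G → |σ| ≤ S (k + 1) → ∀ h, |h| ≤ l → al k h = 1 →
    A k ((G + 1) * σ + l - stateShift G w k h) = 1 →
    A (k + 1) ((G + 1) * σ + l) = 1 ∧
      V (k + 1) ((G + 1) * σ + l) ≤ V k ((G + 1) * σ + l - stateShift G w k h) + c k h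

/-- The vector found by following the recorded decisions. -/
def backtrack (W P : ℕ → ℤ → ℤ) : ℕ → ℤ → ℕ → ℤ
  | 0, _ => 0
  | k + 1, τ => Function.update (backtrack W P k (τ - W k (P (k + 1) τ))) k (P (k + 1) τ)

theorem stateShift_sub (G : ℕ) (w : ℕ → ℤ) (k : ℕ) (h σ l : ℤ) :
    (G + 1) * σ + l - stateShift G w k h = (G + 1) * (σ - w k * h) + (l - |h|) := by
  unfold stateShift; ring

theorem sum_range_update {M : Type*} [AddCommMonoid M] (F : ℕ → ℤ → M) (y : ℕ → ℤ) (k : ℕ) (h : ℤ)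
    {i : ℕ} (hi : i ≤ k) :
    ∑ j ∈ range i, F j (Function.update y k h j) = ∑ j ∈ range i, F j (y j) := by
  refine Finset.sum_congr rfl fun j hj => ?_
  have : j ≠ k := by have := mem_range.1 hj; omega
  simp [this]

namespace IsTable

variable {m G : ℕ} {S w : ℕ → ℤ} {al c A V P : ℕ → ℤ → ℤ}

/-- Soundness of the tables: following the recorded decisions from a reachable state yields an
actual vector with the tabulated value. The condition `|h| ≤ l` keeps the budget in `0, …, G`, so
subtracting `stateShift` never borrows from the packed sum. Intermediate bounds are returned as
well, because the kernel criterion speaks of all prefixes. -/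
theorem backtrack_spec (T : IsTable m G S w al c A V P) : ∀ k ≤ m, ∀ σ l : ℤ, 0 ≤ l → l ≤ G →
    A k ((G + 1) * σ + l) = 1 → ∀ y, y = backtrack (stateShift G w) P k ((G + 1) * σ + l) →
    (∀ j, k ≤ j → y j = 0) ∧ ∑ j ∈ range k, |y j| ≤ l ∧ (∀ j < k, al j (y j) = 1) ∧
      V k ((G + 1) * σ + l) = ∑ j ∈ range k, c j (y j) ∧
      (∀ i ≤ k, |∑ j ∈ range i, w j * y j| ≤ S i) ∧ ∑ j ∈ range k, w j * y j = σ := by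
  intro k
  induction k with
  | zero =>
    intro _ σ l hl hlG hA y hy
    have hσ := (T.base σ l hl hlG).1 hA
    have hb := T.bound 0 (Nat.zero_le _) σ l hl hlG hA
    simp only [backtrack] at hy
    subst hy hσ
    refine ⟨by simp, by simpa using hl, by simp, by simp [T.base_val], fun i hi => ?_, by simp⟩
    obtain rfl : i = 0 := by omega
    simpa using hb
  | succ k ih =>
    intro hk σ l hl hlG hA y hy
    obtain ⟨h, hP, hhl, hal, hA', hV⟩ := T.sound k (by omega) σ l hl hlG hA
    have hbd := T.bound (k + 1) hk σ l hl hlG hA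
    rw [stateShift_sub] at hA' hV
    set z := backtrack (stateShift G w) P k ((G + 1) * (σ - w k * h) + (l - |h|)) with hz
    obtain ⟨i1, i2, i3, i4, i5, i6⟩ := ih (by omega) (σ - w k * h) (l - |h|) (by linarith)
      (by have := abs_nonneg h; linarith) hA' z hz
    have hyz : y = Function.update z k h := by
      rw [hy, hz, ← stateShift_sub]
      simp only [backtrack, hP]
    subst hyz
    have hsum : ∀ {i : ℕ}, i ≤ k → _ := sum_range_update (fun j a => w j * a) z k h
    have htot : ∑ j ∈ range (k + 1), w j * Function.update z k h j = σ := by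
      rw [Finset.sum_range_succ, hsum le_rfl, i6]; simp
    refine ⟨fun j hj => ?_, ?_, fun j hj => ?_, ?_, fun i hi => ?_, htot⟩
    · have : j ≠ k := by omega
      simp [this, i1 j (by omega)]
    · rw [Finset.sum_range_succ, sum_range_update (fun _ a => |a|) z k h le_rfl]
      simp only [Function.update_self]; linarith
    · rcases Nat.lt_succ_iff_lt_or_eq.1 hj with h' | rfl
      · have : j ≠ k := by omega
        simpa [this] using i3 j h'
      · simpa using hal
    · rw [Finset.sum_range_succ, sum_range_update c z k h le_rfl, hV, i4]; simp
    · rcases Nat.lt_succ_iff_lt_or_eq.1 (Nat.lt_succ_of_le hi) with h' | rfl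
      · rw [hsum (by omega)]; exact i5 i (by omega)
      · rw [htot]; exact hbd

/-- Completeness: every admissible vector traces a path of reachable states, so the tabulated value
is at most its cost. The budget `l` only has to dominate the norm, since layer zero accepts every
budget. -/
theorem value_le (T : IsTable m G S w al c A V P) (y : ℕ → ℤ) : ∀ k ≤ m, ∀ l : ℤ, l ≤ G →
    ∑ j ∈ range k, |y j| ≤ l → (∀ j < k, al j (y j) = 1) →
    (∀ i ≤ k, |∑ j ∈ range i, w j * y j| ≤ S i) →
    A k ((G + 1) * (∑ j ∈ range k, w j * y j) + l) = 1 ∧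
      V k ((G + 1) * (∑ j ∈ range k, w j * y j) + l) ≤ ∑ j ∈ range k, c j (y j) := by
  intro k
  induction k with
  | zero =>
    intro _ l hlG hl _ _
    exact ⟨(T.base _ l (by simpa using hl) hlG).2 (by simp), by simp [T.base_val]⟩
  | succ k ih =>
    intro hk l hlG hl hal hS
    rw [Finset.sum_range_succ] at hl
    have h0 : 0 ≤ ∑ j ∈ range k, |y j| := Finset.sum_nonneg fun _ _ => abs_nonneg _
    obtain ⟨i1, i2⟩ := ih (by omega) (l - |y k|) (by have := abs_nonneg (y k); linarith)
      (by linarith) (fun j hj => hal j (by omega)) (fun i hi => hS i (by omega))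
    have e : (G + 1) * (∑ j ∈ range k, w j * y j) + (l - |y k|) =
        (G + 1) * (∑ j ∈ range (k + 1), w j * y j) + l - stateShift G w k (y k) := by
      rw [stateShift_sub, Finset.sum_range_succ]; ring
    rw [e] at i1 i2
    obtain ⟨j1, j2⟩ := T.complete k (by omega) _ l (by have := abs_nonneg (y k); linarith) hlG
      (hS (k + 1) le_rfl) (y k) (by linarith) (hal k (by omega)) i1
    refine ⟨j1, j2.trans ?_⟩
    rw [Finset.sum_range_succ (fun j => c j (y j))]
    linarith

end IsTable

/-! ### Reasoning about programs -/

/-- The oracles available to a program. -/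
structure Env (n t : ℕ) where
  f : (Fin n × Fin t → ℤ) → ℤ
  ans : Option (Fin n × Fin t → ℝ)
  oo : ℕ

instance : Add Expr := ⟨Expr.add⟩
instance : Sub Expr := ⟨Expr.sub⟩

@[simp] theorem Expr.eval_add (s : State) (e₁ e₂ : Expr) :
    (e₁ + e₂).eval s = e₁.eval s + e₂.eval s := rfl
@[simp] theorem Expr.eval_sub (s : State) (e₁ e₂ : Expr) :
    (e₁ - e₂).eval s = e₁.eval s - e₂.eval s := rfl
@[simp] theorem Expr.eval_const (s : State) (z : ℤ) : (Expr.const z).eval s = z := rfl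
@[simp] theorem Expr.eval_var (s : State) (v : ℕ) : (Expr.var v).eval s = s.var v := rfl
@[simp] theorem Expr.eval_get (s : State) (a : ℕ) (i j : Expr) :
    (Expr.get a i j).eval s = s.arr a (i.eval s) (j.eval s) := rfl
@[simp] theorem Expr.eval_floor (s : State) (i j : Expr) :
    (Expr.floor i j).eval s = ⌊s.real (i.eval s) (j.eval s)⌋ := rfl
@[simp] theorem Expr.eval_ceil (s : State) (i j : Expr) :
    (Expr.ceil i j).eval s = ⌈s.real (i.eval s) (j.eval s)⌉ := rfl

@[simp] theorem Expr.cost_add (e₁ e₂ : Expr) : (e₁ + e₂).cost = e₁.cost + e₂.cost + 1 := rfl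
@[simp] theorem Expr.cost_sub (e₁ e₂ : Expr) : (e₁ - e₂).cost = e₁.cost + e₂.cost + 1 := rfl
@[simp] theorem Expr.cost_const (z : ℤ) : (Expr.const z).cost = 1 := rfl
@[simp] theorem Expr.cost_var (v : ℕ) : (Expr.var v).cost = 1 := rfl

namespace State

@[simp] theorem setVar_var (s : State) (v w : ℕ) (z : ℤ) :
    (s.setVar v z).var w = if w = v then z else s.var w := rfl
@[simp] theorem setVar_arr (s : State) (v : ℕ) (z : ℤ) : (s.setVar v z).arr = s.arr := rfl
@[simp] theorem setVar_real (s : State) (v : ℕ) (z : ℤ) : (s.setVar v z).real = s.real := rfl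
@[simp] theorem setArr_var (s : State) (a : ℕ) (i j z : ℤ) : (s.setArr a i j z).var = s.var := rfl
@[simp] theorem setArr_real (s : State) (a : ℕ) (i j z : ℤ) :
    (s.setArr a i j z).real = s.real := rfl

theorem setArr_arr (s : State) (a : ℕ) (i j z : ℤ) (a' : ℕ) (i' j' : ℤ) :
    (s.setArr a i j z).arr a' i' j' = if a' = a ∧ i' = i ∧ j' = j then z else s.arr a' i' j' := rfl

@[simp] theorem setArr_arr_self (s : State) (a : ℕ) (i j z i' j' : ℤ) :
    (s.setArr a i j z).arr a i' j' = if i' = i ∧ j' = j then z else s.arr a i' j' := by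
  simp [setArr_arr]

theorem setArr_arr_ne (s : State) {a a' : ℕ} (h : a' ≠ a) (i j z : ℤ) :
    (s.setArr a i j z).arr a' = s.arr a' := by
  funext i' j'; simp [setArr_arr, h]

end State

/-- Registers written by a program. -/
def Cmd.vars : Cmd → List ℕ
  | Cmd.skip => []
  | Cmd.assign v _ => [v]
  | Cmd.store _ _ _ _ => []
  | Cmd.seq c₁ c₂ => c₁.vars ++ c₂.vars
  | Cmd.ite _ c₁ c₂ => c₁.vars ++ c₂.vars
  | Cmd.loop _ c => c.vars
  | Cmd.evalObj v _ => [v]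
  | Cmd.relax v => [v]

/-- Arrays written by a program. -/
def Cmd.arrs : Cmd → List ℕ
  | Cmd.skip => []
  | Cmd.assign _ _ => []
  | Cmd.store a _ _ _ => [a]
  | Cmd.seq c₁ c₂ => c₁.arrs ++ c₂.arrs
  | Cmd.ite _ c₁ c₂ => c₁.arrs ++ c₂.arrs
  | Cmd.loop _ c => c.arrs
  | Cmd.evalObj _ _ => []
  | Cmd.relax _ => []

/-- Whether a program calls the optimization oracle. -/
def Cmd.relaxes : Cmd → Bool
  | Cmd.seq c₁ c₂ => c₁.relaxes || c₂.relaxes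
  | Cmd.ite _ c₁ c₂ => c₁.relaxes || c₂.relaxes
  | Cmd.loop _ c => c.relaxes
  | Cmd.relax _ => true
  | _ => false

/-- The two states differ only in memory that `c` writes to. -/
structure Agree (c : Cmd) (s s' : State) : Prop where
  var : ∀ v, v ∉ c.vars → s'.var v = s.var v
  arr : ∀ a, a ∉ c.arrs → s'.arr a = s.arr a
  real : c.relaxes = false → s'.real = s.real

theorem Agree.refl (c : Cmd) (s : State) : Agree c s s :=
  ⟨fun _ _ => rfl, fun _ _ => rfl, fun _ => rfl⟩

theorem Agree.trans {c : Cmd} {s₁ s₂ s₃ : State} (h₁ : Agree c s₁ s₂) (h₂ : Agree c s₂ s₃) :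
    Agree c s₁ s₃ :=
  ⟨fun v hv => (h₂.var v hv).trans (h₁.var v hv), fun a ha => (h₂.arr a ha).trans (h₁.arr a ha),
    fun h => (h₂.real h).trans (h₁.real h)⟩

theorem Agree.mono {c c' : Cmd} {s s' : State} (h : Agree c s s') (hv : ∀ v ∈ c.vars, v ∈ c'.vars)
    (ha : ∀ a ∈ c.arrs, a ∈ c'.arrs) (hr : c.relaxes = true → c'.relaxes = true) :
    Agree c' s s' :=
  ⟨fun v hv' => h.var v fun h' => hv' (hv v h'), fun a ha' => h.arr a fun h' => ha' (ha a h'),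
    fun h' => h.real (by
      cases hc : c.relaxes
      · rfl
      · rw [hr hc] at h'; exact absurd h' (by simp))⟩

theorem Agree.setVar (c : Cmd) (s : State) {v : ℕ} (z : ℤ) (hv : v ∈ c.vars) :
    Agree c s (s.setVar v z) :=
  ⟨fun w hw => by
    have : w ≠ v := by rintro rfl; exact hw hv
    simp [this], fun _ _ => rfl, fun _ => rfl⟩

/-- The frame rule. Membership in the lists of written registers and arrays is decidable for a
concrete program, so every later frame condition is settled by `decide`. -/
theorem Exec.agree {n t : ℕ} {f : (Fin n × Fin t → ℤ) → ℤ} {ans : Option (Fin n × Fin t → ℝ)}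
    {oo : ℕ} {c : Cmd} {s s' : State} {T : ℕ} (h : Exec f ans oo c s T s') : Agree c s s' := by
  induction h with
  | skip s => exact Agree.refl _ s
  | assign v e s => exact Agree.setVar _ s _ (by simp [Cmd.vars])
  | store a i j e s =>
    refine ⟨fun _ _ => rfl, fun a' ha' => ?_, fun _ => rfl⟩
    exact State.setArr_arr_ne s (by simpa [Cmd.arrs] using ha') _ _ _
  | @seq c₁ c₂ _ _ _ _ _ _ _ ih₁ ih₂ =>
    exact (ih₁.mono (c' := Cmd.seq c₁ c₂) (by simp +contextual [Cmd.vars])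
      (by simp +contextual [Cmd.arrs]) (by simp +contextual [Cmd.relaxes])).trans
      (ih₂.mono (by simp +contextual [Cmd.vars]) (by simp +contextual [Cmd.arrs])
        (by simp +contextual [Cmd.relaxes]))
  | iteTrue _ _ ih =>
    exact ih.mono (by simp +contextual [Cmd.vars]) (by simp +contextual [Cmd.arrs])
      (by simp +contextual [Cmd.relaxes])
  | iteFalse _ _ ih =>
    exact ih.mono (by simp +contextual [Cmd.vars]) (by simp +contextual [Cmd.arrs])
      (by simp +contextual [Cmd.relaxes])
  | @loopTrue e c _ _ _ _ _ _ _ _ ih₁ ih₂ =>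
    exact (ih₁.mono (c' := Cmd.loop e c) (by simp [Cmd.vars]) (by simp [Cmd.arrs])
      (by simp [Cmd.relaxes])).trans ih₂
  | loopFalse => exact Agree.refl _ _
  | evalObj v a s => exact Agree.setVar _ s _ (by simp [Cmd.vars])
  | relax v s =>
    have hv : v ∈ (Cmd.relax v).vars := by simp [Cmd.vars]
    cases ans with
    | none => exact Agree.setVar _ s 0 hv
    | some x => exact ⟨(Agree.setVar _ s 1 hv).var, fun _ _ => rfl, by simp [Cmd.relaxes]⟩

/-- Started in `s`, the program `c` halts after time at most `T` in a state satisfying `Q`. -/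
def Run {n t : ℕ} (E : Env n t) (c : Cmd) (s : State) (T : ℕ) (Q : State → Prop) : Prop :=
  ∃ T' s', Exec E.f E.ans E.oo c s T' s' ∧ T' ≤ T ∧ Q s'

namespace Run

variable {n t : ℕ} {E : Env n t} {c c₁ c₂ : Cmd} {s : State} {T T₁ T₂ : ℕ} {Q Q' : State → Prop}

theorem mono (h : Run E c s T₁ Q) (hT : T₁ ≤ T₂) (hQ : ∀ s', Agree c s s' → Q s' → Q' s') :
    Run E c s T₂ Q' := by
  obtain ⟨T', s', h1, h2, h3⟩ := h
  exact ⟨T', s', h1, h2.trans hT, hQ s' h1.agree h3⟩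

theorem le (h : Run E c s T₁ Q) (hT : T₁ ≤ T₂) : Run E c s T₂ Q := h.mono hT fun _ _ h => h

theorem seq (h : Run E c₁ s T₁ fun s₁ => Run E c₂ s₁ T₂ Q) :
    Run E (Cmd.seq c₁ c₂) s (T₁ + T₂) Q := by
  obtain ⟨T', s', h1, h2, T'', s'', h3, h4, h5⟩ := h
  exact ⟨T' + T'', s'', h1.seq h3, by omega, h5⟩

/-- Sequential composition; the intermediate state is known to agree with the initial one. -/
theorem bind (h₁ : Run E c₁ s T₁ Q') (h₂ : ∀ s₁, Agree c₁ s s₁ → Q' s₁ → Run E c₂ s₁ T₂ Q) :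
    Run E (Cmd.seq c₁ c₂) s (T₁ + T₂) Q :=
  seq (h₁.mono le_rfl h₂)

theorem ite {e : Expr} (h₁ : 0 < e.eval s → Run E c₁ s T₁ Q)
    (h₂ : ¬ 0 < e.eval s → Run E c₂ s T₂ Q) :
    Run E (Cmd.ite e c₁ c₂) s (e.cost + 1 + (T₁ + T₂)) Q := by
  by_cases h : 0 < e.eval s
  · obtain ⟨T', s', h1, h2, h3⟩ := h₁ h
    exact ⟨_, s', Exec.iteTrue h h1, by omega, h3⟩
  · obtain ⟨T', s', h1, h2, h3⟩ := h₂ h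
    exact ⟨_, s', Exec.iteFalse h h1, by omega, h3⟩

end Run

/-- A bound for the running time of a program without loops. -/
def Cmd.bound : Cmd → ℕ
  | Cmd.skip => 1
  | Cmd.assign _ e => e.cost + 1
  | Cmd.store _ i j e => i.cost + j.cost + e.cost + 1
  | Cmd.seq c₁ c₂ => c₁.bound + c₂.bound
  | Cmd.ite e c₁ c₂ => e.cost + 1 + (c₁.bound + c₂.bound)
  | Cmd.evalObj _ _ => 1
  | _ => 0

/-- Weakest preconditions of programs without loops. -/
def Cmd.wp {n t : ℕ} (f : (Fin n × Fin t → ℤ) → ℤ) : Cmd → State → (State → Prop) → Prop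
  | Cmd.skip, s, Q => Q s
  | Cmd.assign v e, s, Q => Q (s.setVar v (e.eval s))
  | Cmd.store a i j e, s, Q => Q (s.setArr a (i.eval s) (j.eval s) (e.eval s))
  | Cmd.seq c₁ c₂, s, Q => c₁.wp f s fun s₁ => c₂.wp f s₁ Q
  | Cmd.ite e c₁ c₂, s, Q => (0 < e.eval s → c₁.wp f s Q) ∧ (¬ 0 < e.eval s → c₂.wp f s Q)
  | Cmd.evalObj v a, s, Q => Q (s.setVar v (f (readVec n t (s.arr a))))
  | _, _, _ => False

theorem Cmd.wp_mono {n t : ℕ} {f : (Fin n × Fin t → ℤ) → ℤ} {c : Cmd} {s : State}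
    {Q Q' : State → Prop} (h : c.wp f s Q) (hQ : ∀ s', Q s' → Q' s') : c.wp f s Q' := by
  induction c generalizing s Q Q' with
  | skip => exact hQ _ h
  | assign => exact hQ _ h
  | store => exact hQ _ h
  | seq c₁ c₂ ih₁ ih₂ => exact ih₁ h fun s' h' => ih₂ h' hQ
  | ite e c₁ c₂ ih₁ ih₂ => exact ⟨fun h' => ih₁ (h.1 h') hQ, fun h' => ih₂ (h.2 h') hQ⟩
  | loop => exact h
  | evalObj => exact hQ _ h
  | relax => exact h

/-- Loop-free code is handled by computation: `Cmd.wp` unfolds to a condition on the initial state,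
and `Cmd.bound` evaluates to a numeral for concrete code. Loops and oracle calls have precondition
`False`, so the rule cannot be applied to them. -/
theorem Run.straight {n t : ℕ} {E : Env n t} {c : Cmd} {s : State} {Q : State → Prop}
    (h : c.wp E.f s Q) : Run E c s c.bound Q := by
  induction c generalizing s Q with
  | skip => exact ⟨_, _, Exec.skip s, le_rfl, h⟩
  | assign v e => exact ⟨_, _, Exec.assign v e s, le_rfl, h⟩
  | store a i j e => exact ⟨_, _, Exec.store a i j e s, le_rfl, h⟩
  | seq c₁ c₂ ih₁ ih₂ => exact Run.seq (ih₁ (Cmd.wp_mono h fun s' h' => ih₂ h'))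
  | ite e c₁ c₂ ih₁ ih₂ => exact Run.ite (fun h' => ih₁ (h.1 h')) fun h' => ih₂ (h.2 h')
  | loop => exact h.elim
  | evalObj v a => exact ⟨_, _, Exec.evalObj v a s, le_rfl, h⟩
  | relax => exact h.elim

/-! ### Counting loops -/

/-- `for v := 0, …, lim - 1 do c` -/
def forUp (v : ℕ) (lim : Expr) (c : Cmd) : Cmd :=
  Cmd.seq (Cmd.assign v (Expr.const 0)) (Cmd.loop (lim - Expr.var v)
    (Cmd.seq c (Cmd.assign v (Expr.var v + Expr.const 1))))

theorem forUp_vars (v : ℕ) (lim : Expr) (c : Cmd) :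
    (forUp v lim c).vars = v :: (c.vars ++ [v]) := rfl

theorem forUp_arrs (v : ℕ) (lim : Expr) (c : Cmd) : (forUp v lim c).arrs = c.arrs := by
  simp [forUp, Cmd.arrs]

/-- The invariant rule for counting loops. The limit is evaluated anew in every round, hence `hlim`
asks for its value in all states that the loop can produce. The invariant is stated after the
counter has been updated. -/
theorem Run.forUp {n t : ℕ} {E : Env n t} {v : ℕ} {lim : Expr} {c : Cmd} {s : State} {N T : ℕ}
    (P : ℕ → State → Prop) (hv : v ∉ c.vars)
    (hlim : ∀ s', Agree (forUp v lim c) s s' → lim.eval s' = N)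
    (h0 : P 0 (s.setVar v 0))
    (hc : ∀ i < N, ∀ s', Agree (CombNFold.forUp v lim c) s s' → s'.var v = i → P i s' →
      Run E c s' T fun s'' => P (i + 1) (s''.setVar v (i + 1))) :
    Run E (CombNFold.forUp v lim c) s ((N + 1) * (T + lim.cost + 10)) fun s' => P N s' := by
  have hvm : v ∈ (CombNFold.forUp v lim c).vars := by simp [forUp_vars]
  have key : ∀ j i, i + j = N → ∀ s', Agree (CombNFold.forUp v lim c) s s' → s'.var v = i → P i s' →
      Run E (Cmd.loop (lim - Expr.var v) (Cmd.seq c (Cmd.assign v (Expr.var v + Expr.const 1))))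
        s' (j * (T + lim.cost + 7) + lim.cost + 3) fun s'' => P N s'' := by
    intro j
    induction j with
    | zero =>
      intro i hi s' ha hvi hP
      obtain rfl : i = N := by omega
      refine ⟨_, s', Exec.loopFalse ?_, ?_, hP⟩
      · simp [hlim s' ha, hvi]
      · simp
    | succ j ih =>
      intro i hi s' ha hvi hP
      obtain ⟨T', s'', h1, h2, h3⟩ := hc i (by omega) s' ha hvi hP
      have ha1 : Agree (CombNFold.forUp v lim c) s' s'' := h1.agree.mono
        (by simp +contextual [forUp_vars])
        (by simp +contextual [forUp_arrs]) (by simp +contextual [CombNFold.forUp, Cmd.relaxes])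
      have hv'' : s''.var v = i := by rw [h1.agree.var v hv, hvi]
      have ha2 := (ha.trans ha1).trans (Agree.setVar _ s'' ((i : ℤ) + 1) hvm)
      obtain ⟨T₂, s₃, h4, h5, h6⟩ := ih (i + 1) (by omega) _ ha2 (by simp) h3
      refine ⟨_, s₃, Exec.loopTrue ?_ (h1.seq (Exec.assign _ _ _)) (T₂ := T₂) ?_, ?_, h6⟩
      · simp only [Expr.eval_sub, hlim s' ha, Expr.eval_var, hvi]; omega
      · simpa [hv''] using h4
      · simp only [Expr.cost_sub, Expr.cost_var, Expr.cost_add, Expr.cost_const]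
        rw [Nat.add_mul]
        omega
  obtain ⟨T', s', h1, h2, h3⟩ := key N 0 (by omega) _ (Agree.setVar _ s 0 hvm) (by simp) h0
  refine ⟨_, s', (Exec.assign _ _ _).seq h1, ?_, h3⟩
  simp only [Expr.cost_const]
  have : N * (T + lim.cost + 7) ≤ N * (T + lim.cost + 10) := Nat.mul_le_mul_left _ (by omega)
  rw [Nat.add_mul]
  omega

/-! ### Memory layout of the program -/

infixr:60 ";;" => Cmd.seq
infix:62 "::=" => Cmd.assign

notation "regR" => (0 : ℕ)
notation "regT" => (1 : ℕ)
notation "regN" => (2 : ℕ)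
notation "regOk" => (3 : ℕ)
notation "regDelta" => (4 : ℕ)
notation "regPhase" => (5 : ℕ)
notation "regG" => (6 : ℕ)
notation "regV" => (7 : ℕ)
notation "regB" => (8 : ℕ)
notation "regNT" => (9 : ℕ)
notation "regM" => (10 : ℕ)
notation "regW" => (11 : ℕ)
notation "regLowBrick" => (12 : ℕ)
notation "regLowFull" => (13 : ℕ)
notation "regI" => (14 : ℕ)
notation "regJ" => (15 : ℕ)
notation "regK" => (16 : ℕ)
notation "regQ" => (17 : ℕ)
notation "regC" => (18 : ℕ)
notation "regTau" => (19 : ℕ)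
notation "regLam" => (20 : ℕ)
notation "regCell" => (21 : ℕ)
notation "regBest" => (22 : ℕ)
notation "regArg" => (23 : ℕ)
notation "regH" => (24 : ℕ)
notation "regPrev" => (25 : ℕ)
notation "regCand" => (26 : ℕ)
notation "regAcc" => (27 : ℕ)
notation "regGo" => (28 : ℕ)
notation "regF" => (29 : ℕ)
notation "regX" => (30 : ℕ)
notation "regP" => (31 : ℕ)
notation "regD" => (32 : ℕ)
notation "regY" => (33 : ℕ)
notation "regBase" => (34 : ℕ)

notation "arrD" => (0 : ℕ)
notation "arrTop" => (1 : ℕ)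
notation "arrBrick" => (2 : ℕ)
notation "arrL" => (3 : ℕ)
notation "arrU" => (4 : ℕ)
notation "arrX" => (5 : ℕ)
notation "arrLo" => (6 : ℕ)
notation "arrUp" => (7 : ℕ)
notation "arrRow" => (8 : ℕ)
notation "arrCol" => (9 : ℕ)
notation "arrPow" => (10 : ℕ)
notation "arrShift" => (11 : ℕ)
notation "arrCount" => (12 : ℕ)
notation "arrLow" => (13 : ℕ)
notation "arrAllow" => (14 : ℕ)
notation "arrCost" => (15 : ℕ)
notation "arrReach" => (16 : ℕ)
notation "arrVal" => (17 : ℕ)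
notation "arrArg" => (18 : ℕ)

/-! ### The dynamic program -/

/-- Tries the value `regC - regLam` of the variable `regK` in the state `regTau`. -/
def tryValue : Cmd :=
  regH ::= Expr.var regC - Expr.var regLam ;;
  regPrev ::= Expr.var regTau - Expr.get arrShift (Expr.var regK) (Expr.var regH) ;;
  Cmd.ite (Expr.get arrAllow (Expr.var regK) (Expr.var regH))
    (Cmd.ite (Expr.get arrReach (Expr.var regK) (Expr.var regPrev))
      (regCand ::= Expr.get arrVal (Expr.var regK) (Expr.var regPrev) +
          Expr.get arrCost (Expr.var regK) (Expr.var regH) ;;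
        Cmd.ite (Expr.var regCell)
          (Cmd.ite (Expr.var regBest - Expr.var regCand)
            (regBest ::= Expr.var regCand ;; regArg ::= Expr.var regH)
            Cmd.skip)
          (regCell ::= Expr.const 1 ;; regBest ::= Expr.var regCand ;; regArg ::= Expr.var regH))
      Cmd.skip)
    Cmd.skip

/-- Computes the entry of the tables for the variable `regK` and the state `regTau`. -/
def fillCell : Cmd :=
  regCell ::= Expr.const 0 ;; regBest ::= Expr.const 0 ;; regArg ::= Expr.const 0 ;;
  forUp regC (Expr.var regLam + Expr.var regLam + Expr.const 1) tryValue ;;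
  Cmd.store arrReach (Expr.var regK + Expr.const 1) (Expr.var regTau) (Expr.var regCell) ;;
  Cmd.store arrVal (Expr.var regK + Expr.const 1) (Expr.var regTau) (Expr.var regBest) ;;
  Cmd.store arrArg (Expr.var regK + Expr.const 1) (Expr.var regTau) (Expr.var regArg) ;;
  regTau ::= Expr.var regTau + Expr.const 1 ;;
  regLam ::= Expr.var regLam + Expr.const 1 ;;
  Cmd.ite (Expr.var regLam - Expr.var regG) (regLam ::= Expr.const 0) Cmd.skip

/-- Computes a layer of the tables. -/
def fillLayer : Cmd :=
  regTau ::= Expr.get arrLow (Expr.var regK) (Expr.const 0) ;; regLam ::= Expr.const 0 ;;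
  forUp regQ (Expr.get arrCount (Expr.var regK) (Expr.const 0)) fillCell

def dynProg : Cmd := forUp regK (Expr.var regM) fillLayer

/-- The entry `(o, b, a)` of the tables for the state `τ` with norm budget `l` takes all values
`h < B` of the variable `k` into account. -/
def CellSpec (al c A V W : ℤ → ℤ → ℤ) (k τ l B o b a : ℤ) : Prop :=
  (o = 0 ∨ o = 1) ∧
  (o = 1 → |a| ≤ l ∧ al k a = 1 ∧ A k (τ - W k a) = 1 ∧ b = V k (τ - W k a) + c k a) ∧
  ∀ h, |h| ≤ l → h < B → al k h = 1 → A k (τ - W k h) = 1 →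
    o = 1 ∧ b ≤ V k (τ - W k h) + c k h

/-- A cell of layer `k + 1` depends only on layer `k`, which filling layer `k + 1` leaves alone. -/
theorem CellSpec.congr {al c A V W A' V' : ℤ → ℤ → ℤ} {k τ l B o b a : ℤ}
    (h : CellSpec al c A V W k τ l B o b a) (hA : ∀ τ, A' k τ = A k τ) (hV : ∀ τ, V' k τ = V k τ) :
    CellSpec al c A' V' W k τ l B o b a := by
  simpa only [CellSpec, hA, hV] using h

section Programs

variable {n t : ℕ} {E : Env n t}

/-- One more value `h = i - l` enters the running minimum. Five branches arise: better, not better,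
first candidate, unreachable predecessor, inadmissible value. -/
theorem run_tryValue {s : State} {i l : ℕ} {k τ : ℤ} (hi : i < 2 * l + 1) (hlam : s.var regLam = l)
    (hc : s.var regC = i) (hk : s.var regK = k) (hτ : s.var regTau = τ)
    (hal : ∀ h, |h| ≤ (l : ℤ) →
      s.arr arrAllow k h = 0 ∨ s.arr arrAllow k h = 1)
    (hA : ∀ k τ, s.arr arrReach k τ = 0 ∨ s.arr arrReach k τ = 1)
    (h : CellSpec (s.arr arrAllow) (s.arr arrCost) (s.arr arrReach) (s.arr arrVal) (s.arr arrShift)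
      k τ l (i - l) (s.var regCell) (s.var regBest) (s.var regArg)) :
    Run E tryValue s 100 fun s' =>
      CellSpec (s.arr arrAllow) (s.arr arrCost) (s.arr arrReach) (s.arr arrVal) (s.arr arrShift)
        k τ l ((i + 1 : ℕ) - l) (s'.var regCell) (s'.var regBest)
        (s'.var regArg) := by
  refine (Run.straight ?_).le (T₁ := tryValue.bound) (by decide)
  obtain ⟨h1, h2, h3⟩ := h
  have habs : |(i : ℤ) - l| ≤ l := by rw [abs_le]; constructor <;> omega
  have hal0 := hal _ habs
  have hA0 := hA k (τ - s.arr arrShift k (i - l))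
  have hstep : ∀ h' : ℤ, h' < ((i + 1 : ℕ) : ℤ) - l → h' < i - l ∨ h' = i - l := by
    intro h' hh'; push_cast at hh'; omega
  simp only [tryValue, Cmd.wp, Expr.eval_sub, Expr.eval_var, Expr.eval_get, Expr.eval_add,
    State.setVar_var, State.setVar_arr, Expr.eval_const, hlam, hc, hk, hτ]
  norm_num only [if_true, if_false]
  refine ⟨fun ha => ⟨fun hr => ⟨fun ho => ⟨fun hb => ?_, fun hb => ?_⟩, fun ho => ?_⟩, fun hr => ?_⟩,
    fun ha => ?_⟩
  · refine ⟨h1, fun _ => ⟨habs, ?_, ?_, rfl⟩, fun h' hl hB hal' hr' => ?_⟩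
    · omega
    · omega
    · have ho1 : s.var regCell = 1 := by omega
      refine ⟨ho1, ?_⟩
      rcases hstep h' hB with hlt | rfl
      · have := (h3 h' hl hlt hal' hr').2; omega
      · exact le_rfl
  · refine ⟨h1, h2, fun h' hl hB hal' hr' => ?_⟩
    have ho1 : s.var regCell = 1 := by omega
    refine ⟨ho1, ?_⟩
    rcases hstep h' hB with hlt | rfl
    · exact (h3 h' hl hlt hal' hr').2
    · omega
  · refine ⟨Or.inr rfl, fun _ => ⟨habs, ?_, ?_, rfl⟩, fun h' hl hB hal' hr' => ⟨rfl, ?_⟩⟩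
    · omega
    · omega
    · rcases hstep h' hB with hlt | rfl
      · have := (h3 h' hl hlt hal' hr').1; omega
      · exact le_rfl
  · refine ⟨h1, h2, fun h' hl hB hal' hr' => ?_⟩
    rcases hstep h' hB with hlt | rfl
    · exact h3 h' hl hlt hal' hr'
    · exact absurd hr' (by omega)
  · refine ⟨h1, h2, fun h' hl hB hal' hr' => ?_⟩
    rcases hstep h' hB with hlt | rfl
    · exact h3 h' hl hlt hal' hr'
    · exact absurd hal' (by omega)

theorem run_fillCell {s : State} {l G : ℕ} {k τ : ℤ} (hlam : s.var regLam = l) (hl : l ≤ G)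
    (hG : s.var regG = G) (hk : s.var regK = k) (hτ : s.var regTau = τ)
    (hal : ∀ h, |h| ≤ (G : ℤ) → s.arr arrAllow k h = 0 ∨ s.arr arrAllow k h = 1)
    (hA : ∀ k τ, s.arr arrReach k τ = 0 ∨ s.arr arrReach k τ = 1) :
    Run E fillCell s ((2 * G + 2) * 120 + 100) fun s' => ∃ o b a,
      CellSpec (s.arr arrAllow) (s.arr arrCost) (s.arr arrReach) (s.arr arrVal) (s.arr arrShift)
        k τ l (l + 1) o b a ∧
      (∀ k' τ', s'.arr arrReach k' τ' = if k' = k + 1 ∧ τ' = τ then o else s.arr arrReach k' τ') ∧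
      (∀ k' τ', s'.arr arrVal k' τ' = if k' = k + 1 ∧ τ' = τ then b else s.arr arrVal k' τ') ∧
      (∀ k' τ', s'.arr arrArg k' τ' = if k' = k + 1 ∧ τ' = τ then a else s.arr arrArg k' τ') ∧
      s'.var regTau = τ + 1 ∧ s'.var regLam = if l = G then 0 else (l : ℤ) + 1 := by
  refine Run.le (T₁ := 2 + (2 + (2 + ((2 * l + 1 + 1) * (100 + 5 + 10) + 60)))) ?_ (by
    have : (2 * l + 1 + 1) * (100 + 5 + 10) ≤ (2 * G + 2) * 120 := by nlinarith
    omega)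
  refine Run.seq (Run.straight ?_)
  refine Run.seq (Run.straight ?_)
  refine Run.seq (Run.straight ?_)
  simp only [Cmd.wp, Expr.eval_const]
  -- The counter `i` stands for the value `i - l`, so `2 * l + 1` rounds cover `-l, …, l`, exactly
  -- the values that the budget permits.
  refine Run.bind (Run.forUp (N := 2 * l + 1) (T := 100) (fun i s' =>
    CellSpec (s.arr arrAllow) (s.arr arrCost) (s.arr arrReach) (s.arr arrVal) (s.arr arrShift)
      k τ l (i - l) (s'.var regCell) (s'.var regBest) (s'.var regArg)) (by decide) ?_ ?_ ?_) ?_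
  · intro s' ha
    have := ha.var regLam (by decide)
    simp [this, hlam]; ring
  · refine ⟨Or.inl rfl, fun h => by simp at h, fun h hl hB => ?_⟩
    simp only [Nat.cast_zero, zero_sub] at hB
    have := neg_abs_le h
    omega
  · intro i hi s' ha hc hP
    have hlam' := ha.var regLam (by decide)
    have hk' := ha.var regK (by decide)
    have hτ' := ha.var regTau (by decide)
    have e1 := ha.arr arrAllow (by decide)
    have e2 := ha.arr arrCost (by decide)
    have e3 := ha.arr arrReach (by decide)
    have e4 := ha.arr arrVal (by decide)
    have e5 := ha.arr arrShift (by decide)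
    simp at hlam' hk' hτ' e1 e2 e3 e4 e5
    refine (run_tryValue (i := i) (l := l) (k := k) (τ := τ) hi (by omega) hc (by omega) (by omega)
      (fun h hh => by rw [e1]; exact hal h (by omega)) (by rw [e3]; exact hA)
      (by rw [e1, e2, e3, e4, e5]; exact hP)).mono le_rfl fun s'' _ h => ?_
    rw [e1, e2, e3, e4, e5] at h
    simpa using h
  · intro s₁ ha hP
    have hlam' := ha.var regLam (by decide)
    have hk' := ha.var regK (by decide)
    have hτ' := ha.var regTau (by decide)
    have hG' := ha.var regG (by decide)
    have e3 := ha.arr arrReach (by decide)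
    have e4 := ha.arr arrVal (by decide)
    have e5 := ha.arr arrArg (by decide)
    simp at hlam' hk' hτ' hG' e3 e4 e5
    refine (Run.straight ?_).le (by decide)
    simp only [Cmd.wp, Expr.eval_sub, Expr.eval_var, Expr.eval_add, State.setVar_var,
      State.setVar_arr, Expr.eval_const, State.setArr_var, hlam', hk', hτ', hG', hlam, hk, hτ, hG,
      State.setArr_arr, e3, e4, e5]
    norm_num only [if_true, if_false]
    have hP' : CellSpec (s.arr arrAllow) (s.arr arrCost) (s.arr arrReach) (s.arr arrVal)
        (s.arr arrShift) k τ l (l + 1) (s₁.var regCell) (s₁.var regBest) (s₁.var regArg) := by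
      convert hP using 1; push_cast; ring
    refine ⟨fun h => ⟨_, _, _, hP', ?_, ?_, ?_, trivial, ?_⟩,
      fun h => ⟨_, _, _, hP', ?_, ?_, ?_, trivial, ?_⟩⟩ <;> try (intro k' τ'; simp)
    · have : l = G := by omega
      simp [this]
    · have : l ≠ G := by omega
      simp [this]

/-- The states of a layer are consecutive integers. When `low` is a multiple of `G + 1`, as in its
use below, the budget of the state `low + q` is `q % (G + 1)`; the program maintains it by a counter
that wraps around at `G`, without any division. -/
theorem run_fillLayer {s : State} {G N : ℕ} {k low : ℤ} (hG : s.var regG = G) (hk : s.var regK = k)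
    (hlow : s.arr arrLow k 0 = low) (hcnt : s.arr arrCount k 0 = N)
    (hal : ∀ h, |h| ≤ (G : ℤ) → s.arr arrAllow k h = 0 ∨ s.arr arrAllow k h = 1)
    (hA : ∀ k τ, s.arr arrReach k τ = 0 ∨ s.arr arrReach k τ = 1) :
    Run E fillLayer s ((N + 1) * ((2 * G + 2) * 120 + 120)) fun s' =>
      (∀ k' τ, k' ≠ k + 1 → s'.arr arrReach k' τ = s.arr arrReach k' τ ∧
        s'.arr arrVal k' τ = s.arr arrVal k' τ ∧ s'.arr arrArg k' τ = s.arr arrArg k' τ) ∧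
      (∀ τ, τ < low ∨ low + N ≤ τ → s'.arr arrReach (k + 1) τ = s.arr arrReach (k + 1) τ) ∧
      ∀ q < N, CellSpec (s.arr arrAllow) (s.arr arrCost) (s.arr arrReach) (s.arr arrVal)
        (s.arr arrShift) k (low + q) ((q % (G + 1) : ℕ)) ((q % (G + 1) : ℕ) + 1)
        (s'.arr arrReach (k + 1) (low + q)) (s'.arr arrVal (k + 1) (low + q))
        (s'.arr arrArg (k + 1) (low + q)) := by
  refine Run.le (T₁ := 4 + (2 + (N + 1) * ((2 * G + 2) * 120 + 100 + 3 + 10))) ?_ (by nlinarith)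
  refine Run.seq (Run.straight ?_)
  refine Run.seq (Run.straight ?_)
  simp only [Cmd.wp, Expr.eval_const, Expr.eval_get, Expr.eval_var, hk, hlow]
  refine (Run.forUp (N := N) (T := (2 * G + 2) * 120 + 100) (fun i s' =>
    s'.var regTau = low + i ∧ s'.var regLam = ((i % (G + 1) : ℕ) : ℤ) ∧
    (∀ k' τ, k' ≠ k + 1 → s'.arr arrReach k' τ = s.arr arrReach k' τ ∧
        s'.arr arrVal k' τ = s.arr arrVal k' τ ∧ s'.arr arrArg k' τ = s.arr arrArg k' τ) ∧
    (∀ k' τ, s'.arr arrReach k' τ = 0 ∨ s'.arr arrReach k' τ = 1) ∧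
    (∀ τ, τ < low ∨ low + i ≤ τ → s'.arr arrReach (k + 1) τ = s.arr arrReach (k + 1) τ) ∧
    ∀ q < i, CellSpec (s.arr arrAllow) (s.arr arrCost) (s.arr arrReach) (s.arr arrVal)
        (s.arr arrShift) k (low + q) ((q % (G + 1) : ℕ)) ((q % (G + 1) : ℕ) + 1)
        (s'.arr arrReach (k + 1) (low + q)) (s'.arr arrVal (k + 1) (low + q))
        (s'.arr arrArg (k + 1) (low + q))) (by decide) ?_ ?_ ?_).mono le_rfl ?_
  · intro s' ha
    have h1 := ha.var regK (by decide)
    have h2 := ha.arr arrCount (by decide)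
    simp at h1 h2
    simp [h1, h2, hk, hcnt]
  · simp [hA]
  · intro i hi s' ha hq hP
    obtain ⟨p1, p2, p3, p4, p5, p6⟩ := hP
    have hk' := ha.var regK (by decide)
    have hG' := ha.var regG (by decide)
    have e1 := ha.arr arrAllow (by decide)
    have e2 := ha.arr arrCost (by decide)
    have e5 := ha.arr arrShift (by decide)
    simp at hk' hG' e1 e2 e5
    have hlt : i % (G + 1) < G + 1 := Nat.mod_lt _ (by omega)
    refine (run_fillCell (l := i % (G + 1)) (G := G) (k := k) (τ := low + i) p2 (by omega)
      (by omega) (by omega) p1 (by rw [e1]; exact hal) p4).mono le_rfl fun s'' ha' h => ?_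
    obtain ⟨o, b, a, hc, hr, hv, hg, h1, h2⟩ := h
    rw [e1, e2, e5] at hc
    have hc' := hc.congr (A' := s.arr arrReach) (V' := s.arr arrVal)
      (fun τ => ((p3 k τ (by omega)).1).symm) (fun τ => ((p3 k τ (by omega)).2.1).symm)
    simp only [State.setVar_var, State.setVar_arr]
    norm_num only [if_true, if_false]
    refine ⟨by rw [h1]; push_cast; ring, ?_, fun k' τ hne => ?_, fun k' τ => ?_, fun τ hτ => ?_,
      fun q hq => ?_⟩
    · rw [h2]
      split_ifs with h
      · rw [Nat.add_mod, h]; simp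
      · rw [Nat.add_mod, Nat.mod_eq_of_lt (a := i % (G + 1) + 1 % (G + 1))]
        · rw [Nat.mod_eq_of_lt (a := 1) (by omega)]; push_cast; rfl
        · rw [Nat.mod_eq_of_lt (a := 1) (by omega)]; omega
    · rw [hr, hv, hg]
      simpa [hne] using p3 k' τ hne
    · rw [hr]
      split_ifs
      · exact hc.1
      · exact p4 k' τ
    · rw [hr, if_neg, p5 τ (by push_cast at hτ; omega)]
      push_cast at hτ; omega
    · rw [hr, hv, hg]
      rcases Nat.lt_succ_iff_lt_or_eq.1 hq with h | rfl
      · rw [if_neg (by omega), if_neg (by omega), if_neg (by omega)]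
        exact p6 q h
      · simpa using hc'
  · rintro s' - ⟨-, -, p3, -, p5, p6⟩
    exact ⟨p3, p5, p6⟩

/-- The static data of the dynamic program, and the invariants of its tables. -/
structure DPReady (m G : ℕ) (S : ℕ → ℕ) (w : ℕ → ℤ) (s : State) : Prop where
  regM_eq : s.var regM = m
  regG_eq : s.var regG = G
  low : ∀ k < m, s.arr arrLow k 0 = -((G + 1) * S (k + 1))
  count : ∀ k < m, s.arr arrCount k 0 = ((G + 1) * (2 * S (k + 1) + 1) : ℕ)
  shift : ∀ k < m, ∀ h : ℤ, |h| ≤ G → s.arr arrShift k h = stateShift G w k h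
  bit : ∀ k τ, s.arr arrReach k τ = 0 ∨ s.arr arrReach k τ = 1
  base : ∀ τ, s.arr arrReach 0 τ = 1 ↔ 0 ≤ τ ∧ τ ≤ G
  base_val : ∀ τ, s.arr arrVal 0 τ = 0
  bound : ∀ k ≤ m, ∀ σ l : ℤ, 0 ≤ l → l ≤ G → s.arr arrReach k ((G + 1) * σ + l) = 1 → |σ| ≤ S k

/-- For a budget in `0, …, G` the index `(G + 1) * σ + l` is a mixed-radix number, so a symmetric
bound on `σ` becomes one interval of indices. -/
theorem abs_le_iff_index {G S : ℕ} {σ l : ℤ} (hl : 0 ≤ l) (hlG : l ≤ G) :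
    |σ| ≤ S ↔ -((G + 1) * S : ℤ) ≤ (G + 1) * σ + l ∧
      (G + 1) * σ + l < -((G + 1) * S : ℤ) + ((G + 1) * (2 * S + 1) : ℕ) := by
  push_cast
  rw [abs_le]
  constructor
  · rintro ⟨h1, h2⟩
    constructor <;> nlinarith
  · rintro ⟨h1, h2⟩
    constructor
    · by_contra! h
      have : σ + 1 ≤ -(S : ℤ) := by omega
      nlinarith
    · by_contra! h
      have : (S : ℤ) + 1 ≤ σ := by omega
      nlinarith

/-- The tables are not cleared between runs. Each run overwrites the whole window of every layer `1,
…, m` and never marks a cell outside it, so `DPReady` is both assumed and reestablished. -/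
theorem run_dynProg {s : State} {m G : ℕ} {S : ℕ → ℕ} {w : ℕ → ℤ} (hs : DPReady m G S w s)
    (hal : ∀ k < m, ∀ h, |h| ≤ (G : ℤ) → s.arr arrAllow k h = 0 ∨ s.arr arrAllow k h = 1)
    {N : ℕ} (hN : ∀ k < m, (G + 1) * (2 * S (k + 1) + 1) ≤ N) :
    Run E dynProg s ((m + 1) * ((N + 1) * ((2 * G + 2) * 120 + 120) + 11)) fun s' =>
      DPReady m G S w s' ∧ IsTable m G (fun k => S k) w (fun k => s.arr arrAllow k)
        (fun k => s.arr arrCost k) (fun k => s'.arr arrReach k) (fun k => s'.arr arrVal k)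
        (fun k => s'.arr arrArg k) := by
  refine (Run.forUp (N := m) (T := (N + 1) * ((2 * G + 2) * 120 + 120)) (fun K s' =>
    (∀ k τ, s'.arr arrReach k τ = 0 ∨ s'.arr arrReach k τ = 1) ∧
    (∀ τ, s'.arr arrReach 0 τ = 1 ↔ 0 ≤ τ ∧ τ ≤ G) ∧
    (∀ τ, s'.arr arrVal 0 τ = 0) ∧
    (∀ k ≤ m, ∀ σ l : ℤ, 0 ≤ l → l ≤ G → s'.arr arrReach k ((G + 1) * σ + l) = 1 → |σ| ≤ S k) ∧
    ∀ k < K, ∀ σ l : ℤ, 0 ≤ l → l ≤ G → |σ| ≤ S (k + 1) →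
      CellSpec (s.arr arrAllow) (s.arr arrCost) (s'.arr arrReach) (s'.arr arrVal)
        (s.arr arrShift) k ((G + 1) * σ + l) l (l + 1) (s'.arr arrReach (k + 1) ((G + 1) * σ + l))
        (s'.arr arrVal (k + 1) ((G + 1) * σ + l)) (s'.arr arrArg (k + 1) ((G + 1) * σ + l)))
    (by decide) ?_ ?_ ?_).mono (by simp) ?_
  · intro s' ha
    have := ha.var regM (by decide)
    simp [this, hs.regM_eq]
  · exact ⟨hs.bit, hs.base, hs.base_val, hs.bound, fun k hk => absurd hk (Nat.not_lt_zero k)⟩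
  · intro K hK s' ha hkv hP
    obtain ⟨p1, p2, p3, p4, p5⟩ := hP
    have hG' := ha.var regG (by decide)
    have e1 := ha.arr arrAllow (by decide)
    have e2 := ha.arr arrCost (by decide)
    have e3 := ha.arr arrShift (by decide)
    have e4 := ha.arr arrLow (by decide)
    have e5 := ha.arr arrCount (by decide)
    refine (run_fillLayer (G := G) (k := K) (low := -((G + 1) * S (K + 1)))
      (N := (G + 1) * (2 * S (K + 1) + 1)) (by rw [hG', hs.regG_eq]) hkv
      (by rw [e4, hs.low K hK]) (by rw [e5, hs.count K hK]) (by rw [e1]; exact hal K hK) p1).mono ?_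
      fun s'' ha' h => ?_
    · have := hN K hK
      gcongr
    · obtain ⟨q1, q2, q3⟩ := h
      rw [e1, e2, e3] at q3
      simp only [State.setVar_arr]
      have hcell : ∀ σ l : ℤ, 0 ≤ l → l ≤ G → |σ| ≤ S (K + 1) →
          CellSpec (s.arr arrAllow) (s.arr arrCost) (s'.arr arrReach) (s'.arr arrVal)
          (s.arr arrShift) K ((G + 1) * σ + l) l (l + 1)
          (s''.arr arrReach (K + 1) ((G + 1) * σ + l))
          (s''.arr arrVal (K + 1) ((G + 1) * σ + l)) (s''.arr arrArg (K + 1) ((G + 1) * σ + l)) := by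
        intro σ l hl hlG hσ
        obtain ⟨i1, i2⟩ := (abs_le_iff_index hl hlG).1 hσ
        have hσ' := abs_le.1 hσ
        obtain ⟨a, ha⟩ := Int.eq_ofNat_of_zero_le (show 0 ≤ σ + S (K + 1) by omega)
        obtain ⟨b, hb⟩ := Int.eq_ofNat_of_zero_le hl
        -- Relative to the start of the window the state has offset `(G + 1) * (σ + S) + l`, whose
        -- remainder modulo `G + 1` is its budget.
        have hτ : (G + 1) * σ + l = -((G + 1) * S (K + 1) : ℤ) + ((G + 1) * a + b : ℕ) := by
          rw [hb, show σ = a - S (K + 1) by omega]; push_cast; ring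
        have hq := q3 ((G + 1) * a + b) (by
          rw [hτ] at i2; push_cast at i2; zify; linarith)
        rw [Nat.mul_add_mod, Nat.mod_eq_of_lt (by omega), ← hτ] at hq
        rw [hb] at hq ⊢
        exact hq
      refine ⟨fun k τ => ?_, fun τ => ?_, fun τ => ?_, fun k hk σ l hl hlG => ?_,
        fun k hk σ l hl hlG hσ => ?_⟩
      · by_cases hkK : k = K + 1
        · subst hkK
          by_cases hτ : τ < -((G + 1) * S (K + 1) : ℤ) ∨
              -((G + 1) * S (K + 1) : ℤ) + ((G + 1) * (2 * S (K + 1) + 1) : ℕ) ≤ τ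
          · rw [q2 τ hτ]; exact p1 _ _
          · push Not at hτ
            obtain ⟨q, hq⟩ := Int.eq_ofNat_of_zero_le
              (show 0 ≤ τ - -((G + 1) * S (K + 1) : ℤ) by linarith)
            have := (q3 q (by omega)).1
            rwa [show -((G + 1) * S (K + 1) : ℤ) + q = τ by omega] at this
        · rw [(q1 k τ hkK).1]; exact p1 _ _
      · rw [(q1 0 τ (by omega)).1]; exact p2 τ
      · rw [(q1 0 τ (by omega)).2.1]; exact p3 τ
      -- A marked cell of the new layer outside its window would have been marked before, which the
      -- previous invariant excludes.
      · by_cases hkK : k = K + 1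
        · subst hkK
          intro hr
          by_contra hσ
          rw [abs_le_iff_index hl hlG] at hσ
          push_cast at hr
          rw [q2 _ (by omega)] at hr
          have := p4 (K + 1) hk σ l hl hlG (by push_cast; exact hr)
          rw [abs_le_iff_index hl hlG] at this
          exact hσ this
        · rw [(q1 k _ (by omega)).1]; exact p4 k hk σ l hl hlG
      · rcases Nat.lt_succ_iff_lt_or_eq.1 hk with h | rfl
        · have := p5 k h σ l hl hlG hσ
          rw [(q1 (k + 1) _ (by omega)).1, (q1 (k + 1) _ (by omega)).2.1,
            (q1 (k + 1) _ (by omega)).2.2]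
          exact this.congr (fun τ => (q1 k τ (by omega)).1) fun τ => (q1 k τ (by omega)).2.1
        · exact (hcell σ l hl hlG hσ).congr (fun τ => (q1 k τ (by omega)).1)
            fun τ => (q1 k τ (by omega)).2.1
  · rintro s' ha ⟨p1, p2, p3, p4, p5⟩
    refine ⟨⟨?_, ?_, ?_, ?_, ?_, p1, p2, p3, p4⟩, ?_, p3, p4, ?_, ?_⟩
    · rw [ha.var regM (by decide), hs.regM_eq]
    · rw [ha.var regG (by decide), hs.regG_eq]
    · rw [ha.arr arrLow (by decide)]; exact hs.low
    · rw [ha.arr arrCount (by decide)]; exact hs.count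
    · rw [ha.arr arrShift (by decide)]; exact hs.shift
    · intro σ l hl hlG
      simp only [Nat.cast_zero]
      rw [p2]
      constructor
      · rintro ⟨h1, h2⟩
        by_contra hne
        rcases lt_or_gt_of_ne hne with h | h
        · have : σ ≤ -1 := by omega
          nlinarith
        · have : 1 ≤ σ := by omega
          nlinarith
      · rintro rfl
        constructor <;> linarith
    · intro k hk σ l hl hlG hr
      have hσ := p4 (k + 1) hk σ l hl hlG hr
      obtain ⟨c1, c2, c3⟩ := p5 k hk σ l hl hlG hσ
      obtain ⟨d1, d2, d3, d4⟩ := c2 (by push_cast at hr; exact hr)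
      rw [hs.shift k hk _ (by linarith)] at d3 d4
      exact ⟨_, by push_cast; rfl, d1, d2, d3, by push_cast; exact d4⟩
    · intro k hk σ l hl hlG hσ h hh hal' hr
      obtain ⟨c1, c2, c3⟩ := p5 k hk σ l hl hlG hσ
      -- All values were tried: `h ≤ |h| ≤ l` lies below the final cutoff `l + 1`.
      have := c3 h hh (by have := le_abs_self h; omega) hal' (by
        rw [hs.shift k hk _ (by linarith)]; exact hr)
      rw [hs.shift k hk _ (by linarith)] at this
      push_cast
      exact this

/-! ### One augmentation step -/

/-- The dynamic program finds a best kernel step of bounded norm. -/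
theorem IsTable.best_step {r n t m G V Δ : ℕ} {col : ℕ → Fin r → ℤ} {S : ℕ → ℕ} (hΔ : 0 < Δ)
    (hcol : ∀ k p, |col k p| ≤ Δ) (ht : 0 < t) (hm : n * t ≤ m) (hV : V = Δ * G)
    (hG : G = 2 * (4 * Δ * r + 1) ^ r) (hS : ∀ k, (S k : ℤ) = layerBound n t V r k)
    {φ : ℕ → ℤ → ℤ} (hφ : ∀ k, IntConvex (φ k)) {lo up x : ℕ → ℤ}
    (hx : ∀ k < m, lo k ≤ x k ∧ x k ≤ up k) {al c A Val P : ℕ → ℤ → ℤ}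
    (T : IsTable m G (fun k => S k) (weight n t V col) al c A Val P)
    (hal : ∀ k < m, ∀ h, |h| ≤ (G : ℤ) →
      (al k h = 1 ↔ lo k ≤ x k + h ∧ x k + h ≤ up k))
    (hc : ∀ k < m, ∀ h, |h| ≤ (G : ℤ) → al k h = 1 → c k h = φ k (x k + h) - φ k (x k)) :
    A m G = 1 ∧ Val m G ≤ 0 ∧
      (∀ y, y = backtrack (stateShift G (weight n t V col)) P m G →
        InKer m n (fun k => k / t) col y ∧ (∀ k < m, lo k ≤ x k + y k ∧ x k + y k ≤ up k) ∧
        ∑ k ∈ range m, (φ k (x k + y k) - φ k (x k)) = Val m G) ∧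
      ∀ z : ℕ → ℤ, (∀ k < m, lo k ≤ z k ∧ z k ≤ up k) →
        InKer m n (fun k => k / t) col (fun k => z k - x k) →
        (∑ k ∈ range m, |z k - x k|) * Val m G ≤ ∑ k ∈ range m, (φ k (z k) - φ k (x k)) := by
  have hsmall : ∀ y : ℕ → ℤ, InKer m n (fun k => k / t) col y → ∑ k ∈ range m, |y k| ≤ G →
      (∀ k < m, lo k ≤ x k + y k ∧ x k + y k ≤ up k) →
      A m G = 1 ∧ Val m G ≤ ∑ k ∈ range m, (φ k (x k + y k) - φ k (x k)) := by
    intro y hy hyG hbox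
    have hyk : ∀ k < m, |y k| ≤ G := fun k hk =>
      (Finset.single_le_sum (f := fun k => |y k|) (fun _ _ => abs_nonneg _)
        (mem_range.2 hk)).trans hyG
    obtain ⟨h1, h2⟩ := (inKer_iff_layerBound hΔ hcol ht hm hV hyG).1 hy
    have hal' : ∀ j < m, al j (y j) = 1 := fun j hj => (hal j hj _ (hyk j hj)).2 (hbox j hj)
    have := T.value_le y m le_rfl G le_rfl hyG hal' (fun i hi => by rw [hS]; exact h1 i hi)
    rw [h2, mul_zero, zero_add] at this
    refine ⟨this.1, this.2.trans (Finset.sum_le_sum fun k hk => ?_)⟩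
    have hk := mem_range.1 hk
    rw [hc k hk _ (hyk k hk) (hal' k hk)]
  -- The zero step is always admissible. The final state is thus reachable and its value is at most
  -- zero.
  have hzero := hsmall 0 ⟨by simp, by simp⟩ (by simp) (by simpa using hx)
  simp only [Pi.zero_apply, add_zero, sub_self, Finset.sum_const_zero] at hzero
  refine ⟨hzero.1, hzero.2, fun y hy => ?_, fun z hz hzx => ?_⟩
  · obtain ⟨-, b2, b3, b4, b5, b6⟩ := T.backtrack_spec m le_rfl 0 G (by positivity) le_rfl
      (by simpa using hzero.1) y (by simpa using hy)
    have hyk : ∀ k < m, |y k| ≤ G := fun k hk =>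
      (Finset.single_le_sum (f := fun k => |y k|) (fun _ _ => abs_nonneg _)
        (mem_range.2 hk)).trans b2
    refine ⟨(inKer_iff_layerBound hΔ hcol ht hm hV b2).2 ⟨fun k hk => ?_, b6⟩,
      fun k hk => (hal k hk _ (hyk k hk)).1 (b3 k hk), ?_⟩
    · rw [← hS]; exact b5 k hk
    · rw [mul_zero, zero_add] at b4
      rw [b4]
      refine Finset.sum_congr rfl fun k hk => ?_
      have hk := mem_range.1 hk
      rw [hc k hk _ (hyk k hk) (b3 k hk)]
  -- The tabulated value bounds all kernel steps of norm at most `G`; as `G` is the bound for small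
  -- kernel elements, it bounds every kernel step after multiplication by its norm.
  · have := improvement_bound hcol hφ hx hzero.2 (fun g hg hgG hbox =>
      (hsmall g hg (by rw [hG]; exact_mod_cast hgG) hbox).2) _ hzx (fun k hk => by
        have := hz k hk; constructor <;> linarith)
    simpa using this

/-! ### Positions of the variables in memory -/

/-- Row of the variable `k` in the two-dimensional arrays. -/
def rowOf (n t k : ℕ) : ℤ := if k < n * t then (k / t : ℕ) else n

/-- Column of the variable `k` in the two-dimensional arrays. -/
def colOf (n t k : ℕ) : ℤ := if k < n * t then (k % t : ℕ) else (k - n * t : ℕ)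

/-- Distinct variables occupy distinct cells, the slack variables sitting in row `n` below the
bricks. Writing one variable therefore leaves the entries of all others unchanged. -/
theorem position_injective {n t k k' : ℕ} (hr : rowOf n t k = rowOf n t k')
    (hc : colOf n t k = colOf n t k') : k = k' := by
  unfold rowOf colOf at *
  have hdiv : ∀ j, j < n * t → j / t < n := fun j hj => Nat.div_lt_of_lt_mul (by rwa [mul_comm])
  by_cases h : k < n * t <;> by_cases h' : k' < n * t
  · rw [if_pos h, if_pos h'] at hr hc
    have h1 : k / t = k' / t := by exact_mod_cast hr
    have h2 : k % t = k' % t := by exact_mod_cast hc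
    rw [← Nat.div_add_mod k t, ← Nat.div_add_mod k' t, h1, h2]
  · rw [if_pos h, if_neg h'] at hr
    have h1 : k / t = n := by exact_mod_cast hr
    have := hdiv k h; omega
  · rw [if_neg h, if_pos h'] at hr
    have h1 : n = k' / t := by exact_mod_cast hr
    have := hdiv k' h'; omega
  · rw [if_neg h, if_neg h'] at hc
    omega

/-- The value of the variable `k` in a two-dimensional array. -/
def entry (n t : ℕ) (A : ℤ → ℤ → ℤ) (k : ℕ) : ℤ := A (rowOf n t k) (colOf n t k)

/-- The positions of the variables are tabulated. -/
def Indexed (n t m : ℕ) (s : State) : Prop :=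
  ∀ k < m, s.arr arrRow k 0 = rowOf n t k ∧ s.arr arrCol k 0 = colOf n t k

/-- Adds the step found by the dynamic program to the current solution. -/
def applyStep : Cmd :=
  regTau ::= Expr.var regG ;;
  forUp regQ (Expr.var regM) (
    regK ::= Expr.var regM - Expr.const 1 - Expr.var regQ ;;
    regH ::= Expr.get arrArg (Expr.var regK + Expr.const 1) (Expr.var regTau) ;;
    regI ::= Expr.get arrRow (Expr.var regK) (Expr.const 0) ;;
    regJ ::= Expr.get arrCol (Expr.var regK) (Expr.const 0) ;;
    Cmd.store arrX (Expr.var regI) (Expr.var regJ)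
      (Expr.get arrX (Expr.var regI) (Expr.var regJ) + Expr.var regH) ;;
    regTau ::= Expr.var regTau - Expr.get arrShift (Expr.var regK) (Expr.var regH))

/-- The program runs through `backtrack` from the last variable down. After `q` rounds the register
`regTau` holds the state reached in layer `m - q`, and exactly the variables from `m - q` on have
received their change. -/
theorem run_applyStep {n' t' : ℕ} {s : State} {m G : ℕ} {S : ℕ → ℕ} {w : ℕ → ℤ} {al c : ℕ → ℤ → ℤ}
    (hs : DPReady m G S w s) (hidx : Indexed n' t' m s)
    (T : IsTable m G (fun k => S k) w al c (fun k => s.arr arrReach k) (fun k => s.arr arrVal k)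
      (fun k => s.arr arrArg k)) (hr : s.arr arrReach m G = 1) :
    Run E applyStep s ((m + 1) * 70) fun s' => ∀ k < m, entry n' t' (s'.arr arrX) k =
      entry n' t' (s.arr arrX) k + backtrack (stateShift G w) (fun k => s.arr arrArg k) m G k := by
  set P : ℕ → ℤ → ℤ := fun k => s.arr arrArg k with hP
  set y := backtrack (stateShift G w) P m G with hy
  refine Run.le (T₁ := 2 + (m + 1) * (50 + 1 + 10)) ?_ (by omega)
  refine Run.seq (Run.straight ?_)
  simp only [Cmd.wp, Expr.eval_var, hs.regG_eq]
  refine (Run.forUp (N := m) (T := 50) (fun q s' =>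
    (∃ σ l : ℤ, 0 ≤ l ∧ l ≤ G ∧ s'.var regTau = (G + 1) * σ + l ∧
      s.arr arrReach ((m - q : ℕ) : ℤ) ((G + 1) * σ + l) = 1 ∧
      ∀ k < m - q, backtrack (stateShift G w) P (m - q) ((G + 1) * σ + l) k = y k) ∧
    (∀ k < m, entry n' t' (s'.arr arrX) k =
      entry n' t' (s.arr arrX) k + if m - q ≤ k then y k else 0)) (by decide) ?_ ?_ ?_).mono le_rfl ?_
  · intro s' ha
    have := ha.var regM (by decide)
    simp at this
    simp [this, hs.regM_eq]
  · refine ⟨⟨0, G, by positivity, le_rfl, by simp, by simpa using hr, by simp [hy]⟩, fun k hk => ?_⟩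
    rw [if_neg (by omega)]; simp
  · intro q hq s' ha hqv hinv
    obtain ⟨⟨σ, l, hl, hlG, hτ, hA, hb⟩, hX⟩ := hinv
    obtain ⟨K, hK⟩ : ∃ K, m = K + 1 + q := ⟨m - 1 - q, by omega⟩
    have e1 : m - q = K + 1 := by omega
    have e2 : m - (q + 1) = K := by omega
    rw [e1] at hA hb hX
    obtain ⟨h, h1, h2, h3, h4, h5⟩ := T.sound K (by omega) σ l hl hlG (by exact_mod_cast hA)
    have hb1 : backtrack (stateShift G w) P (K + 1) ((G + 1) * σ + l) = Function.update
        (backtrack (stateShift G w) P K ((G + 1) * σ + l - stateShift G w K h)) K h := by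
      simp only [backtrack]
      rw [show P (K + 1) ((G + 1) * σ + l) = h from h1]
    have hyK : y K = h := by
      rw [← hb K (by omega), hb1]; simp
    have hM := ha.var regM (by decide)
    have g1 := ha.arr arrArg (by decide)
    have g2 := ha.arr arrRow (by decide)
    have g3 := ha.arr arrCol (by decide)
    have g4 := ha.arr arrShift (by decide)
    simp at hM g1 g2 g3 g4
    have hPh : s.arr arrArg ((K : ℤ) + 1) ((G + 1) * σ + l) = h := h1
    have hmK : s.var regM - 1 - (q : ℤ) = K := by rw [hs.regM_eq, hK]; push_cast; ring
    have hi := hidx K (by omega)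
    refine (Run.straight ?_).le (by decide)
    simp only [Cmd.wp, Expr.eval_sub, Expr.eval_var, Expr.eval_get, Expr.eval_add, State.setVar_var,
      State.setVar_arr, Expr.eval_const, State.setArr_var, hM, hqv, g1, g2, g3, g4,
      State.setArr_arr]
    norm_num only [if_true, if_false]
    simp only [hmK, hτ, hPh, hi.1, hi.2, hs.shift K (by omega) h (by linarith)]
    refine ⟨⟨σ - w K * h, l - |h|, by linarith, by have := abs_nonneg h; linarith,
      stateShift_sub G w K h σ l, ?_, fun k hk => ?_⟩, fun k hk => ?_⟩
    · rw [e2, ← stateShift_sub]; exact h4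
    · rw [e2] at hk ⊢
      rw [← hb k (by omega), hb1, Function.update_of_ne (by omega), stateShift_sub]
    · simp only [entry, State.setArr_arr, State.setVar_arr, true_and]
      rw [e2]
      by_cases hkK : k = K
      · subst hkK
        have := hX k hk
        rw [if_neg (by omega), add_zero, entry, entry] at this
        rw [if_pos ⟨rfl, rfl⟩, if_pos le_rfl, hyK, this]
      -- The store at the position of `K` does not hit any other variable.
      · rw [if_neg fun hh => hkK (position_injective hh.1 hh.2)]
        have := hX k hk
        rw [entry, entry] at this
        rw [this]
        by_cases hle : K ≤ k
        · rw [if_pos hle, if_pos (by omega)]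
        · rw [if_neg hle, if_neg (by omega)]
  · rintro s' - ⟨-, hX⟩ k hk
    rw [hX k hk, if_pos (by omega)]

/-! ### The augmentation loop -/

/-- Repeats best steps until there is no improvement; `fill` tabulates the costs. -/
def augLoop (fill : Cmd) : Cmd :=
  regGo ::= Expr.const 1 ;;
  Cmd.loop (Expr.var regGo) (fill ;; dynProg ;;
    Cmd.ite (Expr.const 0 - Expr.get arrVal (Expr.var regM) (Expr.var regG)) applyStep
      (regGo ::= Expr.const 0))

/-- Memory that is not changed during the augmentation. -/
structure Keep (s s' : State) : Prop where
  var : ∀ v ≤ 13, s'.var v = s.var v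
  arr : ∀ a ≤ 13, a ≠ arrX → s'.arr a = s.arr a

theorem Keep.refl (s : State) : Keep s s := ⟨fun _ _ => rfl, fun _ _ _ => rfl⟩

theorem Keep.trans {s₁ s₂ s₃ : State} (h₁ : Keep s₁ s₂) (h₂ : Keep s₂ s₃) : Keep s₁ s₃ :=
  ⟨fun v hv => (h₂.var v hv).trans (h₁.var v hv),
    fun a ha hX => (h₂.arr a ha hX).trans (h₁.arr a ha hX)⟩

theorem Agree.keep {c : Cmd} {s s' : State} (h : Agree c s s') (hv : ∀ v ≤ 13, v ∉ c.vars)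
    (ha : ∀ a ≤ 13, a ≠ arrX → a ∉ c.arrs) : Keep s s' :=
  ⟨fun v hv' => h.var v (hv v hv'), fun a ha' hX => h.arr a (ha a ha' hX)⟩

theorem Keep.indexed {m : ℕ} {s s' : State} (h : Keep s s') (hi : Indexed n t m s) :
    Indexed n t m s' := by
  intro k hk
  rw [h.arr arrRow (by decide) (by decide), h.arr arrCol (by decide) (by decide)]
  exact hi k hk

theorem Keep.dpReady {m G : ℕ} {S : ℕ → ℕ} {w : ℕ → ℤ} {s s' : State} (h : Keep s s')
    (hr : s'.arr arrReach = s.arr arrReach) (hv : s'.arr arrVal = s.arr arrVal)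
    (hs : DPReady m G S w s) : DPReady m G S w s' := by
  obtain ⟨h1, h2, h3, h4, h5, h6, h7, h8, h9⟩ := hs
  have e1 := h.var regM (by decide)
  have e2 := h.var regG (by decide)
  have e3 := h.arr arrLow (by decide) (by decide)
  have e4 := h.arr arrCount (by decide) (by decide)
  have e5 := h.arr arrShift (by decide) (by decide)
  refine ⟨?_, ?_, ?_, ?_, ?_, ?_, ?_, ?_, ?_⟩
  · rw [e1, h1]
  · rw [e2, h2]
  · rw [e3]; exact h3
  · rw [e4]; exact h4
  · rw [e5]; exact h5
  · rw [hr]; exact h6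
  · rw [hr]; exact h7
  · rw [hv]; exact h8
  · rw [hr]; exact h9

/-- The program `fill` tabulates the admissible changes of the variables and their costs. -/
def FillSpec (E : Env n t) (fill : Cmd) (m G : ℕ) (φ : ℕ → ℤ → ℤ) (lo up : ℕ → ℤ) (s₀ : State)
    (T : ℕ) : Prop :=
  ∀ s, Keep s₀ s → Run E fill s T fun s' =>
    (∀ k < m, ∀ h, |h| ≤ (G : ℤ) → s'.arr arrAllow k h =
      if lo k ≤ entry n t (s.arr arrX) k + h ∧ entry n t (s.arr arrX) k + h ≤ up k then 1 else 0) ∧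
    (∀ k < m, ∀ h, |h| ≤ (G : ℤ) → s'.arr arrCost k h =
      φ k (entry n t (s.arr arrX) k + h) - φ k (entry n t (s.arr arrX) k)) ∧
    (∀ k < m, entry n t (s'.arr arrX) k = entry n t (s.arr arrX) k) ∧
    Keep s s' ∧ s'.arr arrReach = s.arr arrReach ∧ s'.arr arrVal = s.arr arrVal ∧
    s'.var regGo = s.var regGo

/-- For a fixed optimum `z` each round multiplies the gap by at most `1 - 1/N`, so the fuel `N * e`
bounds the number of improving rounds. The loop stops when the best small step gains nothing, and
then the gap is zero. The separable function is arbitrary, so that both phases use this statement.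
-/
theorem run_augLoop {r m G V Δ : ℕ} {col : ℕ → Fin r → ℤ} {S : ℕ → ℕ} (hΔ : 0 < Δ)
    (hcol : ∀ k p, |col k p| ≤ Δ) (ht : 0 < t) (hm : n * t ≤ m) (hV : V = Δ * G)
    (hG : G = 2 * (4 * Δ * r + 1) ^ r) (hS : ∀ k, (S k : ℤ) = layerBound n t V r k)
    {φ : ℕ → ℤ → ℤ} (hφ : ∀ k, IntConvex (φ k)) {lo up : ℕ → ℤ} {s₀ : State} {fill : Cmd} {Tf : ℕ}
    (hfill : FillSpec E fill m G φ lo up s₀ Tf)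
    (hs₀ : DPReady m G S (weight n t V col) s₀) (hidx : Indexed n t m s₀) {x₀ : ℕ → ℤ}
    (hx₀ : ∀ k < m, entry n t (s₀.arr arrX) k = x₀ k)
    (hbox : ∀ k < m, lo k ≤ x₀ k ∧ x₀ k ≤ up k) {N e Nst : ℕ} (hN : 0 < N)
    (hNsum : ∑ k ∈ range m, (up k - lo k) ≤ N)
    (hgap : ∀ y : ℕ → ℤ, (∀ k < m, lo k ≤ y k ∧ y k ≤ up k) →
      InKer m n (fun k => k / t) col (fun k => y k - x₀ k) →
      ∑ k ∈ range m, φ k (x₀ k) - ∑ k ∈ range m, φ k (y k) < 2 ^ e)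
    (hNst : ∀ k < m, (G + 1) * (2 * S (k + 1) + 1) ≤ Nst) :
    Run E (augLoop fill) s₀ ((N * e + 1) *
      (Tf + (m + 1) * ((Nst + 1) * ((2 * G + 2) * 120 + 120) + 81) + 20) + 10) fun s' =>
      Keep s₀ s' ∧ DPReady m G S (weight n t V col) s' ∧
      (∀ k < m, lo k ≤ entry n t (s'.arr arrX) k ∧ entry n t (s'.arr arrX) k ≤ up k) ∧
      InKer m n (fun k => k / t) col (fun k => entry n t (s'.arr arrX) k - x₀ k) ∧
      ∀ y : ℕ → ℤ, (∀ k < m, lo k ≤ y k ∧ y k ≤ up k) →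
        InKer m n (fun k => k / t) col (fun k => y k - x₀ k) →
        ∑ k ∈ range m, φ k (entry n t (s'.arr arrX) k) ≤ ∑ k ∈ range m, φ k (y k) := by
  classical
  set Tit := Tf + (m + 1) * ((Nst + 1) * ((2 * G + 2) * 120 + 120) + 81) + 20 with hTit
  -- an optimal solution
  obtain ⟨z, ⟨hzbox, hzker⟩, hzmin⟩ := WellFounded.has_min
    (measure fun y : ℕ → ℤ => (∑ k ∈ range m, φ k (y k) - ∑ k ∈ range m, φ k (x₀ k) + 2 ^ e).toNat).wf
    {y | (∀ k < m, lo k ≤ y k ∧ y k ≤ up k) ∧ InKer m n (fun k => k / t) col fun k => y k - x₀ k}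
    ⟨x₀, hbox, by simp [InKer]⟩
  have hzopt : ∀ y : ℕ → ℤ, (∀ k < m, lo k ≤ y k ∧ y k ≤ up k) →
      InKer m n (fun k => k / t) col (fun k => y k - x₀ k) →
      ∑ k ∈ range m, φ k (z k) ≤ ∑ k ∈ range m, φ k (y k) := by
    intro y h1 h2
    have h3 := hzmin y ⟨h1, h2⟩
    change ¬ Int.toNat _ < Int.toNat _ at h3
    -- The bound on the gap makes the arguments of `toNat` positive, so truncation does not distort
    -- the comparison.
    have h4 := hgap y h1 h2
    have h5 := hgap z hzbox hzker
    omega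
  have hkeepdp : ∀ {s s' : State}, Agree dynProg s s' → Keep s s' := fun h =>
    h.keep (by decide) (by decide)
  have key : ∀ fuel, ∀ s, Keep s₀ s → DPReady m G S (weight n t V col) s → s.var regGo = 1 →
      (∀ k < m, lo k ≤ entry n t (s.arr arrX) k ∧ entry n t (s.arr arrX) k ≤ up k) →
      InKer m n (fun k => k / t) col (fun k => entry n t (s.arr arrX) k - x₀ k) →
      Fuel N fuel (∑ k ∈ range m, φ k (entry n t (s.arr arrX) k) -
        ∑ k ∈ range m, φ k (z k)).toNat →
      Run E (Cmd.loop (Expr.var regGo) (fill ;; dynProg ;;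
        Cmd.ite (Expr.const 0 - Expr.get arrVal (Expr.var regM) (Expr.var regG)) applyStep
          (regGo ::= Expr.const 0))) s ((fuel + 1) * Tit + 2) fun s' =>
        Keep s₀ s' ∧ DPReady m G S (weight n t V col) s' ∧
        (∀ k < m, lo k ≤ entry n t (s'.arr arrX) k ∧ entry n t (s'.arr arrX) k ≤ up k) ∧
        InKer m n (fun k => k / t) col (fun k => entry n t (s'.arr arrX) k - x₀ k) ∧
        ∑ k ∈ range m, φ k (entry n t (s'.arr arrX) k) ≤ ∑ k ∈ range m, φ k (z k) := by
    intro fuel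
    induction fuel using Nat.strong_induction_on with
    | _ fuel ih =>
      intro s hkeep hs hgo hsbox hsker hfuel
      set x := entry n t (s.arr arrX) with hx
      set gap := ∑ k ∈ range m, φ k (x k) - ∑ k ∈ range m, φ k (z k) with hgapdef
      have hgap0 : 0 ≤ gap := by
        have := hzopt x hsbox hsker
        omega
      -- the body
      have hbody : Run E (fill ;; dynProg ;;
          Cmd.ite (Expr.const 0 - Expr.get arrVal (Expr.var regM) (Expr.var regG)) applyStep
          (regGo ::= Expr.const 0)) s
          (Tf + ((m + 1) * ((Nst + 1) * ((2 * G + 2) * 120 + 120) + 11) +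
            ((1 + 3 + 1) + 1 + ((m + 1) * 70 + 2)))) fun s' =>
          Keep s₀ s' ∧ DPReady m G S (weight n t V col) s' ∧
          (∀ k < m, lo k ≤ entry n t (s'.arr arrX) k ∧ entry n t (s'.arr arrX) k ≤ up k) ∧
          InKer m n (fun k => k / t) col (fun k => entry n t (s'.arr arrX) k - x₀ k) ∧
          ((s'.var regGo = 0 ∧ ∑ k ∈ range m, φ k (entry n t (s'.arr arrX) k) ≤
              ∑ k ∈ range m, φ k (z k)) ∨
            (s'.var regGo = 1 ∧ 0 < gap ∧ N * (∑ k ∈ range m, φ k (entry n t (s'.arr arrX) k) -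
              ∑ k ∈ range m, φ k (z k)) + gap ≤ N * gap)) := by
        refine Run.bind (Q' := fun s' => (∀ k < m, ∀ h, |h| ≤ (G : ℤ) → s'.arr arrAllow k h =
            if lo k ≤ x k + h ∧ x k + h ≤ up k then 1 else 0) ∧
          (∀ k < m, ∀ h, |h| ≤ (G : ℤ) → s'.arr arrCost k h = φ k (x k + h) - φ k (x k)) ∧
          (∀ k < m, entry n t (s'.arr arrX) k = x k) ∧ Keep s s' ∧
          s'.arr arrReach = s.arr arrReach ∧ s'.arr arrVal = s.arr arrVal ∧
          s'.var regGo = 1) ?_ ?_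
        · refine (hfill s hkeep).mono le_rfl fun s' _ h => ?_
          obtain ⟨h1, h2, h3, h4, h5, h6, h7⟩ := h
          exact ⟨h1, h2, h3, h4, h5, h6, h7.trans hgo⟩
        rintro s₁ - ⟨hal, hcost, hx1, hk1, hr1, hv1, hgo1⟩
        have hs1 := hk1.dpReady hr1 hv1 hs
        refine Run.bind (run_dynProg hs1 (fun k hk h hh => by rw [hal k hk h hh]; split_ifs <;> simp)
          hNst) ?_
        rintro s₂ ha2 ⟨hs2, hT⟩
        have hk2 := hkeepdp ha2
        have hX2 := ha2.arr arrX (by decide)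
        have hgo2 : s₂.var regGo = 1 := by rw [ha2.var regGo (by decide), hgo1]
        obtain ⟨b1, b2, b3, b4⟩ := IsTable.best_step hΔ hcol ht hm hV hG hS hφ hsbox hT
          (fun k hk h hh => by rw [hal k hk h hh]; split_ifs with h' <;> simp [h'])
          (fun k hk h hh _ => hcost k hk h hh)
        obtain ⟨c1, c2, c3⟩ := b3 _ rfl
        have b5 := b4 z hzbox ((hzker.sub hsker).congr fun k _ => by ring)
        rw [Finset.sum_sub_distrib] at b5
        -- Both vectors lie in the box, whose total width is at most `N`.
        have hdist : ∑ k ∈ range m, |z k - x k| ≤ N := by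
          refine (Finset.sum_le_sum fun k hk => ?_).trans hNsum
          have h1 := hzbox k (mem_range.1 hk)
          have h2 := hsbox k (mem_range.1 hk)
          rw [abs_le]; constructor <;> linarith
        -- The step `z - x` gains the gap, and at most `‖z - x‖₁ ≤ N` times the best small gain.
        have hval : gap ≤ N * -(s₂.arr arrVal m G) := by nlinarith
        refine Run.ite (fun hpos => ?_) fun hpos => ?_
        · simp only [Expr.eval_sub, Expr.eval_const, Expr.eval_get, Expr.eval_var, hs2.regM_eq,
            hs2.regG_eq] at hpos
          refine (run_applyStep hs2 (hk2.indexed (hk1.indexed (hkeep.indexed hidx))) hT b1).mono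
            le_rfl fun s₃ ha3 h3 => ?_
          have hk3 : Keep s₂ s₃ := ha3.keep (by decide) (by decide)
          have hx3 : ∀ k < m, entry n t (s₃.arr arrX) k = x k + backtrack
              (stateShift G (weight n t V col)) (fun k => s₂.arr arrArg k) m G k := by
            intro k hk
            rw [h3 k hk, hX2, hx1 k hk]
          refine ⟨((hkeep.trans hk1).trans hk2).trans hk3,
            hk3.dpReady (ha3.arr _ (by decide)) (ha3.arr _ (by decide)) hs2, fun k hk => ?_, ?_,
            Or.inr ⟨?_, ?_, ?_⟩⟩
          · rw [hx3 k hk]; exact c2 k hk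
          · exact (hsker.add c1).congr fun k hk => by rw [hx3 k hk]; ring
          · rw [ha3.var regGo (by decide), hgo2]
          -- An improving step out of an optimal point would contradict the optimality of `z`, so
          -- the gap was positive, as `Fuel.step` requires.
          · by_contra hg
            have hg0 : gap = 0 := by omega
            have h6 := hzopt (fun k => x k + backtrack
              (stateShift G (weight n t V col)) (fun k => s₂.arr arrArg k) m G k) c2
              ((hsker.add c1).congr fun k _ => by ring)
            rw [Finset.sum_sub_distrib] at c3
            linarith
          · have h7 : ∑ k ∈ range m, φ k (entry n t (s₃.arr arrX) k) =
                ∑ k ∈ range m, φ k (x k) + s₂.arr arrVal m G := by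
              rw [← c3, Finset.sum_sub_distrib]
              rw [Finset.sum_congr rfl fun k hk => by rw [hx3 k (mem_range.1 hk)]]
              ring
            rw [h7]
            linarith
        · simp only [Expr.eval_sub, Expr.eval_const, Expr.eval_get, Expr.eval_var, hs2.regM_eq,
            hs2.regG_eq] at hpos
          have hv0 : s₂.arr arrVal m G = 0 := by omega
          rw [hv0] at hval
          refine Run.straight ?_
          simp only [Cmd.wp, State.setVar_arr, hX2]
          have hxx : ∀ k < m, entry n t (s₁.arr arrX) k = x k := hx1
          refine ⟨⟨fun v hv => ?_, fun a ha hX => ?_⟩,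
            ⟨hs2.1, hs2.2, hs2.3, hs2.4, hs2.5, hs2.6, hs2.7, hs2.8, hs2.9⟩, fun k hk => ?_, ?_,
            Or.inl ⟨by simp, ?_⟩⟩
          · have : v ≠ regGo := by omega
            simp only [State.setVar_var, this, if_false]
            exact ((hkeep.trans hk1).trans hk2).var v hv
          · exact ((hkeep.trans hk1).trans hk2).arr a ha hX
          · rw [hxx k hk]; exact hsbox k hk
          · exact hsker.congr fun k hk => by rw [hxx k hk]
          · rw [Finset.sum_congr rfl fun k hk => by rw [hxx k (mem_range.1 hk)]]
            linarith
      obtain ⟨T₁, s₁, hex, hT₁, k1, k2, k3, k4, k5⟩ := hbody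
      have hcond : 0 < (Expr.var regGo).eval s := by simp [hgo]
      rcases k5 with ⟨hgo0, hopt⟩ | ⟨hgo1, hpos, hdec⟩
      · refine ⟨_, s₁, Exec.loopTrue hcond hex (Exec.loopFalse (by simp [hgo0])), ?_, k1, k2, k3, k4,
          hopt⟩
        have : Tit ≤ (fuel + 1) * Tit := Nat.le_mul_of_pos_left _ (by omega)
        simp only [Expr.cost_var]
        have : (m + 1) * ((Nst + 1) * ((2 * G + 2) * 120 + 120) + 81) =
          (m + 1) * ((Nst + 1) * ((2 * G + 2) * 120 + 120) + 11) + (m + 1) * 70 := by ring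
        omega
      · have hgap' : 0 ≤ ∑ k ∈ range m, φ k (entry n t (s₁.arr arrX) k) -
            ∑ k ∈ range m, φ k (z k) := by
          have := hzopt _ k3 k4
          omega
        obtain ⟨fuel', hlt, hf'⟩ := hfuel.step hN (g' := (∑ k ∈ range m,
          φ k (entry n t (s₁.arr arrX) k) - ∑ k ∈ range m, φ k (z k)).toNat) (by omega) (by
            zify
            rw [Int.toNat_of_nonneg hgap', Int.toNat_of_nonneg hgap0]
            exact hdec)
        obtain ⟨T₂, s₂, hex2, hT₂, hpost⟩ := ih fuel' hlt s₁ k1 k2 hgo1 k3 k4 hf'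
        refine ⟨_, s₂, Exec.loopTrue hcond hex hex2, ?_, hpost⟩
        simp only [Expr.cost_var]
        have : (fuel' + 1) * Tit + Tit ≤ (fuel + 1) * Tit := by
          calc (fuel' + 1) * Tit + Tit = (fuel' + 1 + 1) * Tit := by ring
            _ ≤ (fuel + 1) * Tit := Nat.mul_le_mul_right _ (by omega)
        have : (m + 1) * ((Nst + 1) * ((2 * G + 2) * 120 + 120) + 81) =
          (m + 1) * ((Nst + 1) * ((2 * G + 2) * 120 + 120) + 11) + (m + 1) * 70 := by ring
        omega
  have hkeep1 : Keep s₀ (s₀.setVar regGo 1) := ⟨fun v hv => by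
    have : v ≠ regGo := by omega
    simp [this], fun _ _ _ => rfl⟩
  have hsum0 : ∑ k ∈ range m, φ k (entry n t (s₀.arr arrX) k) = ∑ k ∈ range m, φ k (x₀ k) :=
    Finset.sum_congr rfl fun k hk => by rw [hx₀ k (mem_range.1 hk)]
  refine Run.le (T₁ := 2 + ((N * e + 1) * Tit + 2)) ?_ (by omega)
  refine Run.seq (Run.straight ?_)
  simp only [Cmd.wp, Expr.eval_const]
  refine (key (N * e) (s₀.setVar regGo 1) hkeep1 (hkeep1.dpReady rfl rfl hs₀) (by simp)
    (fun k hk => ?_) ?_ ?_).mono le_rfl ?_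
  · simp only [State.setVar_arr]; rw [hx₀ k hk]; exact hbox k hk
  · have h0 : InKer m n (fun k => k / t) col fun _ => 0 := ⟨by simp, by simp⟩
    exact h0.congr fun k hk => by simp only [State.setVar_arr]; rw [hx₀ k hk, sub_self]
  · refine Fuel.of_lt hN ?_
    have := hgap z hzbox hzker
    simp only [State.setVar_arr]
    rw [hsum0, Int.toNat_lt' (by positivity)]
    exact_mod_cast this
  · rintro s' - ⟨h1, h2, h3, h4, h5⟩
    exact ⟨h1, h2, h3, h4, fun y hy1 hy2 => h5.trans (hzopt y hy1 hy2)⟩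

/-! ### Separable functions of the stored vector -/

section Flat

variable {n t : ℕ}

/-- A family of functions indexed by brick and position, extended by zero to all variables. -/
def flatten (ψ : Fin n × Fin t → ℤ → ℤ) (k : ℕ) : ℤ → ℤ :=
  if h : k < n * t then ψ (finProdFinEquiv.symm ⟨k, h⟩) else fun _ => 0

theorem flatten_convex {ψ : Fin n × Fin t → ℤ → ℤ} (h : ∀ p, IntConvex (ψ p)) (k : ℕ) :
    IntConvex (flatten ψ k) := by
  unfold flatten
  split_ifs
  · exact h _
  · exact intConvex_zero

theorem sum_brick_position {R : Type*} [AddCommMonoid R] (g : Fin n × Fin t → R) :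
    ∑ p, g p = ∑ k : Fin (n * t), g (finProdFinEquiv.symm k) :=
  (Equiv.sum_comp finProdFinEquiv.symm g).symm

theorem readVec_symm (A : ℤ → ℤ → ℤ) (k : Fin (n * t)) :
    readVec n t A (finProdFinEquiv.symm k) = entry n t A k := by
  simp [readVec, entry, rowOf, colOf, finProdFinEquiv, Fin.divNat, Fin.modNat]

theorem sum_flatten {m : ℕ} (hm : n * t ≤ m) (ψ : Fin n × Fin t → ℤ → ℤ) (x : ℕ → ℤ) :
    ∑ k ∈ range m, flatten ψ k (x k) =
      ∑ k : Fin (n * t), ψ (finProdFinEquiv.symm k) (x k) := by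
  rw [← Finset.sum_subset (Finset.range_mono hm), Finset.sum_range]
  · exact Finset.sum_congr rfl fun k _ => by simp [flatten]
  · intro k _ hk
    rw [mem_range] at hk
    simp [flatten, hk]

theorem sum_readVec {m : ℕ} (hm : n * t ≤ m) (ψ : Fin n × Fin t → ℤ → ℤ) (A : ℤ → ℤ → ℤ) :
    ∑ p, ψ p (readVec n t A p) = ∑ k ∈ range m, flatten ψ k (entry n t A k) := by
  rw [sum_flatten hm, sum_brick_position]
  exact Finset.sum_congr rfl fun k _ => by rw [readVec_symm]

/-- By separability, changing one stored entry changes the objective by the difference of a single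
summand. This recovers univariate costs from an oracle that only evaluates the whole sum. For a
slack position both sides are zero. -/
theorem sum_readVec_update {m : ℕ} (hm : n * t ≤ m) (ψ : Fin n × Fin t → ℤ → ℤ) (A A' : ℤ → ℤ → ℤ)
    {k : ℕ} (hk : k < m) (y : ℤ)
    (hA : ∀ i j, A' i j = if i = rowOf n t k ∧ j = colOf n t k then y else A i j) :
    ∑ p, ψ p (readVec n t A' p) - ∑ p, ψ p (readVec n t A p) =
      flatten ψ k y - flatten ψ k (entry n t A k) := by
  rw [sum_readVec hm, sum_readVec hm, ← Finset.sum_sub_distrib,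
    Finset.sum_eq_single_of_mem k (mem_range.2 hk)]
  · simp [entry, hA]
  · intro j _ hj
    rw [sub_eq_zero, entry, hA, if_neg fun h => hj (position_injective h.1 h.2), entry]

end Flat

/-! ### Tabulating the costs -/

/-- Stores in `arrCost` the cost of changing the variable `regK` from `regX` to `regY`. -/
def costCmd : Cmd :=
  Cmd.ite (Expr.var regPhase)
    (Cmd.ite (Expr.var regK - Expr.var regNT + Expr.const 1)
      (Cmd.ite (Expr.var regY) (regCand ::= Expr.var regY) (regCand ::= Expr.const 0 - Expr.var regY) ;;
        Cmd.ite (Expr.var regX) (regCand ::= Expr.var regCand - Expr.var regX)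
          (regCand ::= Expr.var regCand + Expr.var regX) ;;
        Cmd.store arrCost (Expr.var regK) (Expr.var regH) (Expr.var regCand))
      (Cmd.store arrCost (Expr.var regK) (Expr.var regH) (Expr.const 0)))
    (Cmd.store arrX (Expr.var regI) (Expr.var regJ) (Expr.var regY) ;;
      Cmd.evalObj regCand arrX ;;
      Cmd.store arrX (Expr.var regI) (Expr.var regJ) (Expr.var regX) ;;
      Cmd.store arrCost (Expr.var regK) (Expr.var regH) (Expr.var regCand - Expr.var regF))

def allowCmd : Cmd :=
  Cmd.ite (Expr.var regY - Expr.get arrLo (Expr.var regI) (Expr.var regJ) + Expr.const 1)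
    (Cmd.ite (Expr.get arrUp (Expr.var regI) (Expr.var regJ) - Expr.var regY + Expr.const 1)
      (Cmd.store arrAllow (Expr.var regK) (Expr.var regH) (Expr.const 1))
      (Cmd.store arrAllow (Expr.var regK) (Expr.var regH) (Expr.const 0)))
    (Cmd.store arrAllow (Expr.var regK) (Expr.var regH) (Expr.const 0))

def fillValue : Cmd :=
  regH ::= Expr.var regC - Expr.var regG ;; regY ::= Expr.var regX + Expr.var regH ;;
  allowCmd ;; costCmd

def fillVariable : Cmd :=
  regI ::= Expr.get arrRow (Expr.var regK) (Expr.const 0) ;;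
  regJ ::= Expr.get arrCol (Expr.var regK) (Expr.const 0) ;;
  regX ::= Expr.get arrX (Expr.var regI) (Expr.var regJ) ;;
  forUp regC (Expr.var regG + Expr.var regG + Expr.const 1) fillValue

/-- Tabulates the admissible changes of the variables and their costs. -/
def fillTables : Cmd := Cmd.evalObj regF arrX ;; forUp regK (Expr.var regM) fillVariable

/-- The objective function of the first phase. -/
def slackNorm (nt k : ℕ) : ℤ → ℤ := if k < nt then fun _ => 0 else fun z => |z|

theorem slackNorm_convex (nt k : ℕ) : IntConvex (slackNorm nt k) := by
  unfold slackNorm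
  split_ifs
  · exact intConvex_zero
  · exact intConvex_abs

theorem run_costCmd_slack {s : State} {k nt : ℕ} {h x y : ℤ} (hph : s.var regPhase = 1)
    (hk : s.var regK = k) (hnt : s.var regNT = nt) (hh : s.var regH = h) (hx : s.var regX = x)
    (hy : s.var regY = y) :
    Run E costCmd s 60 fun s' => s'.arr arrX = s.arr arrX ∧
      ∀ k' h', s'.arr arrCost k' h' = if k' = k ∧ h' = h then slackNorm nt k y - slackNorm nt k x
        else s.arr arrCost k' h' := by
  refine (Run.straight ?_).le (T₁ := costCmd.bound) (by decide)
  simp only [costCmd, Cmd.wp, Expr.eval_sub, Expr.eval_var, Expr.eval_add,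
    State.setVar_var, Expr.eval_const, State.setArr_var, hk, hh, hnt, hx, hy, hph]
  norm_num only [if_true, if_false]
  have hX : ∀ (s₁ : State) (i j z : ℤ), (s₁.setArr arrCost i j z).arr arrX = s₁.arr arrX :=
    fun s₁ i j z => State.setArr_arr_ne s₁ (by decide) i j z
  refine ⟨fun _ => ⟨fun hkn => ⟨fun h1 => ⟨fun h2 => ⟨hX _ _ _ _, fun k' h' => ?_⟩,
    fun h2 => ⟨hX _ _ _ _, fun k' h' => ?_⟩⟩, fun h1 => ⟨fun h2 => ⟨hX _ _ _ _, fun k' h' => ?_⟩,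
    fun h2 => ⟨hX _ _ _ _, fun k' h' => ?_⟩⟩⟩,
    fun hkn => ⟨hX _ _ _ _, fun k' h' => ?_⟩⟩, fun h => h.elim⟩
  all_goals
    rw [State.setArr_arr_self]
    congr 1
  all_goals
    unfold slackNorm
  · rw [if_neg (by omega)]
    rw [abs_of_pos h1, abs_of_pos h2]
  · rw [if_neg (by omega)]
    rw [abs_of_pos h1, abs_of_nonpos (by omega)]; ring
  · rw [if_neg (by omega)]
    rw [abs_of_nonpos (by omega), abs_of_pos h2]; ring
  · rw [if_neg (by omega)]
    rw [abs_of_nonpos (by omega), abs_of_nonpos (by omega)]; ring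
  · rw [if_pos (by omega)]; simp

/-- The entry is overwritten, the oracle called once, and the entry restored. Subtracting the value
at the current point, kept in `regF`, leaves the univariate difference. -/
theorem run_costCmd_objective {s : State} {k m : ℕ} {h y : ℤ} (hph : s.var regPhase = 0)
    (hm : n * t ≤ m) (hkm : k < m) {ψ : Fin n × Fin t → ℤ → ℤ}
    (hψ : ∀ x, E.f x = ∑ p, ψ p (x p))
    (hk : s.var regK = k) (hh : s.var regH = h) (hx : s.var regX = entry n t (s.arr arrX) k)
    (hy : s.var regY = y) (hi : s.var regI = rowOf n t k) (hj : s.var regJ = colOf n t k)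
    (hF : s.var regF = E.f (readVec n t (s.arr arrX))) :
    Run E costCmd s 60 fun s' => s'.arr arrX = s.arr arrX ∧
      ∀ k' h', s'.arr arrCost k' h' = if k' = k ∧ h' = h then
        flatten ψ k y - flatten ψ k (entry n t (s.arr arrX) k) else s.arr arrCost k' h' := by
  refine (Run.straight ?_).le (T₁ := costCmd.bound) (by decide)
  simp only [costCmd, Cmd.wp, Expr.eval_sub, Expr.eval_var, Expr.eval_add,
    State.setVar_var, Expr.eval_const, State.setArr_var, hk, hh, hx, hy, hi, hj, hF, hph]
  norm_num only [if_true, if_false]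
  refine ⟨fun h => h.elim, fun _ => ⟨?_, fun k' h' => ?_⟩⟩
  · rw [State.setArr_arr_ne _ (by decide)]
    funext i j
    rw [State.setArr_arr_self, State.setVar_arr, State.setArr_arr_self]
    split_ifs with hij
    · rw [hij.1, hij.2, entry]
    · rfl
  · rw [State.setArr_arr_self]
    congr 1
    · rw [hψ, hψ]
      exact sum_readVec_update hm ψ _ _ hkm y fun i j => by rw [State.setArr_arr_self]

/-- A tabulated value: whether the change `h` of the variable `k` is admissible. -/
def allowed (lo up x : ℕ → ℤ) (k : ℕ) (h : ℤ) : ℤ :=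
  if lo k ≤ x k + h ∧ x k + h ≤ up k then 1 else 0

theorem run_allowCmd {s : State} {k : ℕ} {h : ℤ} {lo up x : ℕ → ℤ} (hk : s.var regK = k)
    (hh : s.var regH = h) (hy : s.var regY = x k + h)
    (hlo : s.arr arrLo (s.var regI) (s.var regJ) = lo k)
    (hup : s.arr arrUp (s.var regI) (s.var regJ) = up k) :
    Run E allowCmd s 40 fun s' => ∀ k' h', s'.arr arrAllow k' h' =
      if k' = k ∧ h' = h then allowed lo up x k h else s.arr arrAllow k' h' := by
  refine (Run.straight ?_).le (T₁ := allowCmd.bound) (by decide)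
  simp only [allowCmd, Cmd.wp, Expr.eval_sub, Expr.eval_var, Expr.eval_get, Expr.eval_add,
    Expr.eval_const, hk, hh, hy, hlo, hup, State.setArr_arr_self, allowed]
  refine ⟨fun h1 => ⟨fun h2 k' h' => ?_, fun h2 k' h' => ?_⟩, fun h1 k' h' => ?_⟩ <;> congr 1
  · rw [if_pos (by omega)]
  · rw [if_neg (by omega)]
  · rw [if_neg (by omega)]

theorem run_fillTables {s : State} {m G : ℕ} {lo up : ℕ → ℤ} {cv : ℕ → ℤ → ℤ}
    (hM : s.var regM = m) (hG : s.var regG = G) (hidx : Indexed n t m s)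
    (hlo : ∀ k < m, entry n t (s.arr arrLo) k = lo k)
    (hup : ∀ k < m, entry n t (s.arr arrUp) k = up k)
    (hcost : ∀ s' : State, ∀ k < m, ∀ h, Keep s s' → s'.arr arrX = s.arr arrX →
      s'.var regF = E.f (readVec n t (s.arr arrX)) → s'.var regK = k → s'.var regH = h →
      s'.var regX = entry n t (s.arr arrX) k → s'.var regY = entry n t (s.arr arrX) k + h →
      s'.var regI = rowOf n t k → s'.var regJ = colOf n t k →
      Run E costCmd s' 60 fun s'' => s''.arr arrX = s'.arr arrX ∧
        ∀ k' h', s''.arr arrCost k' h' = if k' = k ∧ h' = h then cv k h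
          else s'.arr arrCost k' h') :
    Run E fillTables s ((m + 1) * ((2 * G + 2) * 160)) fun s' =>
      (∀ k < m, ∀ h, |h| ≤ (G : ℤ) →
        s'.arr arrAllow k h = allowed lo up (entry n t (s.arr arrX)) k h) ∧
      (∀ k < m, ∀ h, |h| ≤ (G : ℤ) → s'.arr arrCost k h = cv k h) ∧
      s'.arr arrX = s.arr arrX := by
  set x := entry n t (s.arr arrX) with hx
  refine Run.le (T₁ := 1 + (m + 1) * ((4 + (4 + (4 + (2 * G + 1 + 1) * (110 + 5 + 10)))) + 1 + 10)) ?_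
    (by nlinarith)
  refine Run.seq (Run.straight ?_)
  simp only [Cmd.wp]
  refine (Run.forUp (N := m) (T := 4 + (4 + (4 + (2 * G + 1 + 1) * (110 + 5 + 10)))) (fun K s' =>
    s'.arr arrX = s.arr arrX ∧ ∀ k < m, ∀ h, |h| ≤ (G : ℤ) → k < K →
      s'.arr arrAllow k h = allowed lo up x k h ∧ s'.arr arrCost k h = cv k h)
    (by decide) ?_ ?_ ?_).mono le_rfl ?_
  · intro s' ha
    have := ha.var regM (by decide)
    simp at this
    simp [this, hM]
  · exact ⟨rfl, fun k _ h _ hk => absurd hk (Nat.not_lt_zero k)⟩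
  · intro K hK s' ha hkv hP
    obtain ⟨p1, p2⟩ := hP
    have hG' := ha.var regG (by decide)
    have hF := ha.var regF (by decide)
    have a1 := ha.arr arrRow (by decide)
    have a2 := ha.arr arrCol (by decide)
    have hkeep : Keep (s.setVar regF (E.f (readVec n t (s.arr arrX)))) s' :=
      ha.keep (by decide) (by decide)
    simp at hG' hF a1 a2
    refine Run.seq (Run.straight ?_)
    refine Run.seq (Run.straight ?_)
    refine Run.seq (Run.straight ?_)
    simp only [Cmd.wp, Expr.eval_get, Expr.eval_var, Expr.eval_const, State.setVar_var,
      State.setVar_arr, a1, a2, hkv, (hidx K hK).1, p1]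
    norm_num only [if_true, if_false]
    simp only [(hidx K hK).2]
    refine (Run.forUp (N := 2 * G + 1) (T := 110) (fun c s₁ =>
      s₁.arr arrX = s.arr arrX ∧ ∀ k < m, ∀ h, |h| ≤ (G : ℤ) → k < K ∨ (k = K ∧ h < c - G) →
        s₁.arr arrAllow k h = allowed lo up x k h ∧ s₁.arr arrCost k h = cv k h)
      (by decide) ?_ ?_ ?_).mono le_rfl ?_
    · intro s₁ hb
      have := hb.var regG (by decide)
      simp at this
      simp [this, hG', hG]; ring
    · refine ⟨p1, fun k hk h hh hor => ?_⟩
      rcases hor with h' | h'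
      · exact p2 k hk h hh h'
      · have := neg_abs_le h
        simp only [Nat.cast_zero] at h'
        omega
    · intro c hc s₁ hb hcv hQ
      obtain ⟨q1, q2⟩ := hQ
      have v1 := hb.var regG (by decide)
      have v2 := hb.var regF (by decide)
      have v3 := hb.var regK (by decide)
      have v4 := hb.var regI (by decide)
      have v5 := hb.var regJ (by decide)
      have v6 := hb.var regX (by decide)
      have hkeep1 : Keep s s₁ := by
        refine ⟨fun v hv => ?_, fun a ha' hX => ?_⟩
        · rw [hb.var v (by
            have : ∀ v ≤ 13, v ∉ (forUp regC (Expr.var regG + Expr.var regG + Expr.const 1)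
              fillValue).vars := by decide
            exact this v hv)]
          have h1 : v ≠ regI := by omega
          have h2 : v ≠ regJ := by omega
          have h3 : v ≠ regX := by omega
          have h4 : v ≠ regF := by omega
          simp only [State.setVar_var, h1, h2, h3, if_false]
          rw [hkeep.var v hv]
          simp [h4]
        · rw [hb.arr a (by
            have : ∀ a ≤ 13, a ≠ arrX → a ∉ (forUp regC
              (Expr.var regG + Expr.var regG + Expr.const 1) fillValue).arrs := by decide
            exact this a ha' hX)]
          exact hkeep.arr a ha' hX
      simp at v1 v2 v3 v4 v5 v6
      refine Run.le (T₁ := 4 + (4 + (40 + 60))) ?_ (by norm_num)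
      refine Run.seq (Run.straight ?_)
      refine Run.seq (Run.straight ?_)
      simp only [Cmd.wp, Expr.eval_sub, Expr.eval_add, Expr.eval_var, State.setVar_var, hcv, v1, hG',
        hG, v6]
      norm_num only [if_true, if_false]
      set s₂ := (s₁.setVar regH ((c : ℤ) - G)).setVar regY
        (s.arr arrX (rowOf n t K) (colOf n t K) + ((c : ℤ) - G)) with hs₂
      refine Run.bind (T₁ := 40) (T₂ := 60) (run_allowCmd (k := K) (h := c - G) (lo := lo) (up := up) (x := x) ?_ ?_ ?_
        ?_ ?_) ?_
      · simp [hs₂, v3, hkv]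
      · simp [hs₂]
      · simp [hs₂, hx, entry]
      · have := hkeep1.arr arrLo (by decide) (by decide)
        simp only [hs₂, State.setVar_var, State.setVar_arr, this, v4, v5]
        norm_num only [if_false]
        exact hlo K hK
      · have := hkeep1.arr arrUp (by decide) (by decide)
        simp only [hs₂, State.setVar_var, State.setVar_arr, this, v4, v5]
        norm_num only [if_false]
        exact hup K hK
      · intro s₃ hc3 hal
        have w1 := hc3.var regF (by decide)
        have w2 := hc3.var regK (by decide)
        have w3 := hc3.var regH (by decide)
        have w4 := hc3.var regX (by decide)
        have w5 := hc3.var regY (by decide)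
        have w6 := hc3.var regI (by decide)
        have w7 := hc3.var regJ (by decide)
        have w8 := hc3.arr arrX (by decide)
        have w9 := hc3.arr arrCost (by decide)
        have hkeep2 : Keep s₂ s₃ := hc3.keep (by decide) (by decide)
        have hkeep12 : Keep s₁ s₂ := ⟨fun v hv => by
          have h1 : v ≠ regH := by omega
          have h2 : v ≠ regY := by omega
          simp [hs₂, h1, h2], fun _ _ _ => rfl⟩
        simp only [hs₂, State.setVar_var, State.setVar_arr] at w1 w2 w3 w4 w5 w6 w7 w8 w9 hal
        norm_num only [if_true, if_false] at w1 w2 w3 w4 w5 w6 w7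
        refine (hcost s₃ K hK (c - G) ((hkeep1.trans hkeep12).trans hkeep2) (w8.trans q1)
          (by rw [w1, v2, hF]) (by rw [w2, v3, hkv]) w3 (by rw [w4, v6]; rfl) w5 (by rw [w6, v4])
          (by rw [w7, v5])).mono le_rfl fun s₄ hc4 h4 => ?_
        obtain ⟨r1, r2⟩ := h4
        have r3 := hc4.arr arrAllow (by decide)
        simp only [State.setVar_arr]
        refine ⟨by rw [r1, w8, q1], fun k hk h hh hor => ?_⟩
        rw [r2, r3, hal, w9]
        -- Either the cell just written, or one that the invariant already covers.
        by_cases heq : k = K ∧ h = c - G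
        · obtain ⟨rfl, rfl⟩ := heq
          simp
        · have hne : ¬ ((k : ℤ) = K ∧ h = c - G) := fun hh => heq ⟨by omega, hh.2⟩
          rw [if_neg hne, if_neg hne]
          refine q2 k hk h hh ?_
          push_cast at hor
          omega
    · rintro s₁ - ⟨q1, q2⟩
      refine ⟨q1, fun k hk h hh hlt => q2 k hk h hh ?_⟩
      have := le_abs_self h
      push_cast
      omega
  · rintro s' - ⟨p1, p2⟩
    exact ⟨fun k hk h hh => (p2 k hk h hh hk).1, fun k hk h hh => (p2 k hk h hh hk).2, p1⟩

/-- The two phases differ only in the cost of a single change, so the table filling is verified once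
relative to `costCmd`. -/
theorem fillSpec_of_cost {s₀ : State} {m G : ℕ} {lo up : ℕ → ℤ} {φ : ℕ → ℤ → ℤ}
    (hM : s₀.var regM = m) (hG : s₀.var regG = G) (hidx : Indexed n t m s₀)
    (hlo : ∀ k < m, entry n t (s₀.arr arrLo) k = lo k)
    (hup : ∀ k < m, entry n t (s₀.arr arrUp) k = up k)
    (hcost : ∀ s : State, ∀ k < m, ∀ h, Keep s₀ s →
      s.var regF = E.f (readVec n t (s.arr arrX)) → s.var regK = k → s.var regH = h →
      s.var regX = entry n t (s.arr arrX) k → s.var regY = entry n t (s.arr arrX) k + h →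
      s.var regI = rowOf n t k → s.var regJ = colOf n t k →
      Run E costCmd s 60 fun s' => s'.arr arrX = s.arr arrX ∧
        ∀ k' h', s'.arr arrCost k' h' = if k' = k ∧ h' = h then
          φ k (entry n t (s.arr arrX) k + h) - φ k (entry n t (s.arr arrX) k)
          else s.arr arrCost k' h') :
    FillSpec E fillTables m G φ lo up s₀ ((m + 1) * ((2 * G + 2) * 160)) := by
  intro s hk
  refine (run_fillTables (lo := lo) (up := up) (cv := fun k h =>
    φ k (entry n t (s.arr arrX) k + h) - φ k (entry n t (s.arr arrX) k))
    ((hk.var regM (by decide)).trans hM) ((hk.var regG (by decide)).trans hG) (hk.indexed hidx)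
    (by rw [hk.arr arrLo (by decide) (by decide)]; exact hlo)
    (by rw [hk.arr arrUp (by decide) (by decide)]; exact hup)
    ?_).mono le_rfl ?_
  · intro s' k hkm h hk' hX hF h1 h2 h3 h4 h5 h6
    rw [← hX] at hF h3 h4 ⊢
    exact hcost s' k hkm h (hk.trans hk') hF h1 h2 h3 h4 h5 h6
  · rintro s' ha ⟨h1, h2, h3⟩
    exact ⟨h1, h2, by rw [h3]; exact fun _ _ => rfl, ha.keep (by decide) (by decide),
      ha.arr _ (by decide), ha.arr _ (by decide), ha.var _ (by decide)⟩

theorem fillSpec_slack {s₀ : State} {m G nt : ℕ} {lo up : ℕ → ℤ} (hph : s₀.var regPhase = 1)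
    (hnt : s₀.var regNT = nt)
    (hM : s₀.var regM = m) (hG : s₀.var regG = G) (hidx : Indexed n t m s₀)
    (hlo : ∀ k < m, entry n t (s₀.arr arrLo) k = lo k)
    (hup : ∀ k < m, entry n t (s₀.arr arrUp) k = up k) :
    FillSpec E fillTables m G (slackNorm nt) lo up s₀ ((m + 1) * ((2 * G + 2) * 160)) :=
  fillSpec_of_cost hM hG hidx hlo hup fun _ _ _ _ hk _ h1 h2 h3 h4 _ _ =>
    run_costCmd_slack ((hk.var regPhase (by decide)).trans hph) h1
      ((hk.var regNT (by decide)).trans hnt) h2 h3 h4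

theorem fillSpec_objective {s₀ : State} {m G : ℕ} {lo up : ℕ → ℤ} (hph : s₀.var regPhase = 0)
    (hm : n * t ≤ m) {ψ : Fin n × Fin t → ℤ → ℤ} (hψ : ∀ x, E.f x = ∑ p, ψ p (x p))
    (hM : s₀.var regM = m) (hG : s₀.var regG = G) (hidx : Indexed n t m s₀)
    (hlo : ∀ k < m, entry n t (s₀.arr arrLo) k = lo k)
    (hup : ∀ k < m, entry n t (s₀.arr arrUp) k = up k) :
    FillSpec E fillTables m G (flatten ψ) lo up s₀ ((m + 1) * ((2 * G + 2) * 160)) :=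
  fillSpec_of_cost hM hG hidx hlo hup fun _ _ hkm _ hk hF h1 h2 h3 h4 h5 h6 =>
    run_costCmd_objective ((hk.var regPhase (by decide)).trans hph) hm hkm hψ h1 h2 h3 h4 h5 h6 hF

/-! ### Multiplication -/

/-- `regAcc := regAcc + regX * regD` -/
def addMul : Cmd :=
  Cmd.ite (Expr.var regD)
    (forUp regC (Expr.var regD) (regAcc ::= Expr.var regAcc + Expr.var regX))
    (forUp regC (Expr.const 0 - Expr.var regD) (regAcc ::= Expr.var regAcc - Expr.var regX))

/-- The machine cannot multiply; repeated addition costs time linear in `|regD|`. This is affordable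
because `regD` only ever holds quantities independent of `n`. -/
theorem run_addMul (s : State) :
    Run E addMul s (((s.var regD).natAbs + 1) * 36) fun s' =>
      s'.var regAcc = s.var regAcc + s.var regX * s.var regD := by
  set d := (s.var regD).natAbs with hd
  refine Run.le (T₁ := 1 + 1 + ((d + 1) * (4 + 1 + 10) + (d + 1) * (4 + 3 + 10))) ?_ (by omega)
  refine Run.ite (fun h => ?_) fun h => ?_
  · simp only [Expr.eval_var] at h
    have hdd : s.var regD = d := by omega
    refine (Run.forUp (N := d) (T := 4) (fun i s' => s'.var regAcc =
      s.var regAcc + s.var regX * i) (by decide) (fun s' ha => ?_) (by simp) ?_).mono le_rfl ?_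
    · rw [Expr.eval_var, ha.var regD (by decide), hdd]
    · intro i _ s' ha _ hP
      refine Run.straight ?_
      simp [Cmd.wp, hP, ha.var regX (by decide)]
      ring
    · intro s' _ h'
      rw [h', hdd]
  · simp only [Expr.eval_var] at h
    have hdd : s.var regD = -d := by omega
    refine (Run.forUp (N := d) (T := 4) (fun i s' => s'.var regAcc =
      s.var regAcc - s.var regX * i) (by decide) (fun s' ha => ?_) (by simp) ?_).mono le_rfl ?_
    · rw [Expr.eval_sub, Expr.eval_var, ha.var regD (by decide), hdd]; simp
    · intro i _ s' ha _ hP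
      refine Run.straight ?_
      simp [Cmd.wp, hP, ha.var regX (by decide)]
      ring
    · intro s' _ h'
      rw [h', hdd]; ring

/-- `v := e₁ * e₂` -/
def mulCmd (v : ℕ) (e₁ e₂ : Expr) : Cmd :=
  regX ::= e₁ ;; regD ::= e₂ ;; regAcc ::= Expr.const 0 ;; addMul ;; v ::= Expr.var regAcc

theorem run_mulCmd {s : State} {v : ℕ} {e₁ e₂ : Expr} {x : ℤ} {d : ℕ} (h₁ : e₁.eval s = x)
    (h₂ : e₂.eval (s.setVar regX x) = d) (hc₁ : e₁.cost ≤ 5) (hc₂ : e₂.cost ≤ 5) :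
    Run E (mulCmd v e₁ e₂) s ((d + 1) * 60) fun s' => s'.var v = x * d := by
  refine Run.le (T₁ := (e₁.cost + 1) + ((e₂.cost + 1) + (2 + ((d + 1) * 36 + 2)))) ?_ (by omega)
  refine Run.seq (Run.straight ?_)
  refine Run.seq (Run.straight ?_)
  refine Run.seq (Run.straight ?_)
  simp only [Cmd.wp, h₁, h₂, Expr.eval_const]
  set s₁ := ((s.setVar regX x).setVar regD d).setVar regAcc 0 with hs₁
  have := run_addMul (E := E) s₁
  have hd : (s₁.var regD).natAbs = d := by simp [hs₁]
  rw [hd] at this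
  refine Run.bind this fun s₂ _ h => Run.straight ?_
  simp [Cmd.wp, h, hs₁]

/-! ### The parameters of the algorithm -/

def deltaCmd : Cmd :=
  regDelta ::= Expr.const 1 ;;
  forUp regI (Expr.var regR) (forUp regJ (Expr.var regT) (
    regX ::= Expr.get arrD (Expr.var regI) (Expr.var regJ) ;;
    Cmd.ite (Expr.var regX) Cmd.skip (regX ::= Expr.const 0 - Expr.var regX) ;;
    Cmd.ite (Expr.var regX + Expr.const 1 - Expr.var regDelta)
      (regDelta ::= Expr.var regX + Expr.const 1) Cmd.skip))

/-- The hypotheses describe `Δ` as the least number `≥ 1` above all `|D i j| + 1`. The running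
maximum never exceeds `Δ`, and at the end it is an admissible bound itself. -/
theorem run_deltaCmd {s : State} {r t' : ℕ} {Δ : ℕ} (hr : s.var regR = r) (ht : s.var regT = t')
    (hΔ : ∀ i < r, ∀ j < t', |s.arr arrD i j| + 1 ≤ Δ) (hΔ1 : 1 ≤ Δ)
    (hmin : ∀ δ : ℤ, 1 ≤ δ → (∀ i < r, ∀ j < t', |s.arr arrD i j| + 1 ≤ δ) → (Δ : ℤ) ≤ δ) :
    Run E deltaCmd s ((r + 1) * ((t' + 1) * 70)) fun s' => s'.var regDelta = Δ := by
  refine Run.le (T₁ := 2 + (r + 1) * ((t' + 1) * (30 + 1 + 10) + 1 + 10)) ?_ (by nlinarith)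
  refine Run.seq (Run.straight ?_)
  simp only [Cmd.wp, Expr.eval_const]
  refine (Run.forUp (N := r) (T := (t' + 1) * (30 + 1 + 10)) (fun i s' => 1 ≤ s'.var regDelta ∧
    s'.var regDelta ≤ Δ ∧ ∀ i' < i, ∀ j < t', |s.arr arrD i' j| + 1 ≤ s'.var regDelta) (by decide)
    (fun s' ha => ?_) ?_ ?_).mono le_rfl ?_
  · have := ha.var regR (by decide)
    simp at this
    simp [this, hr]
  · simpa using hΔ1
  · intro i hi s' ha hiv hP
    obtain ⟨p1, p2, p3⟩ := hP
    have hT := ha.var regT (by decide)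
    have hD := ha.arr arrD (by decide)
    simp at hT hD
    refine (Run.forUp (N := t') (T := 30) (fun j s₁ => 1 ≤ s₁.var regDelta ∧
      s₁.var regDelta ≤ Δ ∧ ∀ i' : ℕ, ∀ j' : ℕ, j' < t' → i' < i ∨ (i' = i ∧ j' < j) →
        |s.arr arrD i' j'| + 1 ≤ s₁.var regDelta) (by decide) (fun s₁ hb => ?_) ?_ ?_).mono le_rfl ?_
    · have := hb.var regT (by decide)
      simp [this, hT, ht]
    · simp only [State.setVar_var]
      norm_num only [if_false]
      exact ⟨p1, p2, fun i' j' hj' h => p3 i' (by omega) j' hj'⟩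
    · intro j hj s₁ hb hjv hQ
      obtain ⟨q1, q2, q3⟩ := hQ
      have hi1 := hb.var regI (by decide)
      have hD1 := hb.arr arrD (by decide)
      have key : ∀ δ : ℤ, s₁.var regDelta ≤ δ → |s.arr arrD i j| + 1 ≤ δ → ∀ i' : ℕ, ∀ j' : ℕ,
          j' < t' → i' < i ∨ (i' = i ∧ j' < j + 1) → |s.arr arrD i' j'| + 1 ≤ δ := by
        intro δ h1 h2 i' j' hj' hor
        by_cases h : i' = i ∧ j' = j
        · rw [h.1, h.2]; exact h2
        · exact (q3 i' j' hj' (by omega)).trans h1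
      have hle := hΔ i hi j hj
      refine (Run.straight ?_).le (by decide)
      simp only [Cmd.wp, Expr.eval_get, Expr.eval_sub, Expr.eval_add, Expr.eval_var,
        Expr.eval_const, State.setVar_var, hi1, hiv, hD1, hD, hjv]
      norm_num only [if_true, if_false]
      refine ⟨fun h1 => ⟨fun h2 => ?_, fun h2 => ?_⟩, fun h1 => ⟨fun h2 => ?_, fun h2 => ?_⟩⟩
      · have := abs_of_pos h1
        exact ⟨by omega, by omega, key _ (by omega) (by omega)⟩
      · have := abs_of_pos h1
        exact ⟨q1, q2, key _ le_rfl (by omega)⟩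
      · have := abs_of_nonpos (not_lt.1 h1)
        exact ⟨by omega, by omega, key _ (by omega) (by omega)⟩
      · have := abs_of_nonpos (not_lt.1 h1)
        exact ⟨q1, q2, key _ le_rfl (by omega)⟩
    · rintro s₁ - ⟨q1, q2, q3⟩
      simp only [State.setVar_var]
      norm_num only [if_false]
      exact ⟨q1, q2, fun i' hi' j hj => q3 i' j hj (by omega)⟩
  · rintro s' - ⟨p1, p2, p3⟩
    exact le_antisymm p2 (hmin _ p1 p3)

/-- The parameters computed by `paramCmd` and kept during the whole computation. -/
structure Params (r t n G V W : ℕ) (s : State) : Prop where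
  r_eq : s.var regR = r
  t_eq : s.var regT = t
  n_eq : s.var regN = n
  G_eq : s.var regG = G
  V_eq : s.var regV = V
  B_eq : s.var regB = (2 * V + 1 : ℕ)
  nt_eq : s.var regNT = (n * t : ℕ)
  m_eq : s.var regM = (n * t + r : ℕ)
  W_eq : s.var regW = W

def powCmd : Cmd :=
  regG ::= Expr.const 1 ;;
  forUp regI (Expr.var regR) (mulCmd regG (Expr.var regG) (Expr.var regBase))

theorem run_powCmd {s : State} {r a : ℕ} (hr : s.var regR = r) (ha : s.var regBase = a) :
    Run E powCmd s ((r + 1) * ((a + 1) * 60 + 13)) fun s' => s'.var regG = (a ^ r : ℕ) := by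
  refine Run.le (T₁ := 2 + (r + 1) * ((a + 1) * 60 + 1 + 10)) ?_ (by nlinarith)
  refine Run.seq (Run.straight ?_)
  simp only [Cmd.wp, Expr.eval_const]
  refine (Run.forUp (N := r) (T := (a + 1) * 60) (fun i s' => s'.var regG = (a ^ i : ℕ)) (by decide)
    (fun s' hb => ?_) (by simp) ?_).mono le_rfl fun s' _ h => h
  · have := hb.var regR (by decide)
    simp at this
    simp [this, hr]
  · intro i hi s' hb _ hP
    have hB := hb.var regBase (by decide)
    simp at hB
    refine (run_mulCmd (d := a) (x := (a ^ i : ℕ)) (by simpa using hP) (by simp [hB, ha])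
      (by decide) (by decide)).mono le_rfl fun s₁ _ h => ?_
    simp only [State.setVar_var]
    norm_num only [if_false]
    rw [h]; push_cast; ring

/-- `G` bounds the norm of a small kernel element, `V` the digits of its partial sums, and `W`
exceeds the proximity radius `(nt+1)G + 2nt` by two, leaving room for the rounding error. The second
factor of each product is the number of additions: `r`, `4Δr+1`, `Δ`, `t` and `G+2`, never a
multiple of `n`. -/
def paramCmd : Cmd :=
  deltaCmd ;;
  mulCmd regP (Expr.var regDelta) (Expr.var regR) ;;
  regBase ::= Expr.var regP + Expr.var regP + Expr.var regP + Expr.var regP + Expr.const 1 ;;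
  powCmd ;;
  regG ::= Expr.var regG + Expr.var regG ;;
  mulCmd regV (Expr.var regG) (Expr.var regDelta) ;;
  regB ::= Expr.var regV + Expr.var regV + Expr.const 1 ;;
  mulCmd regNT (Expr.var regN) (Expr.var regT) ;;
  regM ::= Expr.var regNT + Expr.var regR ;;
  mulCmd regW (Expr.var regNT + Expr.const 1) (Expr.var regG + Expr.const 2)

theorem run_paramCmd {s : State} {r t' n' : ℕ} {Δ G V W : ℕ} (hr : s.var regR = r)
    (ht : s.var regT = t') (hn : s.var regN = n')
    (hΔ : ∀ i < r, ∀ j < t', |s.arr arrD i j| + 1 ≤ Δ) (hΔ1 : 1 ≤ Δ)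
    (hmin : ∀ δ : ℤ, 1 ≤ δ → (∀ i < r, ∀ j < t', |s.arr arrD i j| + 1 ≤ δ) → (Δ : ℤ) ≤ δ)
    (hG : G = 2 * (4 * Δ * r + 1) ^ r) (hV : V = Δ * G) (hW : W = (n' * t' + 1) * (G + 2)) :
    Run E paramCmd s ((r + 1) * ((t' + 1) * 70) + (r + 1) * ((4 * Δ * r + 3) * 60) +
      (t' + Δ + G + r + 6) * 60) (Params r t' n' G V W) := by
  refine Run.le (T₁ := (r + 1) * ((t' + 1) * 70) + ((r + 1) * 60 + (10 +
    ((r + 1) * ((4 * Δ * r + 1 + 1) * 60 + 13) + (4 + ((Δ + 1) * 60 + (6 + ((t' + 1) * 60 + (4 +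
      (G + 2 + 1) * 60))))))))) ?_ (by nlinarith)
  refine Run.bind (run_deltaCmd hr ht hΔ hΔ1 hmin) fun s₁ a₁ h₁ => ?_
  have r₁ := (a₁.var regR (by decide)).trans hr
  have t₁ := (a₁.var regT (by decide)).trans ht
  have n₁ := (a₁.var regN (by decide)).trans hn
  refine Run.bind (run_mulCmd (x := Δ) (d := r) (by simpa using h₁) (by simpa using r₁) (by decide)
    (by decide)) fun s₂ a₂ h₂ => ?_
  have r₂ := (a₂.var regR (by decide)).trans r₁
  have t₂ := (a₂.var regT (by decide)).trans t₁
  have n₂ := (a₂.var regN (by decide)).trans n₁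
  have d₂ := (a₂.var regDelta (by decide)).trans h₁
  refine Run.seq (Run.straight ?_)
  simp only [Cmd.wp, Expr.eval_add, Expr.eval_var, h₂, Expr.eval_const]
  refine Run.bind (run_powCmd (r := r) (a := 4 * Δ * r + 1) (by simpa using r₂)
    (by simp; ring)) fun s₃ a₃ h₃ => ?_
  have r₃ := (a₃.var regR (by decide))
  have t₃ := (a₃.var regT (by decide))
  have n₃ := (a₃.var regN (by decide))
  have d₃ := (a₃.var regDelta (by decide))
  simp [r₂, t₂, n₂, d₂] at r₃ t₃ n₃ d₃
  have hGG : ((4 * Δ * r + 1) ^ r : ℕ) + ((4 * Δ * r + 1) ^ r : ℕ) = (G : ℤ) := by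
    rw [hG]; push_cast; ring
  refine Run.seq (Run.straight ?_)
  simp only [Cmd.wp, Expr.eval_add, Expr.eval_var, h₃, hGG]
  refine Run.bind (run_mulCmd (x := G) (d := Δ) (by simp) (by simpa using d₃) (by decide)
    (by decide)) fun s₄ a₄ h₄ => ?_
  have r₄ := (a₄.var regR (by decide))
  have t₄ := (a₄.var regT (by decide))
  have n₄ := (a₄.var regN (by decide))
  have g₄ := (a₄.var regG (by decide))
  simp [r₃, t₃, n₃] at r₄ t₄ n₄ g₄
  have hVV : (G : ℤ) * Δ = V := by rw [hV]; push_cast; ring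
  rw [hVV] at h₄
  refine Run.seq (Run.straight ?_)
  simp only [Cmd.wp, Expr.eval_add, Expr.eval_var, h₄, Expr.eval_const]
  refine Run.bind (run_mulCmd (x := n') (d := t') (by simpa using n₄) (by simpa using t₄)
    (by decide) (by decide)) fun s₅ a₅ h₅ => ?_
  have r₅ := (a₅.var regR (by decide))
  have t₅ := (a₅.var regT (by decide))
  have n₅ := (a₅.var regN (by decide))
  have g₅ := (a₅.var regG (by decide))
  have v₅ := (a₅.var regV (by decide))
  have b₅ := (a₅.var regB (by decide))
  simp [r₄, t₄, n₄, g₄, h₄] at r₅ t₅ n₅ g₅ v₅ b₅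
  refine Run.seq (Run.straight ?_)
  simp only [Cmd.wp, Expr.eval_add, Expr.eval_var, h₅]
  refine (run_mulCmd (x := n' * t' + 1) (d := G + 2) (by simp [h₅]) (by simp [g₅])
    (by decide) (by decide)).mono le_rfl fun s₆ a₆ h₆ => ?_
  have r₆ := (a₆.var regR (by decide))
  have t₆ := (a₆.var regT (by decide))
  have n₆ := (a₆.var regN (by decide))
  have g₆ := (a₆.var regG (by decide))
  have v₆ := (a₆.var regV (by decide))
  have b₆ := (a₆.var regB (by decide))
  have nt₆ := (a₆.var regNT (by decide))
  have m₆ := (a₆.var regM (by decide))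
  simp [r₅, t₅, n₅, g₅, v₅, b₅, h₅] at r₆ t₆ n₆ g₆ v₆ b₆ nt₆ m₆
  refine ⟨r₆, t₆, n₆, g₆, v₆, ?_, ?_, ?_, ?_⟩
  · rw [b₆]; push_cast; ring
  · rw [nt₆]; push_cast; ring
  · rw [m₆]; push_cast; ring
  · rw [h₆, hW]; push_cast; ring

theorem Params.of_agree {c : Cmd} {s s' : State} {r t n G V W : ℕ} (ha : Agree c s s')
    (hc : ∀ v ∈ [regR, regT, regN, regG, regV, regB, regNT, regM, regW], v ∉ c.vars)
    (h : Params r t n G V W s) : Params r t n G V W s' := by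
  obtain ⟨h1, h2, h3, h4, h5, h6, h7, h8, h9⟩ := h
  constructor
  · rw [ha.var _ (hc _ (by decide)), h1]
  · rw [ha.var _ (hc _ (by decide)), h2]
  · rw [ha.var _ (hc _ (by decide)), h3]
  · rw [ha.var _ (hc _ (by decide)), h4]
  · rw [ha.var _ (hc _ (by decide)), h5]
  · rw [ha.var _ (hc _ (by decide)), h6]
  · rw [ha.var _ (hc _ (by decide)), h7]
  · rw [ha.var _ (hc _ (by decide)), h8]
  · rw [ha.var _ (hc _ (by decide)), h9]

/-! ### Powers of the base of the packing -/

/-- All powers carry the factor `G + 1` of the state index from the start, so no later scaling is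
needed. `regLowBrick` lags one round behind `regLowFull` and thus ends with one digit less. -/
def powersCmd : Cmd :=
  Cmd.store arrPow (Expr.const 0) (Expr.const 0) (Expr.var regG + Expr.const 1) ;;
  regLowFull ::= Expr.const 0 ;;
  forUp regP (Expr.var regR + Expr.const 1) (
    regF ::= Expr.get arrPow (Expr.var regP) (Expr.const 0) ;;
    mulCmd regY (Expr.var regF) (Expr.var regV) ;;
    regLowBrick ::= Expr.var regLowFull ;;
    regLowFull ::= Expr.var regLowFull + Expr.var regY ;;
    mulCmd regY (Expr.var regF) (Expr.var regB) ;;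
    Cmd.store arrPow (Expr.var regP + Expr.const 1) (Expr.const 0) (Expr.var regY))

/-- The contents of `arrPow`, `regLowBrick` and `regLowFull`. -/
structure Powers (r G V : ℕ) (s : State) : Prop where
  pow : ∀ p ≤ r + 1, s.arr arrPow p 0 = (G + 1) * (2 * V + 1) ^ p
  brick : s.var regLowBrick = (G + 1) * packMax V r
  full : s.var regLowFull = (G + 1) * packMax V (r + 1)

theorem packMax_succ (V e : ℕ) : packMax V (e + 1) = packMax V e + V * (2 * V + 1) ^ e := by
  rw [packMax, Finset.sum_range_succ, mul_add, ← packMax]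

theorem run_powersCmd {s : State} {r t n G V W : ℕ} (hs : Params r t n G V W s) :
    Run E powersCmd s ((r + 2) * ((V + 1) * 220)) (Powers r G V) := by
  refine Run.le (T₁ := 6 + (2 + (r + 1 + 1) * ((4 + ((V + 1) * 60 + (2 + (4 + ((2 * V + 1 + 1) * 60 +
    6))))) + 3 + 10))) ?_ (by nlinarith)
  refine Run.seq (Run.straight ?_)
  refine Run.seq (Run.straight ?_)
  simp only [Cmd.wp, Expr.eval_add, Expr.eval_var, Expr.eval_const, hs.G_eq]
  set s₀ := (s.setArr arrPow 0 0 (G + 1)).setVar regLowFull 0 with hs₀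
  have hs₀p : Params r t n G V W s₀ := ⟨hs.1, hs.2, hs.3, hs.4, hs.5, hs.6, hs.7, hs.8, hs.9⟩
  refine (Run.forUp (N := r + 1) (T := (4 + ((V + 1) * 60 + (2 + (4 + ((2 * V + 1 + 1) * 60 +
    6)))))) (fun i s' => (∀ p ≤ i, s'.arr arrPow p 0 = (G + 1) * (2 * V + 1) ^ p) ∧
      s'.var regLowFull = (G + 1) * packMax V i ∧
      ∀ i', i = i' + 1 → s'.var regLowBrick = (G + 1) * packMax V i') (by decide)
      (fun s' ha => ?_) ?_ ?_).mono le_rfl ?_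
  · have := hs₀p.of_agree ha (by decide)
    simp [this.r_eq]
  · refine ⟨fun p hp => ?_, by simp [hs₀, packMax], by omega⟩
    obtain rfl : p = 0 := by omega
    simp [hs₀]
  · rintro i hi s₁ ha hP ⟨p1, p2, p3⟩
    have hp₁ := hs₀p.of_agree ha (by decide)
    refine Run.seq (Run.straight ?_)
    simp only [Cmd.wp, Expr.eval_get, Expr.eval_var, Expr.eval_const, hP, p1 i le_rfl]
    refine Run.bind (run_mulCmd (x := (G + 1) * (2 * V + 1) ^ i) (d := V) (by simp)
      (by simp [hp₁.V_eq]) (by decide) (by decide)) fun s₂ a₂ h₂ => ?_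
    have hp₂ := hp₁.of_agree (c := regF ::= Expr.const 0) (s' := s₁.setVar regF
      ((G + 1) * (2 * V + 1) ^ i)) (Agree.setVar _ _ _ (by decide)) (by decide)
    have hp₃ := hp₂.of_agree a₂ (by decide)
    have e1 := a₂.var regLowFull (by decide)
    have e2 := a₂.var regF (by decide)
    have e3 := a₂.var regP (by decide)
    have e4 := a₂.arr arrPow (by decide)
    simp [p2, hP] at e1 e2 e3 e4
    refine Run.seq (Run.straight ?_)
    refine Run.seq (Run.straight ?_)
    simp only [Cmd.wp, Expr.eval_var, Expr.eval_add, State.setVar_var, e1, h₂]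
    norm_num only [if_false]
    refine Run.bind (run_mulCmd (x := (G + 1) * (2 * V + 1) ^ i) (d := 2 * V + 1) (by simp [e2])
      (by simp [hp₃.B_eq]) (by decide) (by decide)) fun s₃ a₃ h₃ => ?_
    have f1 := a₃.var regLowFull (by decide)
    have f2 := a₃.var regLowBrick (by decide)
    have f3 := a₃.var regP (by decide)
    have f4 := a₃.arr arrPow (by decide)
    simp [e3] at f1 f2 f3 f4
    refine (Run.straight ?_).le (by decide)
    simp only [Cmd.wp, Expr.eval_add, Expr.eval_var, Expr.eval_const, f3, h₃]
    refine ⟨fun p hp => ?_, ?_, fun i' hi' => ?_⟩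
    · simp only [State.setVar_arr, State.setArr_arr_self, f4, e4]
      by_cases hpi : p = i + 1
      · rw [if_pos ⟨by rw [hpi]; push_cast; ring, trivial⟩, hpi]; push_cast; ring
      · rw [if_neg (by omega), p1 p (by omega)]
    · simp [f1, packMax_succ]; ring
    · obtain rfl : i' = i := by omega
      simp [f2]
  · rintro s' - ⟨p1, p2, p3⟩
    exact ⟨p1, p3 r rfl, p2⟩

/-! ### Tables for the dynamic program -/

/-- The column of the variable `k` in the upper constraints: the variables `n * t, …` are slack
variables. -/
def tableCol {r : ℕ} (n t : ℕ) (A : ℤ → ℤ → ℤ) (k : ℕ) (p : Fin r) : ℤ :=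
  if k < n * t then A (p : ℕ) (k % t : ℕ) else if k - n * t = p then 1 else 0

/-- `regAcc` becomes the scaled weight of the variable `regK`. -/
def weightCmd : Cmd :=
  Cmd.ite (Expr.var regNT - Expr.var regK)
    (regAcc ::= Expr.get arrPow (Expr.var regR) (Expr.const 0) ;;
      forUp regP (Expr.var regR) (
        regX ::= Expr.get arrPow (Expr.var regP) (Expr.const 0) ;;
        regD ::= Expr.get arrD (Expr.var regP) (Expr.var regJ) ;;
        addMul))
    (regAcc ::= Expr.get arrPow (Expr.var regJ) (Expr.const 0))

/-- The brick digit of an ordinary variable is `1`, hence the accumulation starts from the power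
`r`. The column of a slack variable is a unit vector, so its weight is a single power. -/
theorem run_weightCmd {s : State} {r t n G V W k Δ : ℕ} (hs : Params r t n G V W s)
    (hp : Powers r G V s) (ht : 0 < t) (hk : s.var regK = k) (hj : s.var regJ = colOf n t k)
    (hkm : k < n * t + r) (hD : ∀ p < r, ∀ j < t, |s.arr arrD p j| ≤ Δ) :
    Run E weightCmd s ((r + 1) * ((Δ + 1) * 70)) fun s' => s'.var regAcc =
      (G + 1) * weight n t V (tableCol (r := r) n t (s.arr arrD)) k := by
  refine Run.le (T₁ := 3 + 1 + ((4 + (r + 1) * ((4 + (4 + (Δ + 1) * 36)) + 1 + 10)) + 4)) ?_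
    (by nlinarith)
  refine Run.ite (fun h => ?_) fun h => ?_
  · simp only [Expr.eval_sub, Expr.eval_var, hs.nt_eq, hk] at h
    have hkn : k < n * t := by omega
    rw [colOf, if_pos hkn] at hj
    refine Run.seq (Run.straight ?_)
    simp only [Cmd.wp, Expr.eval_get, Expr.eval_var, Expr.eval_const, hs.r_eq,
      hp.pow r (by omega)]
    refine (Run.forUp (N := r) (T := 4 + (4 + (Δ + 1) * 36)) (fun i s' => s'.var regAcc =
      (G + 1) * (2 * V + 1) ^ r + ∑ p ∈ range i, (G + 1) * (2 * V + 1) ^ p *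
        s.arr arrD p (k % t : ℕ)) (by decide) (fun s' ha => ?_) (by simp) ?_).mono le_rfl ?_
    · have := ha.var regR (by decide)
      simp at this
      simp [this, hs.r_eq]
    · intro i hi s' ha hiv hP
      have e1 := ha.arr arrPow (by decide)
      have e2 := ha.arr arrD (by decide)
      have e3 := ha.var regJ (by decide)
      simp only [State.setVar_arr, State.setVar_var] at e1 e2 e3
      norm_num only [if_false] at e3
      refine Run.seq (Run.straight ?_)
      refine Run.seq (Run.straight ?_)
      simp only [Cmd.wp, Expr.eval_get, Expr.eval_var, Expr.eval_const, State.setVar_var,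
        State.setVar_arr, hiv, e1, e2]
      norm_num only [if_false]
      simp only [e3, hj, hp.pow i (by omega)]
      set s₁ := (s'.setVar regX ((G + 1) * (2 * V + 1) ^ i)).setVar regD
        (s.arr arrD i (k % t : ℕ)) with hs₁
      have hd : s₁.var regD = s.arr arrD i (k % t : ℕ) := by simp [hs₁]
      refine (run_addMul s₁).mono ?_ fun s₂ _ h₂ => ?_
      · have := hD i hi (k % t) (Nat.mod_lt _ ht)
        rw [hd]
        have : (s.arr arrD i (k % t : ℕ)).natAbs ≤ Δ := by
          rw [Int.abs_eq_natAbs] at this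
          exact_mod_cast this
        exact Nat.mul_le_mul_right _ (by omega)
      · rw [hd] at h₂
        have h₃ : s₁.var regAcc = s'.var regAcc := by simp [hs₁]
        have h₄ : s₁.var regX = (G + 1) * (2 * V + 1) ^ i := by simp [hs₁]
        rw [h₃, h₄, hP] at h₂
        rw [h₂, Finset.sum_range_succ]; ring
    · intro s' _ h'
      rw [h', weight, Finset.sum_range_succ, mul_add, Finset.mul_sum, add_comm]
      congr 1
      · refine Finset.sum_congr rfl fun p hp' => ?_
        rw [extCol, dif_pos (mem_range.1 hp'), tableCol, if_pos hkn]
        ring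
      · rw [extCol, dif_neg (by omega), if_pos hkn, one_mul]
  · simp only [Expr.eval_sub, Expr.eval_var, hs.nt_eq, hk] at h
    have hkn : ¬ k < n * t := by omega
    rw [colOf, if_neg hkn] at hj
    refine Run.straight ?_
    simp only [Cmd.wp, Expr.eval_get, Expr.eval_var, Expr.eval_const, hj,
      hp.pow (k - n * t) (by omega), State.setVar_var, if_true]
    congr 1
    rw [weight, Finset.sum_eq_single_of_mem (k - n * t) (mem_range.2 (by omega))]
    · rw [extCol, dif_pos (by omega), tableCol, if_neg hkn, if_pos rfl, one_mul]
    · intro p hp' hne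
      have := mem_range.1 hp'
      rw [extCol]
      split_ifs with h1
      · rw [tableCol, if_neg hkn, if_neg (by simpa using fun h => hne h.symm), zero_mul]
      · exact zero_mul _

/-- Tabulates the multiples of `regAcc` for the variable `regK`. -/
def shiftCmd : Cmd :=
  regY ::= Expr.const 0 ;;
  forUp regH (Expr.var regG + Expr.const 1) (
    Cmd.store arrShift (Expr.var regK) (Expr.var regH) (Expr.var regY + Expr.var regH) ;;
    Cmd.store arrShift (Expr.var regK) (Expr.const 0 - Expr.var regH)
      (Expr.var regH - Expr.var regY) ;;
    regY ::= Expr.var regY + Expr.var regAcc)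

theorem run_shiftCmd {s : State} {G k : ℕ} (hG : s.var regG = G) (hk : s.var regK = k) :
    Run E shiftCmd s ((G + 2) * 40) fun s' => ∀ k' h', s'.arr arrShift k' h' =
      if k' = k ∧ |h'| ≤ (G : ℤ) then s.var regAcc * h' + |h'| else s.arr arrShift k' h' := by
  refine Run.le (T₁ := 2 + (G + 1 + 1) * (20 + 3 + 10)) ?_ (by omega)
  refine Run.seq (Run.straight ?_)
  simp only [Cmd.wp, Expr.eval_const]
  refine (Run.forUp (N := G + 1) (T := 20) (fun i s' => s'.var regY = s.var regAcc * i ∧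
    ∀ k' h', s'.arr arrShift k' h' =
      if k' = k ∧ |h'| < (i : ℤ) then s.var regAcc * h' + |h'| else s.arr arrShift k' h') (by decide)
      (fun s' ha => ?_) ?_ ?_).mono le_rfl ?_
  · have := ha.var regG (by decide)
    simp at this
    simp [this, hG]
  · refine ⟨by simp, fun k' h' => ?_⟩
    rw [if_neg (by simp)]
    simp
  · rintro i hi s' ha hiv ⟨p1, p2⟩
    have e1 := ha.var regK (by decide)
    have e2 := ha.var regAcc (by decide)
    simp [hk] at e1 e2
    refine (Run.straight ?_).le (by decide)
    simp only [Cmd.wp, Expr.eval_var, Expr.eval_add, Expr.eval_sub, Expr.eval_const,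
      State.setArr_var, State.setVar_var, State.setVar_arr, State.setArr_arr_self, e1, e2, hiv, p1]
    norm_num only [if_true, if_false]
    refine ⟨by push_cast; ring, fun k' h' => ?_⟩
    push_cast
    by_cases hk' : k' = k
    · subst hk'
      simp only [true_and, p2]
      by_cases h1 : h' = i
      · subst h1
        by_cases h0 : (i : ℤ) = 0 - i
        · have h00 : (i : ℤ) = 0 := by omega
          simp [h00]
        · rw [if_neg h0, if_pos rfl, if_pos (by rw [abs_of_nonneg (by positivity)]; omega),
            abs_of_nonneg (by positivity)]
      · by_cases h2 : h' = 0 - i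
        · subst h2
          rw [if_pos rfl, if_pos (by rw [zero_sub, abs_neg, abs_of_nonneg (by positivity)]; omega),
            zero_sub, abs_neg, abs_of_nonneg (by positivity)]
          ring
        · rw [if_neg h2, if_neg h1]
          have : |h'| < ((i : ℤ) + 1) ↔ |h'| < i := by
            rw [abs_lt, abs_lt]; omega
          simp only [this]
    · simp [hk', p2]
  · rintro s' - ⟨-, h⟩ k' h'
    rw [h]
    have : |h'| < ((G + 1 : ℕ) : ℤ) ↔ |h'| ≤ G := by push_cast; omega
    simp only [this]

/-- Stores the range of the states after the variable `regK`. -/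
def limitCmd : Cmd :=
  Cmd.ite (Expr.var regNT - Expr.var regK)
    (Cmd.ite (Expr.var regT - Expr.var regJ - Expr.const 1)
      (Cmd.store arrCount (Expr.var regK) (Expr.const 0)
          (Expr.get arrPow (Expr.var regR + Expr.const 1) (Expr.const 0)) ;;
        Cmd.store arrLow (Expr.var regK) (Expr.const 0) (Expr.const 0 - Expr.var regLowFull))
      (Cmd.store arrCount (Expr.var regK) (Expr.const 0)
          (Expr.get arrPow (Expr.var regR) (Expr.const 0)) ;;
        Cmd.store arrLow (Expr.var regK) (Expr.const 0) (Expr.const 0 - Expr.var regLowBrick)))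
    (Cmd.store arrCount (Expr.var regK) (Expr.const 0)
        (Expr.get arrPow (Expr.var regR) (Expr.const 0)) ;;
      Cmd.store arrLow (Expr.var regK) (Expr.const 0) (Expr.const 0 - Expr.var regLowBrick))

theorem succ_mod_eq_zero_iff {t k : ℕ} (ht : 0 < t) : (k + 1) % t = 0 ↔ k % t + 1 = t := by
  have h := Nat.mod_lt k ht
  rw [← Nat.dvd_iff_mod_eq_zero, show k + 1 = (k % t + 1) + t * (k / t) by
    have := Nat.mod_add_div k t; omega, Nat.dvd_add_left (Dvd.intro _ rfl)]
  exact ⟨fun hd => le_antisymm h (Nat.le_of_dvd (by omega) hd), fun he => by rw [he]⟩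

/-- A window of radius `packMax V e` contains `(2V+1)^e` packed sums by `two_mul_packMax`, so its
number of states is already tabulated in `arrPow`. -/
theorem run_limitCmd {s : State} {r t n G V W k : ℕ} {S : ℕ → ℕ} (hs : Params r t n G V W s)
    (hp : Powers r G V s) (ht : 0 < t) (hk : s.var regK = k) (hj : s.var regJ = colOf n t k)
    (hS : ∀ k, (S k : ℤ) = layerBound n t V r k) :
    Run E limitCmd s 80 fun s' =>
      (∀ k', s'.arr arrCount k' 0 = if k' = k then (((G + 1) * (2 * S (k + 1) + 1) : ℕ) : ℤ)
        else s.arr arrCount k' 0) ∧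
      (∀ k', s'.arr arrLow k' 0 = if k' = k then -((G + 1) * S (k + 1) : ℤ)
        else s.arr arrLow k' 0) := by
  refine (Run.straight ?_).le (by decide : limitCmd.bound ≤ 80)
  have hr1 : s.arr arrPow ((r : ℤ) + 1) 0 = (G + 1) * (2 * V + 1) ^ (r + 1) := by
    exact_mod_cast hp.pow (r + 1) le_rfl
  have hL : ∀ (s₁ : State) (z z' : ℤ) (k' : ℤ),
      ((s₁.setArr arrCount k 0 z).setArr arrLow k 0 z').arr arrCount k' 0 =
        if k' = k then z else s₁.arr arrCount k' 0 := fun s₁ z z' k' => by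
    rw [State.setArr_arr_ne _ (by decide)]; simp
  have hL' : ∀ (s₁ : State) (z z' : ℤ) (k' : ℤ),
      ((s₁.setArr arrCount k 0 z).setArr arrLow k 0 z').arr arrLow k' 0 =
        if k' = k then z' else s₁.arr arrLow k' 0 := fun s₁ z z' k' => by
    simp [State.setArr_arr]
  simp only [limitCmd, Cmd.wp, Expr.eval_get, Expr.eval_var, Expr.eval_add, Expr.eval_sub,
    Expr.eval_const, State.setArr_var, hs.nt_eq, hs.t_eq, hs.r_eq, hp.brick, hp.full, hk, hj,
    hp.pow r (by omega), hr1, hL, hL', ← two_mul_packMax]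
  have hfull : (k + 1) % t ≠ 0 → k < n * t → (S (k + 1) : ℤ) = packMax V (r + 1) := fun h1 h2 => by
    rw [hS, layerBound, if_neg (by omega)]
  have hbrick : (k + 1) % t = 0 ∨ n * t ≤ k → (S (k + 1) : ℤ) = packMax V r := fun h => by
    rw [hS, layerBound, if_pos (by omega)]
  have hm := succ_mod_eq_zero_iff (k := k) ht
  have hlt := Nat.mod_lt k ht
  refine ⟨fun h1 => ?_, fun h1 => ?_⟩
  · have hkn : k < n * t := by omega
    rw [colOf, if_pos hkn]
    refine ⟨fun h2 => ?_, fun h2 => ?_⟩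
    · push_cast
      rw [hfull (by omega) hkn]
      exact ⟨fun _ => rfl, fun _ => by rw [zero_sub]⟩
    · push_cast
      rw [hbrick (by omega)]
      exact ⟨fun _ => rfl, fun _ => by rw [zero_sub]⟩
  · push_cast
    rw [hbrick (by omega)]
    exact ⟨fun _ => rfl, fun _ => by rw [zero_sub]⟩

/-- Moves from the position of a variable to that of the next one. -/
def advanceCmd : Cmd :=
  Cmd.ite (Expr.var regN - Expr.var regI)
    (Cmd.ite (Expr.var regT - Expr.var regJ - Expr.const 1)
      (regJ ::= Expr.var regJ + Expr.const 1)
      (regJ ::= Expr.const 0 ;; regI ::= Expr.var regI + Expr.const 1))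
    (regJ ::= Expr.var regJ + Expr.const 1)

/-- Quotient and remainder by `t` are maintained incrementally. After the last brick, reaching row
`n` switches to counting slack variables, where the column is no longer wrapped. -/
theorem run_advanceCmd {s : State} {t n k : ℕ} (ht : 0 < t) (hT : s.var regT = t)
    (hN : s.var regN = n) (hi : s.var regI = rowOf n t k) (hj : s.var regJ = colOf n t k) :
    Run E advanceCmd s 40 fun s' => s'.var regI = rowOf n t (k + 1) ∧
      s'.var regJ = colOf n t (k + 1) := by
  refine (Run.straight ?_).le (by decide : advanceCmd.bound ≤ 40)
  simp only [advanceCmd, Cmd.wp, Expr.eval_var, Expr.eval_add, Expr.eval_sub, Expr.eval_const,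
    State.setVar_var, hT, hN, hi, hj]
  norm_num only [if_true, if_false]
  have hlt := Nat.mod_lt k ht
  have hdm := Nat.div_add_mod k t
  by_cases hk : k < n * t
  · have hdiv : k / t < n := Nat.div_lt_of_lt_mul (by rwa [mul_comm])
    rw [rowOf, colOf, if_pos hk, if_pos hk]
    refine ⟨fun _ => ⟨fun h => ?_, fun h => ?_⟩, fun h => by omega⟩
    · have hk1 : k + 1 < n * t := by
        calc k + 1 = t * (k / t) + (k % t + 1) := by omega
          _ < t * (k / t) + t := by omega
          _ = t * (k / t + 1) := by ring
          _ ≤ t * n := Nat.mul_le_mul_left _ hdiv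
          _ = n * t := mul_comm _ _
      obtain ⟨h1, h2⟩ : (k + 1) / t = k / t ∧ (k + 1) % t = k % t + 1 :=
        (Nat.div_mod_unique ht).2 ⟨by omega, by omega⟩
      rw [rowOf, colOf, if_pos hk1, if_pos hk1, h1, h2]
      simp
    · have hke : k % t + 1 = t := by omega
      have e : k + 1 = t * (k / t + 1) := by rw [mul_add]; omega
      by_cases hk1 : k + 1 < n * t
      · obtain ⟨h1, h2⟩ : (k + 1) / t = k / t + 1 ∧ (k + 1) % t = 0 :=
          (Nat.div_mod_unique ht).2 ⟨by omega, ht⟩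
        rw [rowOf, colOf, if_pos hk1, if_pos hk1, h1, h2]
        simp
      · have hkn : k + 1 = n * t := by omega
        have : k / t + 1 = n := by
          have : t * (k / t + 1) = t * n := by rw [← e, hkn, mul_comm]
          exact Nat.eq_of_mul_eq_mul_left ht this
        rw [rowOf, colOf, if_neg hk1, if_neg hk1]
        constructor
        · exact_mod_cast this
        · simp [hkn]
  · rw [rowOf, colOf, if_neg hk, if_neg hk, rowOf, colOf, if_neg (by omega), if_neg (by omega)]
    exact ⟨fun h => by omega, fun _ => ⟨rfl, by omega⟩⟩

def tableCmd : Cmd :=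
  regI ::= Expr.const 0 ;; regJ ::= Expr.const 0 ;;
  forUp regK (Expr.var regM) (
    Cmd.store arrRow (Expr.var regK) (Expr.const 0) (Expr.var regI) ;;
    Cmd.store arrCol (Expr.var regK) (Expr.const 0) (Expr.var regJ) ;;
    weightCmd ;; shiftCmd ;; limitCmd ;; advanceCmd)

/-- The tables needed by the dynamic program. -/
structure Tables (m n t G : ℕ) (S : ℕ → ℕ) (w : ℕ → ℤ) (s : State) : Prop where
  indexed : Indexed n t m s
  low : ∀ k < m, s.arr arrLow k 0 = -((G + 1) * S (k + 1))
  count : ∀ k < m, s.arr arrCount k 0 = ((G + 1) * (2 * S (k + 1) + 1) : ℕ)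
  shift : ∀ k < m, ∀ h : ℤ, |h| ≤ G → s.arr arrShift k h = stateShift G w k h

theorem run_tableCmd {s : State} {r t n G V W Δ : ℕ} {S : ℕ → ℕ} (hs : Params r t n G V W s)
    (hp : Powers r G V s) (ht : 0 < t) (hn : 0 < n)
    (hD : ∀ p < r, ∀ j < t, |s.arr arrD p j| ≤ Δ)
    (hS : ∀ k, (S k : ℤ) = layerBound n t V r k) :
    Run E tableCmd s ((n * t + r + 1) * ((r + 1) * ((Δ + 1) * 70) + (G + 2) * 40 + 160))
      (Tables (n * t + r) n t G S (weight n t V (tableCol (r := r) n t (s.arr arrD)))) := by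
  set m := n * t + r with hm
  set w := weight n t V (tableCol (r := r) n t (s.arr arrD)) with hw
  set Tb := 4 + (4 + ((r + 1) * ((Δ + 1) * 70) + ((G + 2) * 40 + (80 + 40)))) with hTb
  refine Run.le (T₁ := 2 + (2 + (m + 1) * (Tb + 1 + 10))) ?_ (by rw [hTb]; nlinarith)
  refine Run.seq (Run.straight ?_)
  refine Run.seq (Run.straight ?_)
  simp only [Cmd.wp, Expr.eval_const]
  set s₀ := (s.setVar regI 0).setVar regJ 0 with hs₀
  have hs₀p : Params r t n G V W s₀ := ⟨hs.1, hs.2, hs.3, hs.4, hs.5, hs.6, hs.7, hs.8, hs.9⟩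
  have hp₀ : Powers r G V s₀ := ⟨hp.1, hp.2, hp.3⟩
  refine (Run.forUp (N := m) (T := Tb) (fun i s' => s'.var regI = rowOf n t i ∧
    s'.var regJ = colOf n t i ∧ Tables i n t G S w s') (by decide) (fun s' ha => ?_) ?_ ?_).mono
      le_rfl fun s' _ h => h.2.2
  · have := hs₀p.of_agree ha (by decide)
    rw [Expr.eval_var, this.m_eq]
  · have hnt : 0 < n * t := Nat.mul_pos hn ht
    refine ⟨by simp [hs₀, rowOf, hn, ht], by simp [hs₀, colOf], ⟨?_, ?_, ?_, ?_⟩⟩ <;> intro k hk <;> omega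
  · rintro k hk s₁ ha hkv ⟨p1, p2, ⟨q1, q2, q3, q4⟩⟩
    have hp₁ := hs₀p.of_agree ha (by decide)
    have hpw₁ : Powers r G V s₁ := by
      refine ⟨?_, ?_, ?_⟩
      · rw [ha.arr arrPow (by decide)]; exact hp₀.pow
      · rw [ha.var regLowBrick (by decide)]; exact hp₀.brick
      · rw [ha.var regLowFull (by decide)]; exact hp₀.full
    have hD₁ : s₁.arr arrD = s.arr arrD := ha.arr arrD (by decide)
    refine Run.seq (Run.straight ?_)
    refine Run.seq (Run.straight ?_)
    simp only [Cmd.wp, Expr.eval_const, Expr.eval_var, State.setArr_var, hkv]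
    set s₂ := (s₁.setArr arrRow k 0 (s₁.var regI)).setArr arrCol k 0 (s₁.var regJ) with hs₂
    have hp₂ : Params r t n G V W s₂ :=
      ⟨hp₁.1, hp₁.2, hp₁.3, hp₁.4, hp₁.5, hp₁.6, hp₁.7, hp₁.8, hp₁.9⟩
    have hpw₂ : Powers r G V s₂ := ⟨hpw₁.1, hpw₁.2, hpw₁.3⟩
    have hD₂ : s₂.arr arrD = s.arr arrD := by
      rw [hs₂, State.setArr_arr_ne _ (by decide), State.setArr_arr_ne _ (by decide), hD₁]
    refine Run.bind (run_weightCmd hp₂ hpw₂ ht (k := k) hkv p2 hk (by rw [hD₂]; exact hD)) ?_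
    intro s₃ a₃ h₃
    have hp₃ := hp₂.of_agree a₃ (by decide)
    have k₃ : s₃.var regK = k := (a₃.var regK (by decide)).trans hkv
    refine Run.bind (run_shiftCmd hp₃.G_eq k₃) ?_
    intro s₄ a₄ h₄
    have hp₄ := hp₃.of_agree a₄ (by decide)
    have k₄ : s₄.var regK = k := (a₄.var regK (by decide)).trans k₃
    have j₄ : s₄.var regJ = colOf n t k :=
      (a₄.var regJ (by decide)).trans ((a₃.var regJ (by decide)).trans p2)
    have i₄ : s₄.var regI = rowOf n t k :=
      (a₄.var regI (by decide)).trans ((a₃.var regI (by decide)).trans p1)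
    have hpw₄ : Powers r G V s₄ := by
      refine ⟨?_, ?_, ?_⟩
      · rw [a₄.arr arrPow (by decide), a₃.arr arrPow (by decide)]; exact hpw₂.pow
      · rw [a₄.var regLowBrick (by decide), a₃.var regLowBrick (by decide)]; exact hpw₂.brick
      · rw [a₄.var regLowFull (by decide), a₃.var regLowFull (by decide)]; exact hpw₂.full
    refine Run.bind (run_limitCmd hp₄ hpw₄ ht k₄ j₄ hS) ?_
    rintro s₅ a₅ ⟨c₅, l₅⟩
    have hp₅ := hp₄.of_agree a₅ (by decide)
    refine (run_advanceCmd (k := k) ht hp₅.t_eq hp₅.n_eq ((a₅.var regI (by decide)).trans i₄)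
      ((a₅.var regJ (by decide)).trans j₄)).mono le_rfl ?_
    rintro s₆ a₆ ⟨i₆, j₆⟩
    have row : s₆.arr arrRow = s₂.arr arrRow := by
      rw [a₆.arr arrRow (by decide), a₅.arr arrRow (by decide), a₄.arr arrRow (by decide),
        a₃.arr arrRow (by decide)]
    have col : s₆.arr arrCol = s₂.arr arrCol := by
      rw [a₆.arr arrCol (by decide), a₅.arr arrCol (by decide), a₄.arr arrCol (by decide),
        a₃.arr arrCol (by decide)]
    have shift : s₆.arr arrShift = s₄.arr arrShift := by
      rw [a₆.arr arrShift (by decide), a₅.arr arrShift (by decide)]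
    have shift₃ : s₃.arr arrShift = s₁.arr arrShift := by
      rw [a₃.arr arrShift (by decide), hs₂, State.setArr_arr_ne _ (by decide),
        State.setArr_arr_ne _ (by decide)]
    have count₄ : s₄.arr arrCount = s₁.arr arrCount := by
      rw [a₄.arr arrCount (by decide), a₃.arr arrCount (by decide), hs₂,
        State.setArr_arr_ne _ (by decide), State.setArr_arr_ne _ (by decide)]
    have low₄ : s₄.arr arrLow = s₁.arr arrLow := by
      rw [a₄.arr arrLow (by decide), a₃.arr arrLow (by decide), hs₂,
        State.setArr_arr_ne _ (by decide), State.setArr_arr_ne _ (by decide)]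
    refine ⟨by simpa using i₆, by simpa using j₆, ⟨fun k' hk' => ?_, fun k' hk' => ?_,
      fun k' hk' => ?_, fun k' hk' h hh => ?_⟩⟩
    · simp only [State.setVar_arr, row, col]
      rw [hs₂, State.setArr_arr_ne (a' := arrRow) _ (by decide), State.setArr_arr_self,
        State.setArr_arr_self, State.setArr_arr_ne (a' := arrCol) _ (by decide)]
      by_cases h : k' = k
      · subst h; simp [p1, p2]
      · rw [if_neg (by omega), if_neg (by omega)]
        exact q1 k' (by omega)
    · simp only [State.setVar_arr]
      rw [a₆.arr arrLow (by decide), l₅, low₄]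
      by_cases h : k' = k
      · subst h; simp
      · rw [if_neg (by omega)]
        exact q2 k' (by omega)
    · simp only [State.setVar_arr]
      rw [a₆.arr arrCount (by decide), c₅, count₄]
      by_cases h : k' = k
      · subst h; simp
      · rw [if_neg (by omega)]
        exact q3 k' (by omega)
    · simp only [State.setVar_arr, shift]
      rw [h₄, shift₃]
      by_cases hkk : k' = k
      · subst hkk
        rw [if_pos ⟨rfl, hh⟩, h₃, hD₂, stateShift, hw]
        ring
      · rw [if_neg (by omega)]
        exact q4 k' (by omega) h hh

/-- Initialises the first layer of the dynamic program. -/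
def baseCmd : Cmd :=
  forUp regH (Expr.var regG + Expr.const 1)
    (Cmd.store arrReach (Expr.const 0) (Expr.var regH) (Expr.const 1))

/-- The indices `0, …, G` of layer zero are the packed sum zero with every possible budget. Marking
all of them makes the budget an upper bound for the norm rather than its exact value. -/
theorem run_baseCmd {s : State} {n' t' m G : ℕ} {S : ℕ → ℕ} {w : ℕ → ℤ} (hG : s.var regG = G)
    (hM : s.var regM = m) (hs : Tables m n' t' G S w s) (hr : s.arr arrReach = 0)
    (hv : s.arr arrVal = 0) :
    Run E baseCmd s ((G + 2) * 20) (DPReady m G S w) := by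
  refine Run.le (T₁ := (G + 1 + 1) * (4 + 3 + 10)) ?_ (by omega)
  refine (Run.forUp (N := G + 1) (T := 4) (fun i s' => ∀ k τ, s'.arr arrReach k τ =
    if k = 0 ∧ 0 ≤ τ ∧ τ < i then 1 else 0) (by decide)
    (fun s' ha => ?_) (fun k τ => ?_) ?_).mono le_rfl ?_
  · simp [ha.var regG (by decide), hG]
  · rw [if_neg (by omega)]
    simp [hr]
  · intro i hi s' ha hiv hP
    refine (Run.straight ?_).le (by decide)
    simp only [Cmd.wp, Expr.eval_const, Expr.eval_var, hiv, State.setVar_arr,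
      State.setArr_arr_self]
    intro k τ
    rw [hP]
    by_cases h : k = 0 ∧ τ = i
    · rw [if_pos h, if_pos (by omega)]
    · rw [if_neg h]
      congr 1
      apply propext
      omega
  · intro s' ha h
    refine ⟨(ha.var regM (by decide)).trans hM, (ha.var regG (by decide)).trans hG, ?_, ?_, ?_,
      fun k τ => ?_, fun τ => ?_, fun τ => ?_, fun k hk σ l hl hlG h1 => ?_⟩
    · rw [ha.arr arrLow (by decide)]; exact hs.low
    · rw [ha.arr arrCount (by decide)]; exact hs.count
    · rw [ha.arr arrShift (by decide)]; exact hs.shift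
    · rw [h]; split_ifs <;> simp
    · rw [h]
      push_cast
      split_ifs with h'
      · exact ⟨fun _ => by omega, fun _ => rfl⟩
      · exact ⟨fun h0 => absurd h0 (by decide), fun h0 => absurd ⟨trivial, h0.1, by omega⟩ h'⟩
    · rw [ha.arr arrVal (by decide), hv]; rfl
    · rw [h] at h1
      split_ifs at h1 with h'
      swap
      · exact absurd h1 (by decide)
      obtain ⟨-, h2, h3⟩ := h'
      push_cast at h3
      have : σ = 0 := by
        have h4 : -1 < σ := by nlinarith
        have h5 : σ < 1 := by nlinarith
        omega
      simp [this]

/-! ### Rounding the solution of the relaxation -/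

theorem sum_update_range {t : ℕ} {f g : ℕ → ℤ} {j : ℕ} (hj : j < t) (h : ∀ i < t, i ≠ j → g i = f i) :
    ∑ i ∈ range t, g i = ∑ i ∈ range t, f i + (g j - f j) := by
  have : ∑ i ∈ range t, (g i - f i) = g j - f j :=
    Finset.sum_eq_single_of_mem j (mem_range.2 hj) fun i hi hij => by
      rw [h i (mem_range.1 hi) hij, sub_self]
  rw [Finset.sum_sub_distrib] at this
  linarith

/-- Start from the floors and raise fractional entries to their ceilings until the brick sum is met.
Each entry stays within one of the relaxation and, the bounds being integral, within the box. -/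
def roundRow : Cmd :=
  regAcc ::= Expr.get arrBrick (Expr.var regI) (Expr.const 0) ;;
  forUp regJ (Expr.var regT) (
    Cmd.store arrX (Expr.var regI) (Expr.var regJ) (Expr.floor (Expr.var regI) (Expr.var regJ)) ;;
    regAcc ::= Expr.var regAcc - Expr.floor (Expr.var regI) (Expr.var regJ)) ;;
  forUp regJ (Expr.var regT) (
    Cmd.ite (Expr.var regAcc)
      (Cmd.ite (Expr.ceil (Expr.var regI) (Expr.var regJ) -
          Expr.floor (Expr.var regI) (Expr.var regJ))
        (Cmd.store arrX (Expr.var regI) (Expr.var regJ)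
            (Expr.ceil (Expr.var regI) (Expr.var regJ)) ;;
          regAcc ::= Expr.var regAcc - Expr.const 1)
        Cmd.skip)
      Cmd.skip)

theorem run_roundRow {s : State} {t' i : ℕ} (hT : s.var regT = t') (hi : s.var regI = i)
    (hsum : ∑ j ∈ range t', s.real i j = s.arr arrBrick i 0) :
    Run E roundRow s ((t' + 1) * 80) fun s' =>
      (∀ j < t', s'.arr arrX i j = ⌊s.real i j⌋ ∨ s'.arr arrX i j = ⌈s.real i j⌉) ∧
      ∑ j ∈ range t', s'.arr arrX i j = s.arr arrBrick i 0 ∧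
      ∀ i' : ℤ, i' ≠ i → s'.arr arrX i' = s.arr arrX i' := by
  refine Run.le (T₁ := 4 + ((t' + 1) * (14 + 1 + 10) + (t' + 1) * (30 + 1 + 10))) ?_ (by omega)
  refine Run.seq (Run.straight ?_)
  simp only [Cmd.wp, Expr.eval_get, Expr.eval_var, Expr.eval_const, hi]
  refine Run.bind (Run.forUp (N := t') (T := 14) (fun J s' =>
    s'.var regAcc = s.arr arrBrick i 0 - ∑ j ∈ range J, ⌊s.real i j⌋ ∧
    (∀ j < J, s'.arr arrX i j = ⌊s.real i j⌋) ∧ ∀ i' : ℤ, i' ≠ i → s'.arr arrX i' = s.arr arrX i')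
    (by decide) (fun s' ha => ?_) (by simp) ?_) ?_
  · have := ha.var regT (by decide)
    simp at this
    simp [this, hT]
  · rintro J hJ s' ha hjv ⟨p1, p2, p3⟩
    have e1 := ha.var regI (by decide)
    have e2 := ha.real (by decide)
    simp [hi] at e1 e2
    refine (Run.straight ?_).le (by decide)
    simp only [Cmd.wp, Expr.eval_var, Expr.eval_sub, Expr.eval_floor, State.setArr_var,
      State.setArr_real, State.setVar_var, State.setVar_arr, State.setArr_arr_self, e1, e2, hjv, p1]
    norm_num only [if_true, if_false]
    refine ⟨by rw [Finset.sum_range_succ]; ring, fun j hj => ?_, fun i' hi' => ?_⟩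
    · by_cases h : j = J
      · simp [h]
      · rw [if_neg (by omega), p2 j (by omega)]
    · rw [← p3 i' hi']
      funext j
      simp [hi']
  · rintro s₁ a₁ ⟨p1, p2, p3⟩
    have e1 := a₁.var regI (by decide)
    have e2 := a₁.real (by decide)
    have e3 := a₁.var regT (by decide)
    simp [hi, hT] at e1 e2 e3
    refine (Run.forUp (N := t') (T := 30) (fun J s' => 0 ≤ s'.var regAcc ∧
      (∀ j < t', s'.arr arrX i j = ⌊s.real i j⌋ ∨ s'.arr arrX i j = ⌈s.real i j⌉) ∧
      ∑ j ∈ range t', s'.arr arrX i j + s'.var regAcc = s.arr arrBrick i 0 ∧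
      (s'.var regAcc = 0 ∨ ∀ j < J, s'.arr arrX i j = ⌈s.real i j⌉) ∧
      (∀ j < t', J ≤ j → s'.arr arrX i j = ⌊s.real i j⌋) ∧
      ∀ i' : ℤ, i' ≠ i → s'.arr arrX i' = s.arr arrX i') (by decide) (fun s' ha => ?_) ?_ ?_).mono
      le_rfl ?_
    · simp [ha.var regT (by decide), e3]
    · simp only [State.setVar_var, State.setVar_arr]
      norm_num only [if_false]
      rw [p1]
      refine ⟨?_, fun j hj => Or.inl (p2 j hj), ?_, Or.inr (by simp), fun j hj _ => p2 j hj, p3⟩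
      -- The deficit left by the floors is nonnegative.
      · have : ((∑ j ∈ range t', ⌊s.real i j⌋ : ℤ) : ℝ) ≤ s.arr arrBrick i 0 := by
          rw [← hsum]; push_cast
          exact Finset.sum_le_sum fun j _ => Int.floor_le _
        have : ∑ j ∈ range t', ⌊s.real i j⌋ ≤ s.arr arrBrick i 0 := by exact_mod_cast this
        linarith
      · rw [Finset.sum_congr rfl fun j hj => p2 j (mem_range.1 hj)]; ring
    · rintro J hJ s' ha hjv ⟨q1, q2, q3, q4, q5, q6⟩
      have f1 := ha.var regI (by decide)
      have f2 := ha.real (by decide)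
      rw [e1] at f1
      rw [e2] at f2
      refine (Run.straight ?_).le (by decide)
      simp only [Cmd.wp, Expr.eval_var, Expr.eval_sub, Expr.eval_floor, Expr.eval_ceil,
        Expr.eval_const, State.setArr_var, State.setVar_var, State.setVar_arr,
        State.setArr_arr_self, f1, f2, hjv]
      norm_num only [if_true, if_false]
      have hJf := q5 J hJ le_rfl
      refine ⟨fun h1 => ⟨fun h2 => ?_, fun h2 => ?_⟩, fun h1 => ?_⟩
      · have hc : ⌈s.real i J⌉ = ⌊s.real i J⌋ + 1 := by
          have := Int.ceil_le_floor_add_one (s.real i J); omega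
        refine ⟨by omega, fun j hj => ?_, ?_, Or.inr fun j hj => ?_, fun j hj hJj => ?_,
          fun i' hi' => ?_⟩
        · by_cases h : j = J
          · simp [h]
          · rw [if_neg (by omega)]; exact q2 j hj
        · rw [sum_update_range hJ (f := fun j => s'.arr arrX i j) (fun j _ hj => if_neg (by omega))]
          simp only [true_and, if_true]
          rw [hJf]
          omega
        · by_cases h : j = J
          · simp [h]
          · rw [if_neg (by omega)]
            exact (q4.resolve_left h1.ne') j (by omega)
        · rw [if_neg (by omega)]; exact q5 j hj (by omega)
        · rw [← q6 i' hi']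
          funext j
          simp [hi']
      · have hc : ⌈s.real i J⌉ = ⌊s.real i J⌋ := by
          have := Int.floor_le_ceil (s.real i J); omega
        refine ⟨q1, q2, q3, Or.inr fun j hj => ?_, fun j hj hJj => q5 j hj (by omega), q6⟩
        by_cases h : j = J
        · rw [h, hJf, hc]
        · exact (q4.resolve_left h1.ne') j (by omega)
      · exact ⟨q1, q2, q3, Or.inl (by omega), fun j hj hJj => q5 j hj (by omega), q6⟩
    · rintro s' - ⟨q1, q2, q3, q4, -, q6⟩
      refine ⟨q2, ?_, q6⟩
      rcases q4 with h0 | h0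
      · rw [← q3, h0, add_zero]
      -- If every entry was raised, the sum of the ceilings is at least the required brick sum, so
      -- the deficit has vanished in this case too.
      · have h2 : ((s.arr arrBrick i 0 : ℤ) : ℝ) ≤ ((∑ j ∈ range t', s'.arr arrX i j : ℤ) : ℝ) := by
          rw [← hsum]; push_cast
          exact Finset.sum_le_sum fun j hj => by
            rw [h0 j (mem_range.1 hj)]; exact Int.le_ceil _
        have h3 : s.arr arrBrick i 0 ≤ ∑ j ∈ range t', s'.arr arrX i j := by exact_mod_cast h2
        omega

def roundCmd : Cmd := forUp regI (Expr.var regN) roundRow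

theorem run_roundCmd {s : State} {t' n' : ℕ} (hT : s.var regT = t') (hN : s.var regN = n')
    (hsum : ∀ i < n', ∑ j ∈ range t', s.real i j = s.arr arrBrick i 0) :
    Run E roundCmd s ((n' + 1) * ((t' + 1) * 80 + 11)) fun s' =>
      (∀ i < n', ∀ j < t', s'.arr arrX i j = ⌊s.real i j⌋ ∨ s'.arr arrX i j = ⌈s.real i j⌉) ∧
      ∀ i < n', ∑ j ∈ range t', s'.arr arrX i j = s.arr arrBrick i 0 := by
  refine (Run.forUp (N := n') (T := (t' + 1) * 80) (fun I s' =>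
    (∀ i < I, ∀ j < t', s'.arr arrX i j = ⌊s.real i j⌋ ∨ s'.arr arrX i j = ⌈s.real i j⌉) ∧
      ∀ i < I, ∑ j ∈ range t', s'.arr arrX i j = s.arr arrBrick i 0) (by decide)
      (fun s' ha => ?_) (by simp) ?_).mono le_rfl fun _ _ h => h
  · simp [ha.var regN (by decide), hN]
  · rintro I hI s' ha hiv ⟨p1, p2⟩
    have e1 := ha.var regT (by decide)
    have e2 := ha.real (by decide)
    have e3 := ha.arr arrBrick (by decide)
    have := run_roundRow (E := E) (s := s') (t' := t') (i := I) (e1.trans hT) hiv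
      (by rw [e2, e3]; exact hsum I hI)
    rw [e2, e3] at this
    refine this.mono le_rfl ?_
    rintro s'' - ⟨q1, q2, q3⟩
    simp only [State.setVar_arr]
    refine ⟨fun i hi => ?_, fun i hi => ?_⟩
    · by_cases h : i = I
      · subst h; exact q1
      · rw [q3 i (by omega)]; exact p1 i (by omega)
    · by_cases h : i = I
      · subst h; exact q2
      · rw [q3 i (by omega)]; exact p2 i (by omega)

/-! ### The box around the rounded solution -/

/-- Intersecting the given box with a cube of radius `W` makes the number of augmentation steps
independent of the sizes of `l` and `u`. -/
def boundsCmd : Cmd :=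
  forUp regK (Expr.var regNT) (
    regI ::= Expr.get arrRow (Expr.var regK) (Expr.const 0) ;;
    regJ ::= Expr.get arrCol (Expr.var regK) (Expr.const 0) ;;
    regX ::= Expr.get arrX (Expr.var regI) (Expr.var regJ) - Expr.var regW ;;
    regY ::= Expr.get arrL (Expr.var regI) (Expr.var regJ) ;;
    Cmd.ite (Expr.var regX - Expr.var regY)
      (Cmd.store arrLo (Expr.var regI) (Expr.var regJ) (Expr.var regX))
      (Cmd.store arrLo (Expr.var regI) (Expr.var regJ) (Expr.var regY)) ;;
    regX ::= Expr.get arrX (Expr.var regI) (Expr.var regJ) + Expr.var regW ;;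
    regY ::= Expr.get arrU (Expr.var regI) (Expr.var regJ) ;;
    Cmd.ite (Expr.var regX - Expr.var regY)
      (Cmd.store arrUp (Expr.var regI) (Expr.var regJ) (Expr.var regY))
      (Cmd.store arrUp (Expr.var regI) (Expr.var regJ) (Expr.var regX)))

theorem run_boundsCmd {s : State} {n' t' m nt W : ℕ} (hidx : Indexed n' t' m s) (hnt : nt ≤ m)
    (hNT : s.var regNT = nt) (hW : s.var regW = W) :
    Run E boundsCmd s ((nt + 1) * 100) fun s' =>
      (∀ k < nt, entry n' t' (s'.arr arrLo) k =
        max (entry n' t' (s.arr arrL) k) (entry n' t' (s.arr arrX) k - W)) ∧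
      (∀ k < nt, entry n' t' (s'.arr arrUp) k =
        min (entry n' t' (s.arr arrU) k) (entry n' t' (s.arr arrX) k + W)) := by
  refine Run.le (T₁ := (nt + 1) * (80 + 1 + 10)) ?_ (by omega)
  refine (Run.forUp (N := nt) (T := 80) (fun K s' =>
      (∀ k < K, entry n' t' (s'.arr arrLo) k =
        max (entry n' t' (s.arr arrL) k) (entry n' t' (s.arr arrX) k - W)) ∧
      (∀ k < K, entry n' t' (s'.arr arrUp) k =
        min (entry n' t' (s.arr arrU) k) (entry n' t' (s.arr arrX) k + W))) (by decide)
      (fun s' ha => ?_) (by simp) ?_).mono le_rfl fun _ _ h => h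
  · simp [ha.var regNT (by decide), hNT]
  · rintro K hK s' ha hkv ⟨p1, p2⟩
    have a1 := ha.arr arrRow (by decide)
    have a2 := ha.arr arrCol (by decide)
    have a3 := ha.arr arrX (by decide)
    have a4 := ha.arr arrL (by decide)
    have a5 := ha.arr arrU (by decide)
    have a6 := ha.var regW (by decide)
    have hi := hidx K (by omega)
    have hset : ∀ (A B : ℤ → ℤ → ℤ) (F : ℕ → ℤ) (z : ℤ),
        (∀ k < K, entry n' t' A k = F k) → z = F K →
        (∀ i j, B i j = if i = rowOf n' t' K ∧ j = colOf n' t' K then z else A i j) →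
        ∀ k < K + 1, entry n' t' B k = F k := by
      intro A B F z hA hz hB k hk
      rw [entry, hB]
      by_cases h : k = K
      · subst h; rw [if_pos ⟨rfl, rfl⟩, hz]
      · rw [if_neg fun hh => h (position_injective hh.1 hh.2), ← hA k (by omega), entry]
    have hne : ∀ (s₁ : State) (i j z : ℤ), (s₁.setArr arrLo i j z).arr arrX = s₁.arr arrX :=
      fun s₁ i j z => State.setArr_arr_ne s₁ (by decide) i j z
    have hne2 : ∀ (s₁ : State) (i j z : ℤ), (s₁.setArr arrLo i j z).arr arrU = s₁.arr arrU :=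
      fun s₁ i j z => State.setArr_arr_ne s₁ (by decide) i j z
    refine (Run.straight ?_).le (by decide)
    simp only [Cmd.wp, Expr.eval_var, Expr.eval_sub, Expr.eval_add, Expr.eval_get, Expr.eval_const,
      State.setArr_var, State.setVar_var, State.setVar_arr, hne, hne2, hkv, a1, a2, a3, a4,
      a5, a6, hW, hi.1]
    norm_num only [if_true, if_false]
    simp only [hi.2]
    have hx : s.arr arrX (rowOf n' t' K) (colOf n' t' K) = entry n' t' (s.arr arrX) K := rfl
    have hl : s.arr arrL (rowOf n' t' K) (colOf n' t' K) = entry n' t' (s.arr arrL) K := rfl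
    have hu : s.arr arrU (rowOf n' t' K) (colOf n' t' K) = entry n' t' (s.arr arrU) K := rfl
    rw [hx, hl, hu]
    have fin : ∀ s₃ : State,
        (∀ i j, s₃.arr arrLo i j = if i = rowOf n' t' K ∧ j = colOf n' t' K then
          max (entry n' t' (s.arr arrL) K) (entry n' t' (s.arr arrX) K - W) else s'.arr arrLo i j) →
        (∀ i j, s₃.arr arrUp i j = if i = rowOf n' t' K ∧ j = colOf n' t' K then
          min (entry n' t' (s.arr arrU) K) (entry n' t' (s.arr arrX) K + W) else s'.arr arrUp i j) →
        (∀ k < K + 1, entry n' t' (s₃.arr arrLo) k =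
          max (entry n' t' (s.arr arrL) k) (entry n' t' (s.arr arrX) k - W)) ∧
        (∀ k < K + 1, entry n' t' (s₃.arr arrUp) k =
          min (entry n' t' (s.arr arrU) k) (entry n' t' (s.arr arrX) k + W)) :=
      fun s₃ h1 h2 => ⟨hset _ _ _ _ p1 rfl h1, hset _ _ _ _ p2 rfl h2⟩
    refine ⟨fun h1 => ⟨fun h2 => fin _ (fun i j => ?_) (fun i j => ?_),
      fun h2 => fin _ (fun i j => ?_) (fun i j => ?_)⟩,
      fun h1 => ⟨fun h2 => fin _ (fun i j => ?_) (fun i j => ?_),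
      fun h2 => fin _ (fun i j => ?_) (fun i j => ?_)⟩⟩
    all_goals
      simp only [State.setVar_arr, State.setArr_arr]
      norm_num only [true_and, false_and, if_false]
      congr 1
      omega

/-! ### Slack variables -/

/-- Adds to `regAcc` the negative of the left hand side of the upper constraint `regP`. -/
def residualCmd : Cmd :=
  forUp regK (Expr.var regNT) (
    regI ::= Expr.get arrRow (Expr.var regK) (Expr.const 0) ;;
    regJ ::= Expr.get arrCol (Expr.var regK) (Expr.const 0) ;;
    regX ::= Expr.get arrX (Expr.var regI) (Expr.var regJ) ;;
    regD ::= Expr.const 0 - Expr.get arrD (Expr.var regP) (Expr.var regJ) ;;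
    addMul)

theorem run_residualCmd {s : State} {n' t' m p Δ : ℕ} (ht : 0 < t') (hidx : Indexed n' t' m s)
    (hnt : n' * t' ≤ m) (hNT : s.var regNT = (n' * t' : ℕ)) (hp : s.var regP = p)
    (hD : ∀ j < t', |s.arr arrD p j| ≤ Δ) :
    Run E residualCmd s ((n' * t' + 1) * ((Δ + 1) * 80)) fun s' =>
      s'.var regAcc = s.var regAcc - ∑ k ∈ range (n' * t'),
        entry n' t' (s.arr arrX) k * s.arr arrD p (k % t' : ℕ) := by
  refine Run.le (T₁ := (n' * t' + 1) * ((4 + (4 + (4 + (6 + (Δ + 1) * 36)))) + 1 + 10)) ?_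
    (Nat.mul_le_mul_left _ (by omega))
  refine (Run.forUp (N := n' * t') (T := 4 + (4 + (4 + (6 + (Δ + 1) * 36)))) (fun K s' =>
    s'.var regAcc = s.var regAcc - ∑ k ∈ range K,
        entry n' t' (s.arr arrX) k * s.arr arrD p (k % t' : ℕ)) (by decide)
      (fun s' ha => ?_) (by simp) ?_).mono le_rfl fun _ _ h => h
  · simp only [Expr.eval_var, ha.var regNT (by decide), hNT]
  · intro K hK s' ha hkv hP
    have a1 := ha.arr arrRow (by decide)
    have a2 := ha.arr arrCol (by decide)
    have a3 := ha.arr arrX (by decide)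
    have a4 := ha.arr arrD (by decide)
    have a5 := ha.var regP (by decide)
    have hi := hidx K (by omega)
    refine Run.seq (Run.straight ?_)
    refine Run.seq (Run.straight ?_)
    refine Run.seq (Run.straight ?_)
    refine Run.seq (Run.straight ?_)
    simp only [Cmd.wp, Expr.eval_var, Expr.eval_sub, Expr.eval_get, Expr.eval_const,
      State.setVar_var, State.setVar_arr, hkv, a1, a2, a3, a4, a5, hp, hi.1]
    norm_num only [if_true, if_false]
    simp only [hi.2]
    have hcol : colOf n' t' K = (K % t' : ℕ) := by rw [colOf, if_pos hK]
    generalize hs₁ : State.setVar _ regD _ = s₁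
    have hd : s₁.var regD = - s.arr arrD p (K % t' : ℕ) := by
      rw [← hs₁, hcol]; simp
    have hx : s₁.var regX = entry n' t' (s.arr arrX) K := by
      rw [← hs₁]; simp [entry]
    have hacc : s₁.var regAcc = s'.var regAcc := by
      rw [← hs₁]; simp
    refine (run_addMul s₁).mono ?_ fun s₂ _ h₂ => ?_
    · have := hD (K % t') (Nat.mod_lt _ ht)
      rw [hd, Int.natAbs_neg]
      have : (s.arr arrD p (K % t' : ℕ)).natAbs ≤ Δ := by
        rw [Int.abs_eq_natAbs] at this
        exact_mod_cast this
      exact Nat.mul_le_mul_right _ (by omega)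
    · rw [hd, hx, hacc, hP] at h₂
      rw [h₂, Finset.sum_range_succ]; ring

/-- The interval of a slack variable is the segment between zero and the violation. It contains the
starting value and the target zero, and it is no longer than the violation itself. -/
def slackCmd : Cmd :=
  forUp regP (Expr.var regR) (
    regAcc ::= Expr.get arrTop (Expr.var regP) (Expr.const 0) ;;
    residualCmd ;;
    Cmd.store arrX (Expr.var regN) (Expr.var regP) (Expr.var regAcc) ;;
    Cmd.ite (Expr.var regAcc)
      (Cmd.store arrLo (Expr.var regN) (Expr.var regP) (Expr.const 0) ;;
        Cmd.store arrUp (Expr.var regN) (Expr.var regP) (Expr.var regAcc))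
      (Cmd.store arrLo (Expr.var regN) (Expr.var regP) (Expr.var regAcc) ;;
        Cmd.store arrUp (Expr.var regN) (Expr.var regP) (Expr.const 0)))

/-- The violation of the upper constraint `p`. -/
def residual (n t : ℕ) (s : State) (p : ℕ) : ℤ :=
  s.arr arrTop p 0 - ∑ k ∈ range (n * t), entry n t (s.arr arrX) k * s.arr arrD p (k % t : ℕ)

theorem rowOf_lt {n t k : ℕ} (hk : k < n * t) : rowOf n t k < n := by
  rw [rowOf, if_pos hk]
  exact_mod_cast Nat.div_lt_of_lt_mul (by rwa [mul_comm])

theorem run_slackCmd {s : State} {r n' t' G V W Δ m : ℕ} (hs : Params r t' n' G V W s) (ht : 0 < t')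
    (hidx : Indexed n' t' m s) (hnt : n' * t' ≤ m)
    (hD : ∀ p < r, ∀ j < t', |s.arr arrD p j| ≤ Δ) :
    Run E slackCmd s ((r + 1) * ((n' * t' + 1) * ((Δ + 1) * 80) + 60)) fun s' =>
      (∀ p < r, s'.arr arrX n' p = residual n' t' s p ∧
        s'.arr arrLo n' p = min 0 (residual n' t' s p) ∧
        s'.arr arrUp n' p = max 0 (residual n' t' s p)) ∧
      ∀ i < (n' : ℤ), s'.arr arrX i = s.arr arrX i ∧ s'.arr arrLo i = s.arr arrLo i ∧
        s'.arr arrUp i = s.arr arrUp i := by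
  refine Run.le (T₁ := (r + 1) * ((4 + ((n' * t' + 1) * ((Δ + 1) * 80) + (4 + 30))) + 1 + 10)) ?_
    (Nat.mul_le_mul_left _ (by omega))
  refine (Run.forUp (N := r) (T := 4 + ((n' * t' + 1) * ((Δ + 1) * 80) + (4 + 30))) (fun P s' =>
      (∀ p < P, s'.arr arrX n' p = residual n' t' s p ∧
        s'.arr arrLo n' p = min 0 (residual n' t' s p) ∧
        s'.arr arrUp n' p = max 0 (residual n' t' s p)) ∧
      ∀ i < (n' : ℤ), s'.arr arrX i = s.arr arrX i ∧ s'.arr arrLo i = s.arr arrLo i ∧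
        s'.arr arrUp i = s.arr arrUp i) (by decide)
      (fun s' ha => ?_) (by simp) ?_).mono le_rfl fun _ _ h => h
  · simp [ha.var regR (by decide), hs.r_eq]
  · rintro P hP s₁ ha hpv ⟨p1, p2⟩
    have hs₁ := hs.of_agree ha (by decide)
    have a1 := ha.arr arrRow (by decide)
    have a2 := ha.arr arrCol (by decide)
    have a3 := ha.arr arrTop (by decide)
    have a4 := ha.arr arrD (by decide)
    refine Run.seq (Run.straight ?_)
    simp only [Cmd.wp, Expr.eval_var, Expr.eval_get, Expr.eval_const, hpv, a3]
    refine Run.bind (run_residualCmd (m := m) (n' := n') (t' := t') (p := P) ht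
      (fun k hk => by simp only [State.setVar_arr, a1, a2]; exact hidx k hk) hnt
      (by simpa using hs₁.nt_eq) (by simpa using hpv)
      (by simp only [State.setVar_arr, a4]; exact hD P hP)) ?_
    intro s₂ b₂ h₂
    simp only [State.setVar_arr, State.setVar_var, if_true, a4] at h₂
    have hres : s₂.var regAcc = residual n' t' s P := by
      rw [h₂, residual]
      congr 1
      refine Finset.sum_congr rfl fun k hk => ?_
      rw [entry, (p2 _ (rowOf_lt (mem_range.1 hk))).1, entry]
    have c1 := b₂.var regN (by decide)
    have c2 := b₂.var regP (by decide)
    have c3 := b₂.arr arrX (by decide)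
    have c4 := b₂.arr arrLo (by decide)
    have c5 := b₂.arr arrUp (by decide)
    simp only [State.setVar_arr, State.setVar_var] at c1 c2 c3 c4 c5
    norm_num only [if_false] at c1 c2
    rw [hs₁.n_eq] at c1
    rw [hpv] at c2
    refine Run.seq (Run.straight ?_)
    refine (Run.straight ?_).le (by decide)
    simp only [Cmd.wp, Expr.eval_var, Expr.eval_const, State.setArr_var, c1, c2, hres]
    set ρ := residual n' t' s P with hρ
    have fin : ∀ s₃ : State, (∀ i j, s₃.arr arrX i j = if i = n' ∧ j = P then ρ
          else s₂.arr arrX i j) →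
        (∀ i j, s₃.arr arrLo i j = if i = n' ∧ j = P then min 0 ρ else s₂.arr arrLo i j) →
        (∀ i j, s₃.arr arrUp i j = if i = n' ∧ j = P then max 0 ρ else s₂.arr arrUp i j) →
        (∀ p < P + 1, s₃.arr arrX n' p = residual n' t' s p ∧
          s₃.arr arrLo n' p = min 0 (residual n' t' s p) ∧
          s₃.arr arrUp n' p = max 0 (residual n' t' s p)) ∧
        ∀ i < (n' : ℤ), s₃.arr arrX i = s.arr arrX i ∧ s₃.arr arrLo i = s.arr arrLo i ∧
          s₃.arr arrUp i = s.arr arrUp i := by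
      intro s₃ h1 h2 h3
      refine ⟨fun p hp => ?_, fun i hi => ?_⟩
      · rw [h1, h2, h3]
        by_cases h : p = P
        · simp [h, hρ]
        · rw [if_neg (by omega), if_neg (by omega), if_neg (by omega), c3, c4, c5]
          exact p1 p (by omega)
      · obtain ⟨g1, g2, g3⟩ := p2 i hi
        rw [← g1, ← g2, ← g3, ← c3, ← c4, ← c5]
        refine ⟨funext fun j => ?_, funext fun j => ?_, funext fun j => ?_⟩
        · rw [h1, if_neg (by omega)]
        · rw [h2, if_neg (by omega)]
        · rw [h3, if_neg (by omega)]
    refine ⟨fun h => fin _ ?_ ?_ ?_, fun h => fin _ ?_ ?_ ?_⟩ <;> intro i j <;>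
      simp only [State.setVar_arr, State.setArr_arr] <;> norm_num only [true_and, false_and, if_false]
    · rw [min_eq_left h.le]
    · rw [max_eq_right h.le]
    · rw [min_eq_right (not_lt.1 h)]
    · rw [max_eq_left (not_lt.1 h)]

/-! ### The initialisation -/

def setupCmd : Cmd :=
  paramCmd ;; powersCmd ;; tableCmd ;; baseCmd ;; roundCmd ;; boundsCmd ;; slackCmd

def setupTime (r t n Δ G V : ℕ) : ℕ :=
  ((r + 1) * ((t + 1) * 70) + (r + 1) * ((4 * Δ * r + 3) * 60) + (t + Δ + G + r + 6) * 60) +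
  ((r + 2) * ((V + 1) * 220) +
  ((n * t + r + 1) * ((r + 1) * ((Δ + 1) * 70) + (G + 2) * 40 + 160) +
  ((G + 2) * 20 + ((n + 1) * ((t + 1) * 80 + 11) + ((n * t + 1) * 100 +
  (r + 1) * ((n * t + 1) * ((Δ + 1) * 80) + 60))))))

/-- The state before the augmentation: the current solution `x`, a vector of `n * t + r` variables,
the last `r` of which are slack variables, lies in the box given by `lo` and `up`. -/
structure Ready (r t n G V W : ℕ) (S : ℕ → ℕ) (w x lo up : ℕ → ℤ) (s : State) : Prop where
  params : Params r t n G V W s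
  dp : DPReady (n * t + r) G S w s
  indexed : Indexed n t (n * t + r) s
  x_eq : ∀ k < n * t + r, entry n t (s.arr arrX) k = x k
  lo_eq : ∀ k < n * t + r, entry n t (s.arr arrLo) k = lo k
  up_eq : ∀ k < n * t + r, entry n t (s.arr arrUp) k = up k

/-- `x` is a rounding of the vector `y` that keeps the brick sums, the slack variables are the
violations of the upper constraints, and the box has radius `W`. -/
structure IsStart (r t n W : ℕ) (A top brick l u : ℤ → ℤ → ℤ) (y : ℤ → ℤ → ℝ)
    (x lo up : ℕ → ℤ) : Prop where
  round : ∀ k < n * t, x k = ⌊y (k / t : ℕ) (k % t : ℕ)⌋ ∨ x k = ⌈y (k / t : ℕ) (k % t : ℕ)⌉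
  brick : ∀ i < n, ∑ k ∈ Ico (i * t) ((i + 1) * t), x k = brick i 0
  lo_eq : ∀ k < n * t, lo k = max (l (k / t : ℕ) (k % t : ℕ)) (x k - W)
  up_eq : ∀ k < n * t, up k = min (u (k / t : ℕ) (k % t : ℕ)) (x k + W)
  slack : ∀ p < r, x (n * t + p) = top p 0 - ∑ k ∈ range (n * t), x k * A p (k % t : ℕ)
  lo_slack : ∀ p < r, lo (n * t + p) = min 0 (x (n * t + p))
  up_slack : ∀ p < r, up (n * t + p) = max 0 (x (n * t + p))

theorem entry_of_lt {n t k : ℕ} (A : ℤ → ℤ → ℤ) (hk : k < n * t) :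
    entry n t A k = A (k / t : ℕ) (k % t : ℕ) := by
  rw [entry, rowOf, colOf, if_pos hk, if_pos hk]

theorem entry_slack (n t p : ℕ) (A : ℤ → ℤ → ℤ) : entry n t A (n * t + p) = A n p := by
  rw [entry, rowOf, colOf, if_neg (by omega), if_neg (by omega)]
  simp

theorem sum_Ico_brick {R : Type*} [AddCommMonoid R] {t i : ℕ} (ht : 0 < t) (f : ℕ → ℕ → R) :
    ∑ k ∈ Ico (i * t) ((i + 1) * t), f (k / t) (k % t) = ∑ j ∈ range t, f i j := by
  rw [Finset.sum_Ico_eq_sum_range]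
  have : (i + 1) * t - i * t = t := by rw [add_mul, one_mul]; omega
  rw [this]
  refine Finset.sum_congr rfl fun j hj => ?_
  have hj := mem_range.1 hj
  have h1 : (i * t + j) / t = i := by
    rw [mul_comm, Nat.mul_add_div ht, Nat.div_eq_of_lt hj, add_zero]
  have h2 : (i * t + j) % t = j := by
    rw [mul_comm, Nat.mul_add_mod, Nat.mod_eq_of_lt hj]
  rw [h1, h2]

theorem Tables.of_agree {c : Cmd} {s s' : State} {m n t G : ℕ} {S : ℕ → ℕ} {w : ℕ → ℤ}
    (ha : Agree c s s') (hc : ∀ a ∈ [arrRow, arrCol, arrLow, arrCount, arrShift], a ∉ c.arrs)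
    (h : Tables m n t G S w s) : Tables m n t G S w s' := by
  obtain ⟨h1, h2, h3, h4⟩ := h
  refine ⟨?_, ?_, ?_, ?_⟩
  · unfold Indexed
    rw [ha.arr _ (hc _ (by decide)), ha.arr _ (hc _ (by decide))]; exact h1
  · rw [ha.arr _ (hc _ (by decide))]; exact h2
  · rw [ha.arr _ (hc _ (by decide))]; exact h3
  · rw [ha.arr _ (hc _ (by decide))]; exact h4

theorem DPReady.of_agree {c : Cmd} {s s' : State} {m G : ℕ} {S : ℕ → ℕ} {w : ℕ → ℤ}
    (ha : Agree c s s') (hv : ∀ v ∈ [regM, regG], v ∉ c.vars)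
    (hc : ∀ a ∈ [arrLow, arrCount, arrShift, arrReach, arrVal], a ∉ c.arrs)
    (h : DPReady m G S w s) : DPReady m G S w s' := by
  obtain ⟨h1, h2, h3, h4, h5, h6, h7, h8, h9⟩ := h
  have e1 := ha.arr _ (hc arrLow (by decide))
  have e2 := ha.arr _ (hc arrCount (by decide))
  have e3 := ha.arr _ (hc arrShift (by decide))
  have e4 := ha.arr _ (hc arrReach (by decide))
  have e5 := ha.arr _ (hc arrVal (by decide))
  refine ⟨?_, ?_, ?_, ?_, ?_, ?_, ?_, ?_, ?_⟩
  · rw [ha.var _ (hv _ (by decide)), h1]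
  · rw [ha.var _ (hv _ (by decide)), h2]
  · rw [e1]; exact h3
  · rw [e2]; exact h4
  · rw [e3]; exact h5
  · rw [e4]; exact h6
  · rw [e4]; exact h7
  · rw [e5]; exact h8
  · rw [e4]; exact h9

/-- Only the brick sums of the relaxed vector matter here. Its feasibility for the upper constraints
and its optimality enter later, through the size of the violations and the proximity bound. -/
theorem run_setupCmd {s : State} {r t' n' : ℕ} {Δ G V W : ℕ} {S : ℕ → ℕ} (ht0 : 0 < t')
    (hn0 : 0 < n') (hr : s.var regR = r) (ht : s.var regT = t') (hn : s.var regN = n')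
    (hΔ : ∀ i < r, ∀ j < t', |s.arr arrD i j| + 1 ≤ Δ) (hΔ1 : 1 ≤ Δ)
    (hmin : ∀ δ : ℤ, 1 ≤ δ → (∀ i < r, ∀ j < t', |s.arr arrD i j| + 1 ≤ δ) → (Δ : ℤ) ≤ δ)
    (hG : G = 2 * (4 * Δ * r + 1) ^ r) (hV : V = Δ * G) (hW : W = (n' * t' + 1) * (G + 2))
    (hS : ∀ k, (S k : ℤ) = layerBound n' t' V r k)
    (hreach : s.arr arrReach = 0) (hval : s.arr arrVal = 0)
    (hsum : ∀ i < n', ∑ j ∈ range t', s.real i j = s.arr arrBrick i 0) :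
    Run E setupCmd s (setupTime r t' n' Δ G V) fun s' => ∃ x lo up : ℕ → ℤ,
      Ready r t' n' G V W S (weight n' t' V (tableCol (r := r) n' t' (s.arr arrD))) x lo up s' ∧
      IsStart r t' n' W (s.arr arrD) (s.arr arrTop) (s.arr arrBrick) (s.arr arrL) (s.arr arrU)
        s.real x lo up := by
  have hD : ∀ i < r, ∀ j < t', |s.arr arrD i j| ≤ Δ := fun i hi j hj => by
    have := hΔ i hi j hj; omega
  unfold setupTime
  refine Run.bind (run_paramCmd hr ht hn hΔ hΔ1 hmin hG hV hW) fun s₁ a₁ p₁ => ?_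
  refine Run.bind (run_powersCmd p₁) fun s₂ a₂ w₂ => ?_
  have p₂ := p₁.of_agree a₂ (by decide)
  have d₂ : s₂.arr arrD = s.arr arrD := (a₂.arr _ (by decide)).trans (a₁.arr _ (by decide))
  refine Run.bind (run_tableCmd (Δ := Δ) p₂ w₂ ht0 hn0 (by rw [d₂]; exact hD) hS)
    fun s₃ a₃ T₃ => ?_
  rw [d₂] at T₃
  have p₃ := p₂.of_agree a₃ (by decide)
  refine Run.bind (run_baseCmd p₃.G_eq p₃.m_eq T₃
    (by rw [a₃.arr _ (by decide), a₂.arr _ (by decide), a₁.arr _ (by decide), hreach])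
    (by rw [a₃.arr _ (by decide), a₂.arr _ (by decide), a₁.arr _ (by decide), hval]))
    fun s₄ a₄ r₄ => ?_
  have p₄ := p₃.of_agree a₄ (by decide)
  have T₄ := T₃.of_agree a₄ (by decide)
  have real₄ : s₄.real = s.real := by
    rw [a₄.real (by decide), a₃.real (by decide), a₂.real (by decide), a₁.real (by decide)]
  have old : ∀ a ∈ [arrD, arrTop, arrBrick, arrL, arrU], s₄.arr a = s.arr a := by
    intro a ha
    have h : ∀ a ∈ [arrD, arrTop, arrBrick, arrL, arrU], a ∉ baseCmd.arrs ∧ a ∉ tableCmd.arrs ∧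
      a ∉ powersCmd.arrs ∧ a ∉ paramCmd.arrs := by decide
    obtain ⟨h1, h2, h3, h4⟩ := h a ha
    rw [a₄.arr a h1, a₃.arr a h2, a₂.arr a h3, a₁.arr a h4]
  refine Run.bind (run_roundCmd (t' := t') (n' := n') p₄.t_eq p₄.n_eq
    (by rw [real₄, old _ (by decide)]; exact hsum)) ?_
  rw [real₄, old arrBrick (by decide)]
  rintro s₅ a₅ ⟨x₅, b₅⟩
  have p₅ := p₄.of_agree a₅ (by decide)
  have T₅ := T₄.of_agree a₅ (by decide)
  have r₅ := r₄.of_agree a₅ (by decide) (by decide)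
  refine Run.bind (run_boundsCmd (nt := n' * t') T₅.indexed (by omega) p₅.nt_eq p₅.W_eq) ?_
  rw [a₅.arr arrL (by decide), old arrL (by decide), a₅.arr arrU (by decide), old arrU (by decide)]
  rintro s₆ a₆ ⟨l₆, u₆⟩
  have p₆ := p₅.of_agree a₆ (by decide)
  have T₆ := T₅.of_agree a₆ (by decide)
  have r₆ := r₅.of_agree a₆ (by decide) (by decide)
  have D₆ : s₆.arr arrD = s.arr arrD := by
    rw [a₆.arr _ (by decide), a₅.arr _ (by decide), old _ (by decide)]
  have top₆ : s₆.arr arrTop = s.arr arrTop := by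
    rw [a₆.arr _ (by decide), a₅.arr _ (by decide), old _ (by decide)]
  have X₆ : s₆.arr arrX = s₅.arr arrX := a₆.arr _ (by decide)
  refine (run_slackCmd (Δ := Δ) p₆ ht0 T₆.indexed (by omega) (by rw [D₆]; exact hD)).mono le_rfl ?_
  rintro s₇ a₇ ⟨sl, same⟩
  have T₇ := T₆.of_agree a₇ (by decide)
  have ex : ∀ k < n' * t', entry n' t' (s₇.arr arrX) k = entry n' t' (s₅.arr arrX) k :=
    fun k hk => by rw [entry, (same _ (rowOf_lt hk)).1, X₆, entry]
  have el : ∀ k < n' * t', entry n' t' (s₇.arr arrLo) k = entry n' t' (s₆.arr arrLo) k :=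
    fun k hk => by rw [entry, (same _ (rowOf_lt hk)).2.1, entry]
  have eu : ∀ k < n' * t', entry n' t' (s₇.arr arrUp) k = entry n' t' (s₆.arr arrUp) k :=
    fun k hk => by rw [entry, (same _ (rowOf_lt hk)).2.2, entry]
  have hdiv : ∀ k < n' * t', k / t' < n' := fun k hk => Nat.div_lt_of_lt_mul (by rwa [mul_comm])
  refine ⟨entry n' t' (s₇.arr arrX), entry n' t' (s₇.arr arrLo), entry n' t' (s₇.arr arrUp),
    ⟨p₆.of_agree a₇ (by decide), r₆.of_agree a₇ (by decide) (by decide), T₇.indexed,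
      fun _ _ => rfl, fun _ _ => rfl, fun _ _ => rfl⟩,
    ⟨fun k hk => ?_, fun i hi => ?_, fun k hk => ?_, fun k hk => ?_, fun p hp => ?_, fun p hp => ?_,
      fun p hp => ?_⟩⟩
  · rw [ex k hk, entry_of_lt _ hk]
    exact x₅ _ (hdiv k hk) _ (Nat.mod_lt _ ht0)
  · rw [← b₅ i hi, ← sum_Ico_brick ht0 fun i j => s₅.arr arrX i j]
    refine Finset.sum_congr rfl fun k hk => ?_
    have hkn : k < n' * t' := (mem_Ico.1 hk).2.trans_le (Nat.mul_le_mul_right _ hi)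
    rw [ex k hkn, entry_of_lt _ hkn]
  · rw [el k hk, l₆ k hk, ex k hk, entry_of_lt (s.arr arrL) hk]
  · rw [eu k hk, u₆ k hk, ex k hk, entry_of_lt (s.arr arrU) hk]
  · rw [entry_slack, (sl p hp).1, residual, top₆, D₆, X₆]
    congr 1
    exact Finset.sum_congr rfl fun k hk => by rw [ex k (mem_range.1 hk)]
  · rw [entry_slack, entry_slack, (sl p hp).2.1, (sl p hp).1]
  · rw [entry_slack, entry_slack, (sl p hp).2.2, (sl p hp).1]

/-! ### The two phases -/

/-- `regAcc` becomes the sum of the absolute values of the slack variables. -/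
def normCmd : Cmd :=
  regAcc ::= Expr.const 0 ;;
  forUp regP (Expr.var regR) (
    regX ::= Expr.get arrX (Expr.var regN) (Expr.var regP) ;;
    Cmd.ite (Expr.var regX) (regAcc ::= Expr.var regAcc + Expr.var regX)
      (regAcc ::= Expr.var regAcc - Expr.var regX))

theorem run_normCmd {s : State} {r n' : ℕ} (hr : s.var regR = r) (hn : s.var regN = n') :
    Run E normCmd s ((r + 1) * 40) fun s' =>
      s'.var regAcc = ∑ p ∈ range r, |s.arr arrX n' p| := by
  refine Run.le (T₁ := 2 + (r + 1) * (20 + 1 + 10)) ?_ (by omega)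
  refine Run.seq (Run.straight ?_)
  simp only [Cmd.wp, Expr.eval_const]
  refine (Run.forUp (N := r) (T := 20) (fun i s' => s'.var regAcc =
    ∑ p ∈ range i, |s.arr arrX n' p|) (by decide) (fun s' ha => ?_) (by simp) ?_).mono le_rfl
    fun _ _ h => h
  · have := ha.var regR (by decide)
    simp at this
    simp [this, hr]
  · intro i hi s' ha hiv hP
    have e1 := ha.var regN (by decide)
    have e2 := ha.arr arrX (by decide)
    simp [hn] at e1 e2
    refine (Run.straight ?_).le (by decide)
    simp only [Cmd.wp, Expr.eval_get, Expr.eval_var, Expr.eval_add, Expr.eval_sub,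
      State.setVar_var, e1, e2, hiv, hP]
    norm_num only [if_true, if_false]
    rw [Finset.sum_range_succ]
    exact ⟨fun h => by rw [abs_of_pos h], fun h => by rw [abs_of_nonpos (not_lt.1 h)]; ring⟩

/-- Forces the slack variables to be zero. -/
def closeCmd : Cmd :=
  forUp regP (Expr.var regR) (
    Cmd.store arrLo (Expr.var regN) (Expr.var regP) (Expr.const 0) ;;
    Cmd.store arrUp (Expr.var regN) (Expr.var regP) (Expr.const 0))

theorem run_closeCmd {s : State} {r n' : ℕ} (hr : s.var regR = r) (hn : s.var regN = n') :
    Run E closeCmd s ((r + 1) * 20) fun s' =>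
      (∀ p < r, s'.arr arrLo n' p = 0 ∧ s'.arr arrUp n' p = 0) ∧
      ∀ i < (n' : ℤ), s'.arr arrLo i = s.arr arrLo i ∧ s'.arr arrUp i = s.arr arrUp i := by
  refine Run.le (T₁ := (r + 1) * (8 + 1 + 10)) ?_ (by omega)
  refine (Run.forUp (N := r) (T := 8) (fun i s' =>
      (∀ p < i, s'.arr arrLo n' p = 0 ∧ s'.arr arrUp n' p = 0) ∧
      ∀ i < (n' : ℤ), s'.arr arrLo i = s.arr arrLo i ∧ s'.arr arrUp i = s.arr arrUp i) (by decide)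
      (fun s' ha => ?_) (by simp) ?_).mono le_rfl fun _ _ h => h
  · simp [ha.var regR (by decide), hr]
  · rintro i hi s' ha hiv ⟨p1, p2⟩
    have e1 := ha.var regN (by decide)
    rw [hn] at e1
    refine (Run.straight ?_).le (by decide)
    simp only [Cmd.wp, Expr.eval_var, Expr.eval_const, State.setArr_var, State.setVar_arr, e1, hiv]
    refine ⟨fun p hp => ?_, fun i' hi' => ?_⟩
    · simp only [State.setArr_arr]
      norm_num only [true_and, false_and, if_false]
      by_cases h : p = i
      · simp [h]
      · rw [if_neg (by omega), if_neg (by omega)]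
        exact p1 p (by omega)
    · rw [← (p2 i' hi').1, ← (p2 i' hi').2]
      constructor <;> funext j <;> simp only [State.setArr_arr] <;>
        norm_num only [true_and, false_and, if_false] <;> rw [if_neg (by omega)]

/-- Copies the solution to the array `0` and reports success. -/
def outputCmd : Cmd :=
  forUp regK (Expr.var regNT) (
    regI ::= Expr.get arrRow (Expr.var regK) (Expr.const 0) ;;
    regJ ::= Expr.get arrCol (Expr.var regK) (Expr.const 0) ;;
    Cmd.store arrD (Expr.var regI) (Expr.var regJ)
      (Expr.get arrX (Expr.var regI) (Expr.var regJ))) ;;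
  regR ::= Expr.const 1

theorem run_outputCmd {s : State} {n' t' m nt : ℕ} (hidx : Indexed n' t' m s) (hnt : nt ≤ m)
    (hNT : s.var regNT = nt) :
    Run E outputCmd s ((nt + 1) * 40) fun s' => s'.var regR = 1 ∧
      ∀ k < nt, entry n' t' (s'.arr arrD) k = entry n' t' (s.arr arrX) k := by
  refine Run.le (T₁ := (nt + 1) * (20 + 1 + 10) + 2) ?_ (by omega)
  refine Run.bind (Run.forUp (N := nt) (T := 20) (fun K s' => ∀ k < K,
    entry n' t' (s'.arr arrD) k = entry n' t' (s.arr arrX) k) (by decide) (fun s' ha => ?_) (by simp)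
    ?_) fun s' _ h => Run.straight ?_
  · simp [ha.var regNT (by decide), hNT]
  · intro K hK s' ha hkv hP
    have a1 := ha.arr arrRow (by decide)
    have a2 := ha.arr arrCol (by decide)
    have a3 := ha.arr arrX (by decide)
    have hi := hidx K (by omega)
    refine (Run.straight ?_).le (by decide)
    simp only [Cmd.wp, Expr.eval_var, Expr.eval_get, Expr.eval_const, State.setVar_var,
      State.setVar_arr, hkv, a1, a2, a3, hi.1]
    norm_num only [if_true, if_false]
    simp only [hi.2]
    intro k hk
    rw [entry, State.setArr_arr_self]
    by_cases h : k = K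
    · subst h; rw [if_pos ⟨rfl, rfl⟩, entry]
    · rw [if_neg fun hh => h (position_injective hh.1 hh.2)]
      exact hP k (by omega)
  · exact ⟨by simp, h⟩

/-- Phase one minimizes the 1-norm of the slacks. A positive minimum shows that the box contains no
solution; otherwise the slacks are frozen at zero and phase two minimizes the objective from the
solution found. -/
def solveCmd : Cmd :=
  regPhase ::= Expr.const 1 ;;
  augLoop fillTables ;;
  normCmd ;;
  Cmd.ite (Expr.var regAcc) (regR ::= Expr.const 0)
    (regPhase ::= Expr.const 0 ;; closeCmd ;; augLoop fillTables ;; outputCmd)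

def phaseTime (m G N e Nst : ℕ) : ℕ :=
  (N * e + 1) * ((m + 1) * ((2 * G + 2) * 160) +
    (m + 1) * ((Nst + 1) * ((2 * G + 2) * 120 + 120) + 81) + 20) + 10

theorem Keep.params {s s' : State} {r t n G V W : ℕ} (hk : Keep s s') (h : Params r t n G V W s) :
    Params r t n G V W s' := by
  obtain ⟨h1, h2, h3, h4, h5, h6, h7, h8, h9⟩ := h
  constructor
  · rw [hk.var _ (by decide), h1]
  · rw [hk.var _ (by decide), h2]
  · rw [hk.var _ (by decide), h3]
  · rw [hk.var _ (by decide), h4]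
  · rw [hk.var _ (by decide), h5]
  · rw [hk.var _ (by decide), h6]
  · rw [hk.var _ (by decide), h7]
  · rw [hk.var _ (by decide), h8]
  · rw [hk.var _ (by decide), h9]

theorem sum_slackNorm (nt r : ℕ) (y : ℕ → ℤ) :
    ∑ k ∈ range (nt + r), slackNorm nt k (y k) = ∑ p ∈ range r, |y (nt + p)| := by
  rw [Finset.sum_range_add, Finset.sum_eq_zero, zero_add]
  · exact Finset.sum_congr rfl fun p _ => by simp [slackNorm]
  · intro k hk
    simp [slackNorm, mem_range.1 hk]

/-- The conclusion concerns only solutions inside the reduced box, described as kernel translates of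
the starting point with zero slacks. That such solutions suffice is a matter of proximity, treated
separately. -/
theorem run_solveCmd {s : State} {r Δ G V W : ℕ} {col : ℕ → Fin r → ℤ} {S : ℕ → ℕ} (hΔ : 0 < Δ)
    (hcol : ∀ k p, |col k p| ≤ Δ) (ht : 0 < t) (hV : V = Δ * G)
    (hG : G = 2 * (4 * Δ * r + 1) ^ r) (hS : ∀ k, (S k : ℤ) = layerBound n t V r k)
    {x lo up : ℕ → ℤ} (hs : Ready r t n G V W S (weight n t V col) x lo up s)
    {ψ : Fin n × Fin t → ℤ → ℤ} (hψ : ∀ p, IntConvex (ψ p)) (hf : ∀ x, E.f x = ∑ p, ψ p (x p))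
    (hbox : ∀ k < n * t + r, lo k ≤ x k ∧ x k ≤ up k)
    (hslack : ∀ p < r, lo (n * t + p) ≤ 0 ∧ 0 ≤ up (n * t + p)) {N e Nst : ℕ} (hN : 0 < N)
    (hNsum : ∑ k ∈ range (n * t + r), (up k - lo k) ≤ N)
    (hgap₁ : ∑ p ∈ range r, |x (n * t + p)| < 2 ^ e)
    (hgap₂ : ∀ y z : ℕ → ℤ, (∀ k < n * t, lo k ≤ y k ∧ y k ≤ up k) →
      (∀ k < n * t, lo k ≤ z k ∧ z k ≤ up k) →
      ∑ k ∈ range (n * t + r), flatten ψ k (y k) - ∑ k ∈ range (n * t + r), flatten ψ k (z k) < 2 ^ e)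
    (hNst : ∀ k < n * t + r, (G + 1) * (2 * S (k + 1) + 1) ≤ Nst) :
    Run E solveCmd s (2 * phaseTime (n * t + r) G N e Nst + (r + 1) * 60 + (n * t + 1) * 40 + 10)
      fun s' =>
      (s'.var regR = 0 ∧ ∀ y : ℕ → ℤ, (∀ k < n * t, lo k ≤ y k ∧ y k ≤ up k) →
        (∀ p < r, y (n * t + p) = 0) →
        ¬ InKer (n * t + r) n (fun k => k / t) col (fun k => y k - x k)) ∨
      (s'.var regR = 1 ∧ ∃ y : ℕ → ℤ, (∀ k < n * t, entry n t (s'.arr arrD) k = y k) ∧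
        (∀ k < n * t, lo k ≤ y k ∧ y k ≤ up k) ∧ (∀ p < r, y (n * t + p) = 0) ∧
        InKer (n * t + r) n (fun k => k / t) col (fun k => y k - x k) ∧
        ∀ z : ℕ → ℤ, (∀ k < n * t, lo k ≤ z k ∧ z k ≤ up k) → (∀ p < r, z (n * t + p) = 0) →
          InKer (n * t + r) n (fun k => k / t) col (fun k => z k - x k) →
          ∑ k ∈ range (n * t + r), flatten ψ k (y k) ≤ ∑ k ∈ range (n * t + r), flatten ψ k (z k)) := by
  set m := n * t + r with hm
  have hclosed : ∀ y : ℕ → ℤ, (∀ k < n * t, lo k ≤ y k ∧ y k ≤ up k) →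
      (∀ p < r, y (n * t + p) = 0) → ∀ k < m, lo k ≤ y k ∧ y k ≤ up k := by
    intro y h1 h2 k hk
    rcases lt_or_ge k (n * t) with h | h
    · exact h1 k h
    · obtain ⟨p, rfl⟩ := Nat.exists_eq_add_of_le h
      rw [h2 p (by omega)]
      exact hslack p (by omega)
  refine Run.le (T₁ := 2 + (phaseTime m G N e Nst + ((r + 1) * 40 + (1 + 1 + (2 + (2 +
    ((r + 1) * 20 + (phaseTime m G N e Nst + (n * t + 1) * 40)))))))) ?_ (by omega)
  refine Run.seq (Run.straight ?_)
  simp only [Cmd.wp, Expr.eval_const]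
  set s₁ := s.setVar regPhase 1 with hs₁
  have p₁ : Params r t n G V W s₁ := hs.params.of_agree
    (c := regPhase ::= Expr.const 0) (Agree.setVar _ _ _ (by decide)) (by decide)
  have dp₁ : DPReady m G S (weight n t V col) s₁ := hs.dp.of_agree
    (c := regPhase ::= Expr.const 0) (Agree.setVar _ _ _ (by decide)) (by decide) (by decide)
  refine Run.bind (run_augLoop hΔ hcol ht (by omega) hV hG hS (slackNorm_convex (n * t))
    (fillSpec_slack (by simp [hs₁]) p₁.nt_eq p₁.m_eq p₁.G_eq hs.indexed hs.lo_eq hs.up_eq) dp₁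
    hs.indexed hs.x_eq hbox hN hNsum (e := e) ?_ hNst) ?_
  · intro y _ _
    rw [sum_slackNorm, sum_slackNorm]
    have : 0 ≤ ∑ p ∈ range r, |y (n * t + p)| := Finset.sum_nonneg fun _ _ => abs_nonneg _
    omega
  rintro s₂ a₂ ⟨k₂, dp₂, box₂, ker₂, opt₂⟩
  have p₂ := k₂.params p₁
  have idx₂ : Indexed n t m s₂ := k₂.indexed hs.indexed
  refine Run.bind (run_normCmd p₂.r_eq p₂.n_eq) fun s₃ a₃ h₃ => ?_
  have k₃ : Keep s₂ s₃ := a₃.keep (by decide) (by decide)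
  have X₃ : s₃.arr arrX = s₂.arr arrX := a₃.arr _ (by decide)
  have hacc : s₃.var regAcc = ∑ k ∈ range m, slackNorm (n * t) k (entry n t (s₂.arr arrX) k) := by
    rw [h₃, sum_slackNorm]
    exact Finset.sum_congr rfl fun p _ => by rw [entry_slack]
  refine Run.ite (fun h => ?_) fun h => ?_
  · refine Run.straight ?_
    simp only [Cmd.wp, Expr.eval_const]
    -- A slack-free solution in the box would have phase-one value zero, below the minimum just
    -- found.
    refine Or.inl ⟨by simp, fun y hy1 hy2 hker => ?_⟩
    have := opt₂ y (hclosed y hy1 hy2) hker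
    rw [Expr.eval_var, hacc] at h
    have h0 : ∑ p ∈ range r, |y (n * t + p)| = 0 := Finset.sum_eq_zero fun p hp => by
      rw [hy2 p (mem_range.1 hp), abs_zero]
    rw [sum_slackNorm (n * t) r y, h0] at this
    exact absurd h (not_lt.2 this)
  · rw [Expr.eval_var, h₃] at h
    have hzero : ∀ p < r, s₂.arr arrX n p = 0 := fun p hp => by
      have h1 := Finset.single_le_sum (f := fun p : ℕ => |s₂.arr arrX n p|)
        (fun _ _ => abs_nonneg _) (mem_range.2 hp)
      have h2 := abs_nonneg (s₂.arr arrX n p)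
      exact abs_eq_zero.1 (by omega)
    refine Run.seq (Run.straight ?_)
    simp only [Cmd.wp, Expr.eval_const]
    set s₄ := s₃.setVar regPhase 0 with hs₄
    have p₃ := k₃.params p₂
    refine Run.bind (run_closeCmd (s := s₄) (r := r) (n' := n) p₃.r_eq p₃.n_eq) ?_
    rintro s₅ a₅ ⟨z₅, same₅⟩
    have p₄ : Params r t n G V W s₄ := p₃.of_agree
      (c := regPhase ::= Expr.const 0) (Agree.setVar _ _ _ (by decide)) (by decide)
    have p₅ := p₄.of_agree a₅ (by decide)
    have dp₃ : DPReady m G S (weight n t V col) s₃ := dp₂.of_agree a₃ (by decide) (by decide)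
    have dp₄ : DPReady m G S (weight n t V col) s₄ := dp₃.of_agree
      (c := regPhase ::= Expr.const 0) (Agree.setVar _ _ _ (by decide)) (by decide) (by decide)
    have dp₅ := dp₄.of_agree a₅ (by decide) (by decide)
    have idx₅ : Indexed n t m s₅ := by
      have := k₃.indexed idx₂
      unfold Indexed
      rw [a₅.arr arrRow (by decide), a₅.arr arrCol (by decide)]
      exact this
    have X₅ : s₅.arr arrX = s₂.arr arrX := (a₅.arr _ (by decide)).trans X₃
    have hlo₄ : s₄.arr arrLo = s.arr arrLo :=
      (k₃.arr arrLo (by decide) (by decide)).trans (k₂.arr arrLo (by decide) (by decide))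
    have hup₄ : s₄.arr arrUp = s.arr arrUp :=
      (k₃.arr arrUp (by decide) (by decide)).trans (k₂.arr arrUp (by decide) (by decide))
    -- The box of phase two: ordinary variables keep their range, slack variables are pinned to
    -- zero. Its total width does not grow, so the same `N` serves both phases.
    set lo' : ℕ → ℤ := fun k => if k < n * t then lo k else 0 with hlo'
    set up' : ℕ → ℤ := fun k => if k < n * t then up k else 0 with hup'
    have hbox' : ∀ y : ℕ → ℤ, (∀ k < m, lo' k ≤ y k ∧ y k ≤ up' k) ↔
        (∀ k < n * t, lo k ≤ y k ∧ y k ≤ up k) ∧ ∀ p < r, y (n * t + p) = 0 := by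
      intro y
      refine ⟨fun hh => ⟨fun k hk => ?_, fun p hp => ?_⟩, fun hh k hk => ?_⟩
      · simpa [hlo', hup', hk] using hh k (by omega)
      · have := hh (n * t + p) (by omega)
        simp only [hlo', hup', if_neg (show ¬ n * t + p < n * t by omega)] at this
        omega
      · rcases lt_or_ge k (n * t) with h' | h'
        · simpa [hlo', hup', h'] using hh.1 k h'
        · obtain ⟨p, rfl⟩ := Nat.exists_eq_add_of_le h'
          simp [hlo', hup', hh.2 p (by omega)]
    have hx2 : ∀ k < m, lo' k ≤ entry n t (s₂.arr arrX) k ∧ entry n t (s₂.arr arrX) k ≤ up' k :=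
      (hbox' _).2 ⟨fun k hk => box₂ k (by omega), fun p hp => by rw [entry_slack, hzero p hp]⟩
    have hsum' : ∑ k ∈ range m, (up' k - lo' k) ≤ N := by
      refine (Finset.sum_le_sum fun k hk => ?_).trans hNsum
      have := hbox k (mem_range.1 hk)
      simp only [hlo', hup']
      split_ifs <;> omega
    refine Run.bind (run_augLoop (lo := lo') (up := up') (x₀ := entry n t (s₂.arr arrX)) hΔ hcol ht
      (by omega) hV hG hS (flatten_convex hψ)
      (fillSpec_objective ?_ (by omega) hf p₅.m_eq p₅.G_eq idx₅ ?_ ?_) dp₅ idx₅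
      (fun k _ => by rw [X₅]) hx2 hN hsum' (e := e) ?_ hNst) ?_
    · rw [a₅.var regPhase (by decide), hs₄]; simp
    · intro k hk
      rcases lt_or_ge k (n * t) with h' | h'
      · rw [entry, (same₅ _ (rowOf_lt h')).1, hlo₄]
        refine (hs.lo_eq k hk).trans ?_
        simp [hlo', h']
      · obtain ⟨p, rfl⟩ := Nat.exists_eq_add_of_le h'
        rw [entry_slack, (z₅ p (by omega)).1]
        simp [hlo']
    · intro k hk
      rcases lt_or_ge k (n * t) with h' | h'
      · rw [entry, (same₅ _ (rowOf_lt h')).2, hup₄]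
        refine (hs.up_eq k hk).trans ?_
        simp [hup', h']
      · obtain ⟨p, rfl⟩ := Nat.exists_eq_add_of_le h'
        rw [entry_slack, (z₅ p (by omega)).2]
        simp [hup']
    · intro y hy _
      exact hgap₂ _ _ (fun k hk => box₂ k (by omega)) ((hbox' y).1 hy).1
    rintro s₆ a₆ ⟨k₆, dp₆, box₆, ker₆, opt₆⟩
    have p₆ := k₆.params p₅
    refine (run_outputCmd (nt := n * t) (k₆.indexed idx₅) (by omega) p₆.nt_eq).mono le_rfl ?_
    rintro s₇ a₇ ⟨h₇, out₇⟩
    obtain ⟨b1, b2⟩ := (hbox' _).1 box₆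
    -- The two loops start from different points; their kernel differences are added to refer back
    -- to `x`.
    refine Or.inr ⟨h₇, entry n t (s₆.arr arrX), out₇, b1, b2,
      (ker₆.add ker₂).congr fun k _ => by ring, fun z hz1 hz2 hz3 => ?_⟩
    exact opt₆ z ((hbox' z).2 ⟨hz1, hz2⟩) ((hz3.sub ker₂).congr fun k _ => by ring)

/-- The algorithm. -/
def mainCmd : Cmd :=
  Cmd.relax regOk ;; Cmd.ite (Expr.var regOk) (setupCmd ;; solveCmd) (regR ::= Expr.const 0)

end Programs

/-! ### The integer program in terms of flat vectors -/

theorem embed_coe {α : Type} [Zero α] {m k : ℕ} (M : Fin m × Fin k → α) (i : Fin m) (j : Fin k) :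
    embed M (i : ℕ) (j : ℕ) = M (i, j) := by
  simp [embed]

/-- The entries of a vector as a sequence. -/
def flatVec {α : Type} [Zero α] {n t : ℕ} (x : Fin n × Fin t → α) (k : ℕ) : α :=
  embed x (k / t : ℕ) (k % t : ℕ)

theorem flatVec_coe {α : Type} [Zero α] {n t : ℕ} (x : Fin n × Fin t → α) (k : Fin (n * t)) :
    flatVec x k = x (finProdFinEquiv.symm k) := by
  have := embed_coe x k.divNat k.modNat
  simpa [flatVec, finProdFinEquiv, Fin.divNat, Fin.modNat] using this

theorem flatVec_equiv {α : Type} [Zero α] {n t : ℕ} (x : Fin n × Fin t → α) (q : Fin n × Fin t) :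
    flatVec x (finProdFinEquiv q) = x q := by
  rw [flatVec_coe, Equiv.symm_apply_apply]

theorem flatVec_comp {α : Type} [Zero α] {n t : ℕ} (g : ℕ → α) {k : ℕ} (hk : k < n * t) :
    flatVec (fun q : Fin n × Fin t => g (finProdFinEquiv q)) k = g k := by
  have := flatVec_coe (fun q : Fin n × Fin t => g (finProdFinEquiv q)) ⟨k, hk⟩
  rwa [Equiv.apply_symm_apply] at this

namespace Instance

variable {r t n : ℕ} (I : Instance r t n)

/-- The columns of the upper constraints. -/
def col (k : ℕ) (p : Fin r) : ℤ :=
  tableCol n t (embed fun p : Fin r × Fin t => I.D p.1 p.2) k p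

theorem col_coe (k : Fin (n * t)) (p : Fin r) :
    I.col k p = I.D p (finProdFinEquiv.symm k).2 := by
  have := embed_coe (fun p : Fin r × Fin t => I.D p.1 p.2) p k.modNat
  simpa [col, tableCol, finProdFinEquiv, Fin.modNat] using this

/-- The equality constraints for a flat vector. -/
def IsSolution {R : Type} [CommRing R] (y : ℕ → R) : Prop :=
  (∀ p, ∑ k ∈ range (n * t), y k * (I.col k p : R) = I.b (Sum.inl p)) ∧
    ∀ i : Fin n, ∑ k ∈ range (n * t) with k / t = i, y k = I.b (Sum.inr (i, 0))

theorem isSolution_iff {R : Type} [CommRing R] (ht : 0 < t) (x : Fin n × Fin t → R) :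
    (I.E.map (fun z : ℤ => (z : R))).mulVec x = (fun q => (I.b q : R)) ↔
      I.IsSolution (flatVec x) := by
  have h1 : ∀ p, (I.E.map (fun z : ℤ => (z : R))).mulVec x (Sum.inl p) =
      ∑ k ∈ range (n * t), flatVec x k * (I.col k p : R) := by
    intro p
    rw [Finset.sum_range, Matrix.mulVec, dotProduct, sum_brick_position]
    refine Finset.sum_congr rfl fun k _ => ?_
    rw [flatVec_coe, col_coe, mul_comm]
    rfl
  have h2 : ∀ i, (I.E.map (fun z : ℤ => (z : R))).mulVec x (Sum.inr (i, 0)) =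
      ∑ k ∈ range (n * t) with k / t = (i : ℕ), flatVec x k := by
    intro i
    rw [sum_brick ht le_rfl i.2, Matrix.mulVec, dotProduct, Fintype.sum_prod_type,
      Finset.sum_eq_single_of_mem i (Finset.mem_univ i)]
    · have := sum_Ico_brick (i := i) ht fun a b => embed x (a : ℤ) (b : ℤ)
      simp only [flatVec]
      rw [this, Finset.sum_range]
      refine Finset.sum_congr rfl fun j _ => ?_
      rw [embed_coe]
      simp [E, nFoldProduct, onesRow]
    · intro i' _ hne
      exact Finset.sum_eq_zero fun j _ => by simp [E, nFoldProduct, onesRow, hne.symm]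
  constructor
  · intro h
    exact ⟨fun p => by rw [← h1, h], fun i => by rw [← h2, h]⟩
  · rintro ⟨g1, g2⟩
    funext q
    rcases q with p | ⟨i, q⟩
    · rw [h1, g1]
    · rw [Subsingleton.elim q 0, h2, g2]

theorem feasible_iff (ht : 0 < t) (x : Fin n × Fin t → ℤ) :
    I.Feasible x ↔ I.IsSolution (flatVec x) ∧ ∀ q, I.l q ≤ x q ∧ x q ≤ I.u q := by
  rw [← isSolution_iff I ht, Feasible, Pi.le_def, Pi.le_def, forall_and]
  simp only [Int.cast_id]
  rfl

theorem relaxFeasible_iff (ht : 0 < t) (x : Fin n × Fin t → ℝ) :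
    I.RelaxFeasible x ↔
      I.IsSolution (flatVec x) ∧ ∀ q, (I.l q : ℝ) ≤ x q ∧ x q ≤ (I.u q : ℝ) := by
  rw [← isSolution_iff I ht, RelaxFeasible]

variable {I}

theorem IsSolution.congr {R : Type} [CommRing R] {y y' : ℕ → R} (h : I.IsSolution y)
    (hy : ∀ k < n * t, y' k = y k) : I.IsSolution y' := by
  refine ⟨fun p => ?_, fun i => ?_⟩
  · rw [← h.1 p]
    exact Finset.sum_congr rfl fun k hk => by rw [hy k (mem_range.1 hk)]
  · rw [← h.2 i]
    exact Finset.sum_congr rfl fun k hk => hy k (mem_range.1 (mem_filter.1 hk).1)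

theorem IsSolution.cast {y : ℕ → ℤ} (h : I.IsSolution y) : I.IsSolution fun k => (y k : ℝ) :=
  ⟨fun p => by
    have := congrArg (Int.cast : ℤ → ℝ) (h.1 p)
    push_cast at this
    simpa using this,
  fun i => by
    have := congrArg (Int.cast : ℤ → ℝ) (h.2 i)
    push_cast at this
    simpa using this⟩

theorem IsSolution.add_ker {R : Type} [CommRing R] {y : ℕ → R} {g : ℕ → ℤ} (h : I.IsSolution y)
    (hg : InKer (n * t) n (fun k => k / t) I.col g) : I.IsSolution fun k => y k + (g k : R) := by
  refine ⟨fun p => ?_, fun i => ?_⟩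
  · simp only [add_mul, Finset.sum_add_distrib, h.1 p]
    have := hg.1 p
    have h0 : ∑ k ∈ range (n * t), (g k : R) * (I.col k p : R) = 0 := by
      have := congrArg (Int.cast : ℤ → R) this
      simpa using this
    rw [h0, add_zero]
  · simp only [Finset.sum_add_distrib, h.2 i]
    have := hg.2 i i.2
    have h0 : ∑ k ∈ range (n * t) with k / t = (i : ℕ), (g k : R) = 0 := by
      have := congrArg (Int.cast : ℤ → R) this
      simpa using this
    rw [h0, add_zero]

variable (I)

theorem natAbs_lt_Delta (p : Fin r) (j : Fin t) : (I.D p j).natAbs + 1 ≤ I.Delta := by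
  have := Finset.le_sup (f := fun p : Fin r × Fin t => (I.D p.1 p.2).natAbs)
    (Finset.mem_univ (p, j))
  simp only at this
  unfold Delta
  omega

theorem abs_embed_lt_Delta (i j : ℤ) :
    |embed (fun p : Fin r × Fin t => I.D p.1 p.2) i j| + 1 ≤ I.Delta := by
  unfold embed
  split_ifs with h
  · have := I.natAbs_lt_Delta ⟨i.toNat, by omega⟩ ⟨j.toNat, by omega⟩
    rw [Int.abs_eq_natAbs]
    exact_mod_cast this
  · simp [Delta]

theorem abs_col_le (k : ℕ) (p : Fin r) : |I.col k p| ≤ I.Delta := by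
  have hD := I.abs_embed_lt_Delta
  unfold col tableCol
  split_ifs
  · have := hD (p : ℕ) (k % t : ℕ); omega
  · simp [Delta]
  · simp

/-! ### Proximity of integer and continuous optima -/

theorem finite_feasible : {z | I.Feasible z}.Finite :=
  (Finset.finite_toSet (Finset.Icc I.l I.u)).subset fun z hz => by
    simpa using ⟨hz.2.1, hz.2.2⟩

/-- Some minimizer is close to the given optimal solution of the continuous relaxation. -/
theorem exists_minimizer_near (ht : 0 < t) {F : (Fin n × Fin t → ℝ) → ℝ}
    (hF : IsSeparableConvexExtension I.f F) {x : Fin n × Fin t → ℝ} (hx : I.RelaxFeasible x)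
    (hopt : ∀ y, I.RelaxFeasible y → F x ≤ F y) (hfeas : ∃ z, I.Feasible z) :
    ∃ z, I.IsMinimizer z ∧ ∀ q, |x q - z q| ≤
      2 * ((n * t + 1) * (4 * I.Delta * r + 1) ^ r + n * t) := by
  obtain ⟨⟨φ, hφ, hFφ⟩, hFf⟩ := hF
  obtain ⟨z₀, hz₀⟩ := hfeas
  obtain ⟨z₁, hz₁, hmin₁⟩ := Set.exists_min_image _ I.f I.finite_feasible ⟨z₀, hz₀⟩
  have hfin : {z | I.IsMinimizer z}.Finite := I.finite_feasible.subset fun z hz => hz.1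
  -- Among all minimizers take one nearest to `x` in the 1-norm. The coordinate bound is then
  -- derived from a bound on this norm.
  obtain ⟨z, hz, hnear⟩ := Set.exists_min_image _
    (fun z : Fin n × Fin t → ℤ => ∑ q, |x q - z q|) hfin ⟨z₁, hz₁, hmin₁⟩
  refine ⟨z, hz, fun q => ?_⟩
  refine (Finset.single_le_sum (f := fun q => |x q - z q|) (fun _ _ => abs_nonneg _)
    (Finset.mem_univ q)).trans ?_
  by_contra! hlarge
  set y : ℕ → ℝ := fun k => flatVec x k - flatVec z k with hy
  have hyq : ∀ q, y (finProdFinEquiv q) = x q - z q := fun q => by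
    simp only [hy, flatVec_equiv]
  have hzs := ((I.feasible_iff ht z).1 hz.1)
  have hxs := ((I.relaxFeasible_iff ht x).1 hx)
  have hzc := hzs.1.cast
  -- If `x - z` were large, it would dominate a nonzero integral kernel vector `g`. Then `z + g` and
  -- `x - g` both stay feasible, since they lie between `z` and `x` coordinatewise.
  obtain ⟨g, hg, hgy, hg1⟩ := exists_integer_kernel_element (m := n * t) (n := n)
    (br := fun k => k / t) (t := t) I.abs_col_le y
    (fun p => by simp only [hy, sub_mul, Finset.sum_sub_distrib, hxs.1.1 p, hzc.1 p, sub_self])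
    (fun i hi => by
      have h1 := hxs.1.2 ⟨i, hi⟩
      have h2 := hzc.2 ⟨i, hi⟩
      simp only at h1 h2
      simp only [hy, Finset.sum_sub_distrib, h1, h2, sub_self])
    (fun i hi => by
      have := sum_brick ht le_rfl hi (fun _ => 1)
      rw [Finset.card_eq_sum_ones, this]
      simp [add_mul])
    (fun k hk hb => absurd (Nat.div_lt_of_lt_mul (by rwa [mul_comm])) (not_lt.2 hb))
    (by
      rw [Finset.sum_range]
      rw [sum_brick_position] at hlarge
      refine hlarge.trans_le (le_of_eq (Finset.sum_congr rfl fun k _ => ?_))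
      simp only [hy, flatVec_coe])
  have hgq : ∀ q : Fin n × Fin t, (0 ≤ (g (finProdFinEquiv q) : ℝ) ∧
      (g (finProdFinEquiv q) : ℝ) ≤ x q - z q) ∨
      ((g (finProdFinEquiv q) : ℝ) ≤ 0 ∧ x q - z q ≤ g (finProdFinEquiv q)) := fun q => by
    have := hgy (finProdFinEquiv q)
    rw [hyq] at this
    exact_mod_cast this
  set z' : Fin n × Fin t → ℤ := fun q => z q + g (finProdFinEquiv q) with hz'
  set x' : Fin n × Fin t → ℝ := fun q => x q - g (finProdFinEquiv q) with hx'
  have hz'f : I.Feasible z' := by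
    refine (I.feasible_iff ht z').2 ⟨(hzs.1.add_ker hg).congr fun k hk => ?_, fun q => ?_⟩
    · have := flatVec_coe z' ⟨k, hk⟩
      have h2 := flatVec_coe z ⟨k, hk⟩
      simp only at this h2
      rw [this, h2, hz']
      simp only [Equiv.apply_symm_apply, Int.cast_id]
    · have h1 := hzs.2 q
      have h2 := hxs.2 q
      have h3 : (I.l q : ℝ) ≤ z q := by exact_mod_cast h1.1
      have h4 : (z q : ℝ) ≤ I.u q := by exact_mod_cast h1.2
      have h5 : (I.l q : ℝ) ≤ (z' q : ℝ) ∧ (z' q : ℝ) ≤ I.u q := by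
        rw [hz']; push_cast
        rcases hgq q with h | h <;> constructor <;> linarith
      exact_mod_cast h5
  have hx'f : I.RelaxFeasible x' := by
    have hneg : InKer (n * t) n (fun k => k / t) I.col fun k => 0 - g k :=
      InKer.sub ⟨by simp, by simp⟩ hg
    refine (I.relaxFeasible_iff ht x').2 ⟨(hxs.1.add_ker hneg).congr fun k hk => ?_, fun q => ?_⟩
    · have := flatVec_coe x' ⟨k, hk⟩
      have h2 := flatVec_coe x ⟨k, hk⟩
      simp only at this h2
      rw [this, h2, hx']
      simp only [Equiv.apply_symm_apply]
      push_cast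
      ring
    · have h1 := hzs.2 q
      have h2 := hxs.2 q
      have h3 : (I.l q : ℝ) ≤ z q := by exact_mod_cast h1.1
      have h4 : (z q : ℝ) ≤ I.u q := by exact_mod_cast h1.2
      rw [hx']
      simp only
      rcases hgq q with h | h <;> constructor <;> linarith
  have hexch : F (fun q => (z' q : ℝ)) + F x' ≤ F (fun q => (z q : ℝ)) + F x := by
    rw [hFφ, hFφ, hFφ, hFφ, ← Finset.sum_add_distrib, ← Finset.sum_add_distrib]
    refine Finset.sum_le_sum fun q _ => ?_
    have := convexOn_exchange (hφ q) (z q) (x q - z q) (g (finProdFinEquiv q)) (hgq q)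
    simp only [add_sub_cancel] at this
    rw [hz', hx']; push_cast
    exact this
  -- By the exchange inequality, what `x` loses by moving to `x - g` is gained by `z + g`;
  -- optimality of `x` excludes a loss of value for `z`.
  have hle : I.f z' ≤ I.f z := by
    have h1 := hopt x' hx'f
    rw [hFf, hFf] at hexch
    have : (I.f z' : ℝ) ≤ I.f z := by linarith
    exact_mod_cast this
  have hz'm : I.IsMinimizer z' := ⟨hz'f, fun w hw => hle.trans (hz.2 w hw)⟩
  -- The new minimizer is closer to `x` by `‖g‖₁ ≥ 1`, contradicting the choice of `z`.
  have hd := hnear z' hz'm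
  have hsum : ∑ q, |x q - z' q| = ∑ q, |x q - z q| - ∑ q : Fin n × Fin t,
      |(g (finProdFinEquiv q) : ℝ)| := by
    rw [← Finset.sum_sub_distrib]
    refine Finset.sum_congr rfl fun q _ => ?_
    rw [hz']; push_cast
    rcases hgq q with h | h
    · rw [abs_of_nonneg (by linarith), abs_of_nonneg (by linarith), abs_of_nonneg h.1]; ring
    · rw [abs_of_nonpos (by linarith), abs_of_nonpos (by linarith), abs_of_nonpos h.1]; ring
  have hg1' : (1 : ℝ) ≤ ∑ q : Fin n × Fin t, |(g (finProdFinEquiv q) : ℝ)| := by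
    rw [sum_brick_position]
    simp only [Equiv.apply_symm_apply]
    rw [← Finset.sum_range fun k => |(g k : ℝ)|]
    exact_mod_cast hg1
  linarith

end Instance

/-! ### The starting point and the correctness of the algorithm -/

theorem flatVec_of_le {α : Type} [Zero α] {n t : ℕ} (ht : 0 < t) (x : Fin n × Fin t → α) {k : ℕ}
    (hk : n * t ≤ k) : flatVec x k = 0 := by
  have : n ≤ k / t := (Nat.le_div_iff_mul_le ht).2 hk
  unfold flatVec embed
  rw [dif_neg]
  rintro ⟨⟨-, h⟩, -⟩
  omega

theorem flatVec_cast {n t : ℕ} (x : Fin n × Fin t → ℤ) (k : ℕ) :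
    flatVec (fun q => (x q : ℝ)) k = ((flatVec x k : ℤ) : ℝ) := by
  unfold flatVec embed
  split_ifs <;> simp

theorem sum_flatten_eq {n t m : ℕ} (hm : n * t ≤ m) {f : (Fin n × Fin t → ℤ) → ℤ}
    {ψ : Fin n × Fin t → ℤ → ℤ} (hf : ∀ x, f x = ∑ p, ψ p (x p)) (y : ℕ → ℤ) :
    ∑ k ∈ range m, flatten ψ k (y k) = f fun q => y (finProdFinEquiv q) := by
  rw [sum_flatten hm, hf, sum_brick_position]
  exact Finset.sum_congr rfl fun k _ => by rw [Equiv.apply_symm_apply]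

namespace Instance

variable {r t n : ℕ} (I : Instance r t n)

theorem Feasible.relaxFeasible {I : Instance r t n} (ht : 0 < t) {z : Fin n × Fin t → ℤ}
    (hz : I.Feasible z) : I.RelaxFeasible fun q => (z q : ℝ) := by
  rw [feasible_iff I ht] at hz
  rw [relaxFeasible_iff I ht]
  refine ⟨hz.1.cast.congr fun k _ => flatVec_cast z k, fun q => ?_⟩
  exact_mod_cast hz.2 q

theorem sum_mul_col (v : ℕ → ℤ) (p : Fin r) :
    ∑ k ∈ range (n * t + r), v k * I.col k p =
      ∑ k ∈ range (n * t), v k * I.col k p + v (n * t + p) := by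
  rw [Finset.sum_range_add]
  congr 1
  rw [Finset.sum_eq_single_of_mem (p : ℕ) (mem_range.2 p.2)]
  · simp [col, tableCol]
  · intro j _ hj
    simp [col, tableCol, hj]

/-- Kernel steps from a solution with slack variables to a solution without. -/
theorem inKer_sub_iff (ht : 0 < t) {x y : ℕ → ℤ}
    (htop : ∀ p : Fin r, ∑ k ∈ range (n * t), x k * I.col k p + x (n * t + p) = I.b (Sum.inl p))
    (hbrick : ∀ i : Fin n, ∑ k ∈ range (n * t) with k / t = i, x k = I.b (Sum.inr (i, 0)))
    (hy : ∀ p < r, y (n * t + p) = 0) :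
    InKer (n * t + r) n (fun k => k / t) I.col (fun k => y k - x k) ↔ I.IsSolution y := by
  have h1 : ∀ p : Fin r, ∑ k ∈ range (n * t + r), (y k - x k) * I.col k p =
      ∑ k ∈ range (n * t), y k * I.col k p - I.b (Sum.inl p) := fun p => by
    rw [sum_mul_col, hy p p.2, ← htop p]
    simp only [sub_mul, Finset.sum_sub_distrib]
    ring
  have h2 : ∀ i : Fin n, ∑ k ∈ range (n * t + r) with k / t = (i : ℕ), (y k - x k) =
      ∑ k ∈ range (n * t) with k / t = (i : ℕ), y k - I.b (Sum.inr (i, 0)) := fun i => by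
    rw [sum_brick ht (by omega) i.2, ← hbrick i, sum_brick ht le_rfl i.2, sum_brick ht le_rfl i.2,
      Finset.sum_sub_distrib]
  constructor
  · rintro ⟨g1, g2⟩
    refine ⟨fun p => ?_, fun i => ?_⟩
    · have := g1 p
      rw [h1] at this
      exact sub_eq_zero.1 this
    · have := g2 i i.2
      rw [h2] at this
      exact sub_eq_zero.1 this
  · rintro ⟨g1, g2⟩
    refine ⟨fun p => ?_, fun i hi => ?_⟩
    · rw [h1]; exact sub_eq_zero.2 (g1 p)
    · exact (h2 ⟨i, hi⟩).trans (sub_eq_zero.2 (g2 ⟨i, hi⟩))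

theorem abs_f_le {x : Fin n × Fin t → ℤ} (hx : ∀ q, I.l q ≤ x q ∧ x q ≤ I.u q) :
    |I.f x| ≤ I.fMax := by
  have := Finset.le_sup (f := fun x => (I.f x).natAbs)
    (Finset.mem_Icc.2 ⟨fun q => (hx q).1, fun q => (hx q).2⟩ : x ∈ Finset.Icc I.l I.u)
  rw [Int.abs_eq_natAbs]
  exact_mod_cast this

/-- The properties of the starting point of the augmentation. -/
theorem start_spec (ht : 0 < t) {W : ℕ} {y : Fin n × Fin t → ℝ} (hy : I.RelaxFeasible y)
    {x lo up : ℕ → ℤ}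
    (h : IsStart r t n W (embed fun p : Fin r × Fin t => I.D p.1 p.2)
      (embed fun p : Fin r × Fin 1 => I.b (Sum.inl p.1))
      (embed fun p : Fin n × Fin 1 => I.b (Sum.inr p)) (embed I.l) (embed I.u) (embed y) x lo up) :
    (∀ k < n * t, |flatVec y k - x k| ≤ 1) ∧
    (∀ k < n * t, flatVec I.l k ≤ x k ∧ x k ≤ flatVec I.u k) ∧
    (∀ p : Fin r, ∑ k ∈ range (n * t), x k * I.col k p + x (n * t + p) = I.b (Sum.inl p)) ∧
    (∀ i : Fin n, ∑ k ∈ range (n * t) with k / t = i, x k = I.b (Sum.inr (i, 0))) ∧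
    ∀ p < r, |x (n * t + p)| ≤ (n * t * I.Delta : ℕ) := by
  have hys := (I.relaxFeasible_iff ht y).1 hy
  have h1 : ∀ k < n * t, |flatVec y k - x k| ≤ 1 := fun k hk => by
    have f1 := Int.floor_le (flatVec y k)
    have f2 := Int.lt_floor_add_one (flatVec y k)
    have f3 := Int.le_ceil (flatVec y k)
    have f4 := Int.ceil_lt_add_one (flatVec y k)
    rw [abs_le]
    rcases h.round k hk with hr | hr <;> rw [hr] <;> unfold flatVec at * <;> constructor <;> linarith
  have h3 : ∀ p : Fin r, ∑ k ∈ range (n * t), x k * I.col k p + x (n * t + p) =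
      I.b (Sum.inl p) := fun p => by
    have e1 := h.slack p p.2
    have e2 := embed_coe (fun p : Fin r × Fin 1 => I.b (Sum.inl p.1)) p 0
    simp only [Fin.val_zero, Nat.cast_zero] at e2
    rw [e2] at e1
    rw [e1]
    have : ∑ k ∈ range (n * t), x k * I.col k p = ∑ k ∈ range (n * t), x k *
        embed (fun p : Fin r × Fin t => I.D p.1 p.2) (p : ℕ) (k % t : ℕ) :=
      Finset.sum_congr rfl fun k hk => by rw [col, tableCol, if_pos (mem_range.1 hk)]
    rw [this]; ring
  refine ⟨h1, fun k hk => ?_, h3, fun i => ?_, fun p hp => ?_⟩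
  · have hb := hys.2 (finProdFinEquiv.symm ⟨k, hk⟩)
    have e1 := flatVec_coe y ⟨k, hk⟩
    have e2 := flatVec_coe I.l ⟨k, hk⟩
    have e3 := flatVec_coe I.u ⟨k, hk⟩
    simp only at e1 e2 e3
    rw [← e1, ← e2, ← e3] at hb
    rcases h.round k hk with hr | hr
    · have hr' : x k = ⌊flatVec y k⌋ := hr
      rw [hr']
      refine ⟨Int.le_floor.2 hb.1, ?_⟩
      have : ((⌊flatVec y k⌋ : ℤ) : ℝ) ≤ ((flatVec I.u k : ℤ) : ℝ) := (Int.floor_le _).trans hb.2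
      exact_mod_cast this
    · have hr' : x k = ⌈flatVec y k⌉ := hr
      rw [hr']
      refine ⟨?_, Int.ceil_le.2 hb.2⟩
      have : ((flatVec I.l k : ℤ) : ℝ) ≤ ((⌈flatVec y k⌉ : ℤ) : ℝ) := hb.1.trans (Int.le_ceil _)
      exact_mod_cast this
  · rw [sum_brick ht le_rfl i.2, h.brick i i.2]
    have e2 := embed_coe (fun p : Fin n × Fin 1 => I.b (Sum.inr p)) i 0
    simpa using e2
  · have e1 := h3 ⟨p, hp⟩
    have e2 := hys.1.1 ⟨p, hp⟩
    simp only at e1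
    -- The relaxed vector satisfies the upper constraints exactly, so the violation is the image of
    -- the rounding error, whose entries are at most one.
    have e3 : (x (n * t + p) : ℝ) =
        ∑ k ∈ range (n * t), (flatVec y k - x k) * (I.col k ⟨p, hp⟩ : ℝ) := by
      simp only [sub_mul, Finset.sum_sub_distrib, e2]
      rw [← e1]; push_cast; ring
    have e4 : |(x (n * t + p) : ℝ)| ≤ (n * t * I.Delta : ℕ) := by
      rw [e3]
      refine (Finset.abs_sum_le_sum_abs _ _).trans ((Finset.sum_le_sum fun k hk => ?_).trans
        (?_ : ∑ k ∈ range (n * t), (I.Delta : ℝ) ≤ _))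
      · rw [abs_mul]
        have g1 := h1 k (mem_range.1 hk)
        have g2 : |(I.col k ⟨p, hp⟩ : ℝ)| ≤ I.Delta := by exact_mod_cast I.abs_col_le k ⟨p, hp⟩
        calc _ ≤ 1 * |(I.col k ⟨p, hp⟩ : ℝ)| := mul_le_mul_of_nonneg_right g1 (abs_nonneg _)
          _ ≤ _ := by rw [one_mul]; exact g2
      · simp
    exact_mod_cast e4

/-- If the integer program is feasible, proximity places a minimizer in the reduced box with zero
slacks. Hence infeasibility in the box implies infeasibility, and an optimum of the box is a global
optimum. If the relaxation is infeasible, so is the integer program. -/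
theorem run_mainCmd (hr : 0 < r) (ht : 0 < t) (hn : 0 < n) {F : (Fin n × Fin t → ℝ) → ℝ}
    (hF : IsSeparableConvexExtension I.f F) {ans : Option (Fin n × Fin t → ℝ)}
    (hans : I.IsRelaxationAnswer F ans) (oo : ℕ) {G V W N e Nst : ℕ}
    (hG : G = 2 * (4 * I.Delta * r + 1) ^ r) (hV : V = I.Delta * G)
    (hW : W = (n * t + 1) * (G + 2)) (hN : N = n * t * (2 * W) + r * (n * t * I.Delta))
    (he : e = n * t + r * I.Delta + (I.fMax.size + 1))
    (hNst : Nst = (G + 1) * (2 * V + 1) ^ (r + 1)) :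
    Run ⟨I.f, ans, oo⟩ mainCmd I.initState (oo + (setupTime r t n I.Delta G V +
      (2 * phaseTime (n * t + r) G N e Nst + (r + 1) * 60 + (n * t + 1) * 40 + 10) + 4))
      I.SolvedBy := by
  have hΔ0 : 0 < I.Delta := by unfold Delta; omega
  refine Run.le (T₁ := oo + (1 + 1 + (setupTime r t n I.Delta G V +
      (2 * phaseTime (n * t + r) G N e Nst + (r + 1) * 60 + (n * t + 1) * 40 + 10) + 2))) ?_
      (by omega)
  refine Run.seq ⟨oo, _, Exec.relax _ _, le_rfl, ?_⟩
  cases ans with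
  | none =>
    refine Run.ite (fun h => ?_) fun _ => Run.straight ?_
    · simp [State.setRelax] at h
    · refine Or.inr ⟨by simp, ?_⟩
      rintro ⟨z, hz⟩
      exact hans ⟨_, hz.relaxFeasible ht⟩
  | some y =>
    obtain ⟨hy, hopt⟩ := hans
    refine Run.ite (fun _ => ?_) fun h => ?_
    swap
    · simp [State.setRelax] at h
    obtain ⟨ψ, hψ, hf⟩ := I.separableConvex
    have hys := (I.relaxFeasible_iff ht y).1 hy
    have hlayer : ∀ k, 0 ≤ layerBound n t V r k := fun k => by
      unfold layerBound
      split_ifs <;> exact packMax_nonneg _ _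
    set S : ℕ → ℕ := fun k => (layerBound n t V r k).toNat with hSdef
    have hS : ∀ k, (S k : ℤ) = layerBound n t V r k := fun k => Int.toNat_of_nonneg (hlayer k)
    set s := (I.initState).setRelax regOk (some y) with hs
    have hD : s.arr arrD = embed fun p : Fin r × Fin t => I.D p.1 p.2 := by
      simp [hs, State.setRelax, initState]
    have hTop : s.arr arrTop = embed fun p : Fin r × Fin 1 => I.b (Sum.inl p.1) := by
      simp [hs, State.setRelax, initState]
    have hBrick : s.arr arrBrick = embed fun p : Fin n × Fin 1 => I.b (Sum.inr p) := by
      simp [hs, State.setRelax, initState]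
    have hL : s.arr arrL = embed I.l := by simp [hs, State.setRelax, initState]
    have hU : s.arr arrU = embed I.u := by simp [hs, State.setRelax, initState]
    have hreal : s.real = embed y := by simp [hs, State.setRelax]
    have hsetup := run_setupCmd (E := ⟨I.f, some y, oo⟩) (s := s) (r := r) (t' := t) (n' := n)
      (Δ := I.Delta) (W := W) (S := S) ht hn (by simp [hs, State.setRelax, initState])
      (by simp [hs, State.setRelax, initState]) (by simp [hs, State.setRelax, initState])
      (fun i _ j _ => by rw [hD]; exact I.abs_embed_lt_Delta _ _) hΔ0
      (fun δ h1 h2 => by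
        rw [hD] at h2
        have : I.Delta ≤ 1 + (δ - 1).toNat := by
          unfold Delta
          refine Nat.add_le_add_left (Finset.sup_le fun p _ => ?_) 1
          have h3 : |I.D p.1 p.2| + 1 ≤ δ := by
            have := h2 p.1 p.1.2 p.2 p.2.2
            rwa [embed_coe] at this
          rw [Int.abs_eq_natAbs] at h3
          omega
        omega) hG hV hW hS (by simp [hs, State.setRelax, initState])
      (by simp [hs, State.setRelax, initState])
      (fun i hi => by
        have h1 := hys.1.2 ⟨i, hi⟩
        rw [sum_brick ht le_rfl hi] at h1
        have h2 := sum_Ico_brick (i := i) ht fun a b => embed y (a : ℤ) (b : ℤ)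
        have h3 := embed_coe (fun p : Fin n × Fin 1 => I.b (Sum.inr p)) ⟨i, hi⟩ 0
        simp only [Fin.val_zero, Nat.cast_zero] at h3
        rw [hreal, hBrick, h3, ← h2, ← h1]
        rfl)
    rw [hD, hTop, hBrick, hL, hU, hreal] at hsetup
    refine Run.le (T₁ := setupTime r t n I.Delta G V +
      (2 * phaseTime (n * t + r) G N e Nst + (r + 1) * 60 + (n * t + 1) * 40 + 10)) ?_
      (Nat.le_refl _)
    refine Run.bind hsetup ?_
    rintro s₁ - ⟨x, lo, up, hready, hstart⟩
    obtain ⟨hnear, hxbox, htop, hbrick, hres⟩ := I.start_spec ht hy hstart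
    have hbox : ∀ k < n * t + r, lo k ≤ x k ∧ x k ≤ up k := by
      intro k hk
      rcases lt_or_ge k (n * t) with h | h
      · rw [hstart.lo_eq k h, hstart.up_eq k h]
        obtain ⟨b1, b2⟩ := hxbox k h
        exact ⟨max_le b1 (by omega), le_min b2 (by omega)⟩
      · obtain ⟨p, rfl⟩ := Nat.exists_eq_add_of_le h
        rw [hstart.lo_slack p (by omega), hstart.up_slack p (by omega)]
        exact ⟨min_le_right _ _, le_max_right _ _⟩
    have hressum : ∑ p ∈ range r, |x (n * t + p)| ≤ (r * (n * t * I.Delta) : ℕ) := by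
      refine (Finset.sum_le_sum fun p hp => hres p (mem_range.1 hp)).trans ?_
      simp
    have hwithin : ∀ y : ℕ → ℤ, (∀ k < n * t, lo k ≤ y k ∧ y k ≤ up k) →
        ∀ q, I.l q ≤ y (finProdFinEquiv q) ∧ y (finProdFinEquiv q) ≤ I.u q := by
      intro y hy q
      have h1 := hy (finProdFinEquiv q) (finProdFinEquiv q).2
      have e1 : embed I.l _ _ = I.l q := flatVec_equiv I.l q
      have e2 : embed I.u _ _ = I.u q := flatVec_equiv I.u q
      rw [hstart.lo_eq _ (finProdFinEquiv q).2, hstart.up_eq _ (finProdFinEquiv q).2, e1, e2] at h1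
      exact ⟨(le_max_left _ _).trans h1.1, h1.2.trans (min_le_left _ _)⟩
    -- every minimizer close to the solution of the relaxation lies in the box
    have hminbox : (∃ z, I.Feasible z) → ∃ z, I.IsMinimizer z ∧
        (∀ k < n * t, lo k ≤ flatVec z k ∧ flatVec z k ≤ up k) ∧
        (∀ p < r, flatVec z (n * t + p) = 0) ∧
        InKer (n * t + r) n (fun k => k / t) I.col (fun k => flatVec z k - x k) := by
      intro hfeas
      obtain ⟨z, hz, hzy⟩ := I.exists_minimizer_near ht hF hy hopt hfeas
      have hzs := (I.feasible_iff ht z).1 hz.1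
      have h0 : ∀ p < r, flatVec z (n * t + p) = 0 := fun p _ => flatVec_of_le ht z (by omega)
      refine ⟨z, hz, fun k hk => ?_, h0, (I.inKer_sub_iff ht htop hbrick h0).2 hzs.1⟩
      have g1 := hnear k hk
      have g2 := hzy (finProdFinEquiv.symm ⟨k, hk⟩)
      have g3 := hzs.2 (finProdFinEquiv.symm ⟨k, hk⟩)
      have e1 := flatVec_coe y ⟨k, hk⟩
      have e2 := flatVec_coe I.l ⟨k, hk⟩
      have e3 := flatVec_coe I.u ⟨k, hk⟩
      have e4 := flatVec_coe z ⟨k, hk⟩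
      simp only at e1 e2 e3 e4
      rw [← e1, ← e4] at g2
      rw [← e2, ← e3, ← e4] at g3
      -- The radius is the proximity bound plus two, which covers the rounding error of at most one.
      have hWr : (W : ℝ) = 2 * ((n * t + 1) * (4 * I.Delta * r + 1) ^ r + n * t) + 2 := by
        rw [hW, hG]; push_cast; ring
      rw [abs_le] at g1 g2
      have g4 : ((x k - W : ℤ) : ℝ) ≤ ((flatVec z k : ℤ) : ℝ) := by push_cast; linarith
      have g5 : ((flatVec z k : ℤ) : ℝ) ≤ ((x k + W : ℤ) : ℝ) := by push_cast; linarith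
      rw [hstart.lo_eq k hk, hstart.up_eq k hk]
      exact ⟨max_le g3.1 (by exact_mod_cast g4), le_min g3.2 (by exact_mod_cast g5)⟩
    refine (run_solveCmd (col := I.col) (N := N) (e := e) (Nst := Nst) hΔ0 I.abs_col_le ht hV hG hS
      hready hψ hf hbox ?_ ?_ ?_ ?_ ?_ ?_).mono le_rfl ?_
    · intro p hp
      rw [hstart.lo_slack p hp, hstart.up_slack p hp]
      exact ⟨min_le_left _ _, le_max_left _ _⟩
    · have : 0 < n * t := Nat.mul_pos hn ht
      have h2 : 0 < W := by rw [hW]; positivity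
      rw [hN]; positivity
    · rw [Finset.sum_range_add]
      have b1 : ∑ k ∈ range (n * t), (up k - lo k) ≤ ∑ k ∈ range (n * t), (2 * W : ℤ) := by
        refine Finset.sum_le_sum fun k hk => ?_
        rw [hstart.lo_eq k (mem_range.1 hk), hstart.up_eq k (mem_range.1 hk)]
        have := min_le_right (embed I.u (k / t : ℕ) (k % t : ℕ)) (x k + W)
        have := le_max_right (embed I.l (k / t : ℕ) (k % t : ℕ)) (x k - W)
        linarith
      have b2 : ∑ p ∈ range r, (up (n * t + p) - lo (n * t + p)) ≤
          ∑ p ∈ range r, |x (n * t + p)| := by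
        refine Finset.sum_le_sum fun p hp => ?_
        rw [hstart.lo_slack p (mem_range.1 hp), hstart.up_slack p (mem_range.1 hp)]
        rcases le_total 0 (x (n * t + p)) with h | h
        · rw [max_eq_right h, min_eq_left h, abs_of_nonneg h]; omega
        · rw [max_eq_left h, min_eq_right h, abs_of_nonpos h]; omega
      have b3 : ∑ k ∈ range (n * t), (2 * W : ℤ) = (n * t * (2 * W) : ℕ) := by simp
      rw [b3] at b1
      rw [hN]
      push_cast at *
      linarith
    · refine hressum.trans_lt ?_
      -- The initial violation is at most `(n * t) * (r * Δ)`. As `a < 2^a`, it suffices that `e`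
      -- contains both factors as summands.
      have h1 : n * t < 2 ^ (n * t) := Nat.lt_two_pow_self
      have h2 : r * I.Delta < 2 ^ (r * I.Delta) := Nat.lt_two_pow_self
      have h3 : r * (n * t * I.Delta) < 2 ^ e := by
        calc r * (n * t * I.Delta) = (n * t) * (r * I.Delta) := by ring
          _ < 2 ^ (n * t) * 2 ^ (r * I.Delta) := Nat.mul_lt_mul'' h1 h2
          _ = 2 ^ (n * t + r * I.Delta) := by rw [pow_add]
          _ ≤ 2 ^ e := Nat.pow_le_pow_right (by norm_num) (by omega)
      exact_mod_cast h3
    · intro v w hv hw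
      rw [sum_flatten_eq (by omega) hf, sum_flatten_eq (by omega) hf]
      have h1 := abs_le.1 (I.abs_f_le (hwithin v hv))
      have h2 := abs_le.1 (I.abs_f_le (hwithin w hw))
      -- Two values of `f` in the box differ by at most twice the maximal absolute value; this
      -- explains the summand `size + 1` of `e`.
      have h3 : 2 * I.fMax < 2 ^ e := by
        calc 2 * I.fMax < 2 * 2 ^ I.fMax.size := by
              have := Nat.lt_size_self I.fMax; omega
          _ = 2 ^ (I.fMax.size + 1) := by rw [pow_succ]; ring
          _ ≤ 2 ^ e := Nat.pow_le_pow_right (by norm_num) (by omega)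
      have h4 : (2 * I.fMax : ℤ) < 2 ^ e := by exact_mod_cast h3
      linarith
    · intro k _
      rw [hNst]
      refine Nat.mul_le_mul_left _ ?_
      have h1 : (S (k + 1) : ℤ) ≤ packMax V (r + 1) := by
        rw [hS]
        unfold layerBound
        split_ifs
        · rw [packMax_succ]
          have : (0 : ℤ) ≤ V * (2 * V + 1) ^ r := by positivity
          linarith
        · exact le_rfl
      have h2 := two_mul_packMax V (r + 1)
      zify
      linarith
    · rintro s₂ - (⟨h0, hnone⟩ | ⟨h1, v, hv, hvbox, hv0, hvker, hvopt⟩)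
      · refine Or.inr ⟨h0, fun hfeas => ?_⟩
        obtain ⟨z, -, z1, z2, z3⟩ := hminbox hfeas
        exact hnone _ z1 z2 z3
      · refine Or.inl ⟨h1, ?_⟩
        have hread : readVec n t (s₂.arr 0) = fun q => v (finProdFinEquiv q) := by
          funext q
          have := readVec_symm (s₂.arr 0) (finProdFinEquiv q)
          rw [Equiv.symm_apply_apply] at this
          rw [this]
          exact hv _ (finProdFinEquiv q).2
        have hsol := (I.inKer_sub_iff ht htop hbrick hv0).1 hvker
        have hfeas : I.Feasible (readVec n t (s₂.arr 0)) := by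
          rw [feasible_iff I ht, hread]
          exact ⟨hsol.congr fun k hk => flatVec_comp v hk, hwithin v hvbox⟩
        refine ⟨hfeas, fun w hw => ?_⟩
        obtain ⟨z, hz, z1, z2, z3⟩ := hminbox ⟨w, hw⟩
        have h2 := hvopt _ z1 z2 z3
        rw [sum_flatten_eq (by omega) hf, sum_flatten_eq (by omega) hf] at h2
        simp only [flatVec_equiv] at h2
        rw [hread]
        exact h2.trans (hz.2 w hw)

end Instance

/-! ### The running time -/

/-- `B` stands for `2V + 1` and dominates all parameters free of `n` and `t`; the preparation is
then linear in `n * t`. -/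
theorem setupTime_le {r t n Δ G V B : ℕ} (ht : 0 < t) (hn : 0 < n) (hr : r + 2 ≤ B)
    (hΔ : Δ + 1 ≤ B) (hG : G + 2 ≤ B) (hV : V + 1 ≤ B) (ha : 4 * Δ * r + 3 ≤ B) :
    setupTime r t n Δ G V ≤ 2400 * (n * t * B ^ 3) := by
  set K := n * t with hK
  have hKt : t ≤ K := Nat.le_mul_of_pos_left t hn
  have hKn : n ≤ K := Nat.le_mul_of_pos_right n ht
  have hB : 1 ≤ B := by omega
  have hK1 : 1 ≤ K := by omega
  have p1 : K * B ≤ K * B ^ 3 := Nat.mul_le_mul_left _ (Nat.le_self_pow (by norm_num) B)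
  have p2 : K * B ^ 2 ≤ K * B ^ 3 :=
    Nat.mul_le_mul_left _ (Nat.pow_le_pow_right hB (by norm_num))
  have p3 : B ^ 2 ≤ K * B ^ 2 := Nat.le_mul_of_pos_left _ hK1
  have p4 : B ≤ K * B := Nat.le_mul_of_pos_left _ hK1
  have p5 : K ≤ K * B := Nat.le_mul_of_pos_right _ hB
  have p6 : B ≤ B ^ 2 := Nat.le_self_pow (by norm_num) B
  have e1 : (r + 1) * ((t + 1) * 70) ≤ 140 * (K * B) := by
    calc (r + 1) * ((t + 1) * 70) ≤ B * ((K + K) * 70) := by gcongr; omega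
      _ = _ := by ring
  have e2 : (r + 1) * ((4 * Δ * r + 3) * 60) ≤ 60 * B ^ 2 := by
    calc (r + 1) * ((4 * Δ * r + 3) * 60) ≤ B * (B * 60) := by gcongr; omega
      _ = _ := by ring
  have e3 : (r + 2) * ((V + 1) * 220) ≤ 220 * B ^ 2 := by
    calc (r + 2) * ((V + 1) * 220) ≤ B * (B * 220) := by gcongr
      _ = _ := by ring
  have e4 : (K + r + 1) * ((r + 1) * ((Δ + 1) * 70) + (G + 2) * 40 + 160) ≤ 540 * (K * B ^ 3) := by
    calc (K + r + 1) * ((r + 1) * ((Δ + 1) * 70) + (G + 2) * 40 + 160)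
        ≤ (K * B + K * B) * (B * (B * 70) + B ^ 2 * 40 + B ^ 2 * 160) := by
          gcongr <;> first | omega | nlinarith
      _ = _ := by ring
  have e5 : (n + 1) * ((t + 1) * 80 + 11) ≤ 342 * K := by
    calc (n + 1) * ((t + 1) * 80 + 11) ≤ (n + n) * ((t + t) * 80 + 11 * t) := by gcongr <;> omega
      _ = _ := by rw [hK]; ring
  have e6 : (r + 1) * ((K + 1) * ((Δ + 1) * 80) + 60) ≤ 220 * (K * B ^ 2) := by
    calc (r + 1) * ((K + 1) * ((Δ + 1) * 80) + 60)
        ≤ B * ((K + K) * (B * 80) + (K * B) * 60) := by gcongr <;> omega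
      _ = _ := by ring
  unfold setupTime
  rw [← hK]
  omega

/-- Of the three factors `n * t`, two come from the number `N` of augmentations (the number of
variables times the radius of the box) and one from the layers of the dynamic program. A layer costs
about `B^(r+3)`: its states times the values tried for each. -/
theorem phaseTime_le {r t n Δ G W N e Nst L B : ℕ} (ht : 0 < t) (hn : 0 < n) (hL : 0 < L)
    (hr : r + 2 ≤ B) (hG : G + 2 ≤ B) (hrΔ : r * Δ ≤ B)
    (hW : W = (n * t + 1) * (G + 2)) (hN : N = n * t * (2 * W) + r * (n * t * Δ))
    (he : e ≤ L + r * Δ) (hNst : Nst = (G + 1) * B ^ (r + 1)) :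
    phaseTime (n * t + r) G N e Nst ≤ 25000 * ((n * t) ^ 3 * L * B ^ (r + 7)) := by
  set K := n * t with hK
  have hB : 1 ≤ B := by omega
  have hK1 : 1 ≤ K := Nat.mul_pos hn ht
  have hW' : W ≤ 2 * (K * B) := by
    calc W ≤ (K + K) * B := by rw [hW]; gcongr
      _ = _ := by ring
  have hN' : N ≤ 5 * (K ^ 2 * B) := by
    calc N = K * (2 * W) + K * (r * Δ) := by rw [hN]; ring
      _ ≤ K * (2 * (2 * (K * B))) + K * (K * B) :=
        Nat.add_le_add (by gcongr)
          (Nat.mul_le_mul_left _ (hrΔ.trans (Nat.le_mul_of_pos_left _ hK1)))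
      _ = _ := by ring
  have he' : e ≤ 2 * (L * B) := by
    calc e ≤ L * B + L * B := he.trans (Nat.add_le_add (Nat.le_mul_of_pos_right _ hB)
          (hrΔ.trans (Nat.le_mul_of_pos_left _ hL)))
      _ = _ := by ring
  have h1 : 1 ≤ K ^ 2 * L * B ^ 2 := Nat.mul_pos (Nat.mul_pos (by positivity) hL) (by positivity)
  have hNe : N * e + 1 ≤ 11 * (K ^ 2 * L * B ^ 2) := by
    calc N * e + 1 ≤ 5 * (K ^ 2 * B) * (2 * (L * B)) + K ^ 2 * L * B ^ 2 := by gcongr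
      _ = _ := by ring
  have hm : K + r + 1 ≤ 2 * (K * B) := by
    have := Nat.le_mul_of_pos_left B hK1
    have := Nat.le_mul_of_pos_right K hB
    omega
  have hNst' : Nst + 1 ≤ B ^ (r + 2) := by
    calc Nst + 1 ≤ (G + 1) * B ^ (r + 1) + B ^ (r + 1) := by
          rw [hNst]; gcongr; exact Nat.one_le_pow _ _ hB
      _ = (G + 2) * B ^ (r + 1) := by ring
      _ ≤ B * B ^ (r + 1) := by gcongr
      _ = _ := by ring
  have hP : 1 ≤ B ^ (r + 3) := Nat.one_le_pow _ _ hB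
  have hbr : (Nst + 1) * ((2 * G + 2) * 120 + 120) + 81 ≤ 321 * B ^ (r + 3) := by
    calc (Nst + 1) * ((2 * G + 2) * 120 + 120) + 81 ≤ B ^ (r + 2) * ((2 * B) * 120) +
          81 * B ^ (r + 3) := by gcongr <;> omega
      _ = _ := by ring
  have hbr2 : (2 * G + 2) * 160 ≤ 320 * B ^ (r + 3) := by
    have : B ≤ B ^ (r + 3) := Nat.le_self_pow (by omega) B
    omega
  have hQ : 1 ≤ K * B ^ (r + 4) := Nat.mul_pos hK1 (by positivity)
  have hinner : (K + r + 1) * ((2 * G + 2) * 160) +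
      (K + r + 1) * ((Nst + 1) * ((2 * G + 2) * 120 + 120) + 81) + 20 ≤
      1302 * (K * B ^ (r + 4)) := by
    calc (K + r + 1) * ((2 * G + 2) * 160) +
          (K + r + 1) * ((Nst + 1) * ((2 * G + 2) * 120 + 120) + 81) + 20
        ≤ 2 * (K * B) * (320 * B ^ (r + 3)) + 2 * (K * B) * (321 * B ^ (r + 3)) +
          20 * (K * B ^ (r + 4)) := by
          gcongr; omega
      _ = _ := by ring
  have hR : 1 ≤ K ^ 3 * L * B ^ (r + 6) := Nat.mul_pos (Nat.mul_pos (by positivity) hL) (by positivity)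
  calc phaseTime (K + r) G N e Nst
      ≤ 11 * (K ^ 2 * L * B ^ 2) * (1302 * (K * B ^ (r + 4))) + 10 * (K ^ 3 * L * B ^ (r + 6)) := by
        unfold phaseTime; gcongr; omega
    _ = 14332 * (K ^ 3 * L * B ^ (r + 6)) := by ring
    _ ≤ 25000 * (K ^ 3 * L * B ^ (r + 7)) := by gcongr <;> omega

/-- The factor `5` is absorbed into the base by `5 * q ≤ q^4` for `q ≥ 2`. For `q = 1` this is
impossible, but then `r = 1` and the power of `5` is a constant. -/
theorem pow_five_mul_le {q r E : ℕ} (hq : 0 < q) (h : q = 1 → r = 1) :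
    (5 * q) ^ (E * r ^ 2) ≤ 5 ^ E * q ^ (4 * E * r ^ 2) := by
  rcases Nat.lt_or_ge 1 q with h1 | h1
  · have : 5 * q ≤ q ^ 4 := by
      have : 2 ^ 3 ≤ q ^ 3 := Nat.pow_le_pow_left h1 3
      calc 5 * q ≤ q ^ 3 * q := Nat.mul_le_mul_right _ (by omega)
        _ = q ^ 4 := by ring
    calc (5 * q) ^ (E * r ^ 2) ≤ (q ^ 4) ^ (E * r ^ 2) := Nat.pow_le_pow_left this _
      _ = q ^ (4 * E * r ^ 2) := by rw [← pow_mul, mul_assoc]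
      _ ≤ 5 ^ E * q ^ (4 * E * r ^ 2) := Nat.le_mul_of_pos_left _ (by positivity)
  · obtain rfl : q = 1 := by omega
    simp [h rfl]

namespace Instance

variable {r t n : ℕ} (I : Instance r t n)

/-- Every entry of `l` takes at least one bit, so the encoding length also pays for the summand `n *
t` of `e`. -/
theorem card_add_size_le : n * t + (I.fMax.size + 1) ≤ I.size := by
  have h1 : ∀ z, 1 ≤ encLength z := fun z => by unfold encLength; omega
  have h2 : n * t ≤ ∑ k, encLength (I.l k) := by
    calc n * t = ∑ _k : Fin n × Fin t, 1 := by simp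
      _ ≤ _ := Finset.sum_le_sum fun k _ => h1 _
  have h3 : encLength (I.fMax : ℤ) = I.fMax.size + 1 := by
    simp [encLength, add_comm]
  unfold size
  omega

theorem time_le (hr : 0 < r) (ht : 0 < t) (hn : 0 < n) {G V W N e Nst : ℕ}
    (hG : G = 2 * (4 * I.Delta * r + 1) ^ r) (hV : V = I.Delta * G)
    (hW : W = (n * t + 1) * (G + 2)) (hN : N = n * t * (2 * W) + r * (n * t * I.Delta))
    (he : e = n * t + r * I.Delta + (I.fMax.size + 1))
    (hNst : Nst = (G + 1) * (2 * V + 1) ^ (r + 1)) :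
    setupTime r t n I.Delta G V +
      (2 * phaseTime (n * t + r) G N e Nst + (r + 1) * 60 + (n * t + 1) * 40 + 10) + 4 ≤
      53000 * 5 ^ 16 * (t ^ (64 * r) * (I.Delta * r) ^ (64 * r ^ 2) * (n ^ 3 * I.size)) := by
  set Δ := I.Delta with hΔ
  set L := I.size with hLdef
  have hΔ0 : 1 ≤ Δ := by rw [hΔ]; unfold Delta; omega
  have hsize := I.card_add_size_le
  have hL : 0 < L := by omega
  set a := 4 * Δ * r + 1 with ha
  set B := 2 * V + 1 with hB
  have hΔr : r ≤ Δ * r := Nat.le_mul_of_pos_left _ hΔ0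
  have hΔr' : Δ ≤ Δ * r := Nat.le_mul_of_pos_right _ hr
  have haG : 2 * a ≤ G := by
    rw [hG]; exact Nat.mul_le_mul_left _ (Nat.le_self_pow hr.ne' a)
  have hGV : G ≤ V := by rw [hV]; exact Nat.le_mul_of_pos_left _ hΔ0
  have ha' : a = 4 * (Δ * r) + 1 := by rw [ha]; ring
  have hrΔ : r * Δ ≤ B := by rw [mul_comm]; omega
  have t1 := setupTime_le (Δ := Δ) (G := G) (V := V) (B := B) (r := r) ht hn (by omega) (by omega)
    (by omega) (by omega) (by omega)
  have t2 := phaseTime_le (B := B) (e := e) (L := L) ht hn hL (by omega) (by omega) hrΔ hW hN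
    (by omega) hNst
  -- Uses `4Δr + 1 ≤ 5Δr`, valid because `Δ ≥ 1` and `r ≥ 1`.
  have hBβ : B ≤ (5 * (Δ * r)) ^ (2 * r) := by
    calc B = 4 * Δ * a ^ r + 1 := by rw [hB, hV, hG]; ring
      _ ≤ 4 * (Δ * r) * (5 * (Δ * r)) ^ r + (Δ * r) * (5 * (Δ * r)) ^ r := by
        gcongr
        · omega
        · exact Nat.mul_pos (by omega) (Nat.pow_pos (by omega))
      _ = (5 * (Δ * r)) ^ (r + 1) := by ring
      _ ≤ _ := Nat.pow_le_pow_right (by omega) (by omega)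
  have hB1 : 1 ≤ B := by omega
  set K := n * t with hK
  have hK1 : 1 ≤ K := Nat.mul_pos hn ht
  set M := K ^ 3 * L * B ^ (r + 7) with hM
  have m1 : K * B ^ 3 ≤ M := by
    calc K * B ^ 3 ≤ K ^ 3 * B ^ (r + 7) := Nat.mul_le_mul (Nat.le_self_pow (by norm_num) K)
          (Nat.pow_le_pow_right hB1 (by omega))
      _ ≤ K ^ 3 * L * B ^ (r + 7) := Nat.mul_le_mul_right _ (Nat.le_mul_of_pos_right _ hL)
  have m2 : B ≤ K * B ^ 3 :=
    (Nat.le_self_pow (by norm_num : 3 ≠ 0) B).trans (Nat.le_mul_of_pos_left _ hK1)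
  have m3 : K ≤ K * B ^ 3 := Nat.le_mul_of_pos_right _ (by positivity)
  have hrB : r + 1 ≤ B := by omega
  have hMle : M ≤ 5 ^ 16 * (t ^ (64 * r) * (Δ * r) ^ (64 * r ^ 2) * (n ^ 3 * L)) := by
    -- The exponent is `r + 7 ≤ 8r`, and `B` itself has exponent `2r` over `5Δr`. This yields
    -- `16r²`, and `64r²` once the factor `5` has been absorbed.
    have b1 : B ^ (r + 7) ≤ 5 ^ 16 * (Δ * r) ^ (64 * r ^ 2) := by
      calc B ^ (r + 7) ≤ B ^ (8 * r) := Nat.pow_le_pow_right hB1 (by omega)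
        _ ≤ ((5 * (Δ * r)) ^ (2 * r)) ^ (8 * r) := Nat.pow_le_pow_left hBβ _
        _ = (5 * (Δ * r)) ^ (16 * r ^ 2) := by rw [← pow_mul]; ring_nf
        _ ≤ 5 ^ 16 * (Δ * r) ^ (4 * 16 * r ^ 2) :=
          pow_five_mul_le (by omega) fun h => Nat.eq_one_of_mul_eq_one_left h
        _ = _ := by norm_num
    have b2 : t ^ 3 ≤ t ^ (64 * r) := Nat.pow_le_pow_right ht (by omega)
    calc M = t ^ 3 * n ^ 3 * L * B ^ (r + 7) := by rw [hM, hK]; ring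
      _ ≤ t ^ (64 * r) * n ^ 3 * L * (5 ^ 16 * (Δ * r) ^ (64 * r ^ 2)) := by gcongr
      _ = _ := by ring
  have htot : setupTime r t n Δ G V +
      (2 * phaseTime (K + r) G N e Nst + (r + 1) * 60 + (K + 1) * 40 + 10) + 4 ≤ 53000 * M := by
    omega
  refine htot.trans ((Nat.mul_le_mul_left _ hMle).trans (le_of_eq ?_))
  ring

end Instance

end CombNFold

theorem theorem1 :
    ∃ (P : CombNFold.Cmd) (C c : ℕ),
      ∀ (r t n : ℕ), 0 < r → 0 < t → 0 < n →
      ∀ (I : CombNFold.Instance r t n)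
        (F : (Fin n × Fin t → ℝ) → ℝ), CombNFold.IsSeparableConvexExtension I.f F →
      ∀ (ans : Option (Fin n × Fin t → ℝ)), I.IsRelaxationAnswer F ans →
      ∀ (oo : ℕ),
        ∃ (T : ℕ) (s : CombNFold.State),
          CombNFold.Exec I.f ans oo P I.initState T s ∧
          I.SolvedBy s ∧
          T ≤ C * (t ^ (c * r) * (I.Delta * r) ^ (c * r ^ 2) * (n ^ 3 * I.size)) + oo := by
  refine ⟨CombNFold.mainCmd, 53000 * 5 ^ 16, 64, fun r t n hr ht hn I F hF ans hans oo => ?_⟩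
  -- The six `rfl` fix `G`, `V`, `W`, `N`, `e` and `Nst` at their defining formulas, and the time
  -- bound is instantiated at the same values.
  obtain ⟨T, s, hexec, hT, hs⟩ := I.run_mainCmd hr ht hn hF hans oo rfl rfl rfl rfl rfl rfl
  have := I.time_le hr ht hn rfl rfl rfl rfl rfl rfl
  exact ⟨T, s, hexec, hs, by omega⟩
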